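/- **Market.** Let $(\Omega,\mathcal F,\mathbb P)$ be a complete probability space and $0<T<\infty$. Let $N$ be a homogeneous Poisson process on $[0,T]$ with intensity $\lambda>0$, and let $Y_1,Y_2,\dots$ be i.i.d. positive square-integrable claim sizes with law $F$, independent of $N$. Let $T_i$ be the time of the $i$-th claim and let $(\mathcal F_t)$ be the usual augmentation of the filtration generated by claim times and claim sizes. Write $v(dy)=\lambda\,dF(y)$, $a_Y=\int y\,dF(y)$, $\sigma_Y^2=\int y^2\,dF(y)$ and $c=(1+\theta)\lambda a_Y$, where $\theta>0$; let $\eta\in\mathbb R$ and $\gamma_I>0$. Let $\rho_I,\rho_{R1},\rho_{R2}$ be deterministic, measurable, positive and bounded interest rates on $[0,T]$, and let $x_0^I,x_0^{R1},x_0^{R2}>0$ be the initial assets of the insurer and the two reinsurers. For treaties $l_1,l_2$ and premium loadings $\xi_1,\xi_2$, the premium rates are $p_1=\int l_1\,dv+\xi_1\int l_1^2\,dv$ (variance principle) and $p_2=(1+\xi_2)\int l_2\,dv$ (expected value principle), and the surplus processes solve $$dX_I=[c-p_1-p_2+\rho_I X_I]\,dt-\int (y-l_1-l_2)\,N(dt,dy),\qquad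 dX_{Rj}=[p_j+\rho_{Rj}X_{Rj}]\,dt-\int l_j\,N(dt,dy),$$ where $N(dt,dy)$ is the random measure with atoms $(T_i,Y_i)$. The market strategy $\{l_1,l_2,\xi_1,\xi_2\}$ is *admissible* if 1. $l_1,l_2\ge 0$ are predictable with $l_1(t,y)+l_2(t,y)\le y$ for $t\in[0,T]$, $y\ge0$; 2. $\xi_1,\xi_2$ are predictable with $\xi_1(t)\in[\theta a_Y/\sigma_Y^2,\ \eta a_Y/\sigma_Y^2]$ and $\xi_2(t)\in[\theta,\eta]$ for $t\in[0,T]$; 3. the three equations, started at time $0$ from $x_0^I,x_0^{R1},x_0^{R2}$, have unique strong (adapted càdlàg) solutions, and these satisfy $\mathbb E[\sup_{t\le T}|X(t)|^2]<\infty$. The insurer's objective is $$J_I(t,x;l_1,l_2,\xi_1,\xi_2)=\mathbb E[X_I(T)\mid\mathcal F_t]-\tfrac{\gamma_I}{2}\operatorname{Var}[X_I(T)\mid\mathcal F_t],$$ where $X_I$ is the insurer's surplus started from $X_I(t)=x$. **Equilibrium.** $\{l_1,l_2\}$ is an *equilibrium reinsurance strategy associated with* $(\xi_1,\xi_2)$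 if $\{l_1,l_2,\xi_1,\xi_2\}$ is admissible and the following holds for all $t\in[0,T]$, $x\in\mathbb R$ and functions $\tilde l_1,\tilde l_2$ of $y$. Let $l_j^\varepsilon$ be equal to $\tilde l_j$ on $[t,t+\varepsilon)$ and to $l_j$ at other times. Then, along every sequence $\varepsilon\to0^+$ for which the strategies $\{l^\varepsilon_1,l^\varepsilon_2,\xi_1,\xi_2\}$ are admissible, almost surely $$\liminf_{\varepsilon\to0^+}\frac{J_I(t,x;l_1,l_2,\xi_1,\xi_2)-J_I(t,x;l_1^\varepsilon,l_2^\varepsilon,\xi_1,\xi_2)}{\varepsilon}\ \ge\ 0 .$$ **Proposition 3.2.** Let $\xi_1,\xi_2$ be deterministic premium strategies satisfying condition 2, and put $$q(t)=\frac{\gamma_I e^{\int_t^T\rho_I(s)ds}}{2\xi_1(t)+\gamma_I e^{\int_t^T\rho_I(s)ds}},\qquad d(t)=\frac{\xi_2(t)}{\gamma_I e^{\int_t^T\rho_I(s)ds}}+\frac{\xi_2(t)}{2\xi_1(t)},$$ $$l_1^*(t,y)=\begin{cases}q(t)\,y,& y\le d(t),\\ \dfrac{\xi_2(t)}{2\xi_1(t)},&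 y>d(t),\end{cases}\qquad l_2^*(t,y)=\begin{cases}0,& y\le d(t),\\ y-d(t),& y>d(t).\end{cases}$$ Then $\{l_1^*,l_2^*\}$ is an equilibrium reinsurance strategy associated with $(\xi_1,\xi_2)$; in particular it is admissible. It is the only deterministic one: every equilibrium reinsurance strategy $\{l_1,l_2\}$ associated with $(\xi_1,\xi_2)$ that consists of deterministic functions of $(t,y)$ satisfies $l_j(t,y)=l_j^*(t,y)$, $j=1,2$, for Lebesgue-almost every $t\in[0,T]$ and $F$-almost every $y$. -/

import Mathlib

open MeasureTheory ProbabilityTheory Filter Topology Set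
open scoped NNReal ENNReal

noncomputable section

/-- `N` is a homogeneous Poisson process with intensity `lam` on the time interval `[0, T]`:
a right-continuous counting process started at `0` whose increments `N t - N s` are Poisson
distributed with parameter `lam * (t - s)` and independent of the past `(N u)_{u ≤ s}`.
Only the restriction of `N` to `[0, T]` matters. -/
structure IsPoissonProcessOn {Ω : Type*} [MeasurableSpace Ω] (P : Measure Ω)
    (T lam : ℝ≥0) (N : ℝ≥0 → Ω → ℕ) : Prop where
  measurable : ∀ t ≤ T, Measurable (N t)
  zero : ∀ ω, N 0 ω = 0
  mono : ∀ ω s t, s ≤ t → t ≤ T → N s ω ≤ N t ω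
  rightCont : ∀ ω, ∀ s < T, ContinuousWithinAt (fun u => N u ω) (Ici s) s
  law : ∀ s t, s ≤ t → t ≤ T →
    P.map (fun ω => N t ω - N s ω) = poissonMeasure (lam * (t - s))
  indep : ∀ s t, s ≤ t → t ≤ T →
    IndepFun (fun ω (u : Iic s) => N u ω) (fun ω => N t ω - N s ω) P

/-- A deterministic interest rate that is positive and bounded on `[0, T]`. -/
structure IsInterestRate (T : ℝ≥0) (ρ : ℝ → ℝ) : Prop where
  measurable : Measurable ρ
  pos : ∀ s ∈ Icc (0 : ℝ) T, 0 < ρ s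
  bdd : ∃ K, ∀ s ∈ Icc (0 : ℝ) T, ρ s ≤ K

/-- The insurance market: the horizon `T`, the claim number process `N`, the claim sizes
`Y 0, Y 1, …` (`Y i` is the size of claim number `i + 1`), the insurer's loading `θ`, the cap `η`
for the loadings of the reinsurers, the insurer's risk aversion `γ`, and the interest rates and
initial assets of the insurer and the two reinsurers. -/
structure InsuranceMarket {Ω : Type*} [MeasurableSpace Ω] (P : Measure Ω) where
  T : ℝ≥0
  T_pos : 0 < T
  lam : ℝ≥0
  lam_pos : 0 < lam
  N : ℝ≥0 → Ω → ℕ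
  poisson : IsPoissonProcessOn P T lam N
  Y : ℕ → Ω → ℝ
  Y_measurable : ∀ i, Measurable (Y i)
  Y_pos : ∀ i, ∀ᵐ ω ∂P, 0 < Y i ω
  Y_memLp : ∀ i, MemLp (Y i) 2 P
  Y_indep : iIndepFun Y P
  Y_ident : ∀ i, IdentDistrib (Y i) (Y 0) P P
  N_indep_Y : IndepFun (fun ω (t : Iic T) => N t ω) (fun ω i => Y i ω) P
  θ : ℝ
  θ_pos : 0 < θ
  η : ℝ
  γ : ℝ
  γ_pos : 0 < γ
  ρI : ℝ → ℝ
  ρI_rate : IsInterestRate T ρI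
  ρR1 : ℝ → ℝ
  ρR1_rate : IsInterestRate T ρR1
  ρR2 : ℝ → ℝ
  ρR2_rate : IsInterestRate T ρR2
  xI : ℝ
  xI_pos : 0 < xI
  xR1 : ℝ
  xR1_pos : 0 < xR1
  xR2 : ℝ
  xR2_pos : 0 < xR2

namespace InsuranceMarket

variable {Ω : Type*} [MeasurableSpace Ω] {P : Measure Ω} (M : InsuranceMarket P)

/-- The common law `dF` of the claim sizes. -/
def claimLaw : Measure ℝ := P.map (M.Y 0)

/-- The compensator `v(dy) = lam dF(y)`; it is carried by `(0, ∞)`. -/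
def v : Measure ℝ := M.lam • M.claimLaw

/-- `a_Y`, the first moment of the claim size. -/
def aY : ℝ := ∫ y, y ∂M.claimLaw

/-- `σ_Y²`, the second moment of the claim size. -/
def sigmaSq : ℝ := ∫ y, y ^ 2 ∂M.claimLaw

/-- The premium rate `c = (1 + θ) lam a_Y` received by the insurer. -/
def c : ℝ := (1 + M.θ) * M.lam * M.aY

/-- The time at which claim number `i + 1` occurs (used only where it occurs before `T`). -/
def arrival (i : ℕ) (ω : Ω) : ℝ≥0 := sInf {s : ℝ≥0 | s ≤ M.T ∧ i < M.N s ω}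

/-- The information on claim times and sizes up to time `t`: generated by the events
"claim number `i + 1` has occurred by time `s` and its size lies in `B`", `s ≤ t`. -/
@[reducible] def history (t : ℝ≥0) : MeasurableSpace Ω :=
  MeasurableSpace.generateFrom
    {A | ∃ s, s ≤ t ∧ s ≤ M.T ∧ ∃ (i : ℕ) (B : Set ℝ), MeasurableSet B ∧
      A = {ω | i < M.N s ω ∧ M.Y i ω ∈ B}}

/-- The null sets of `P`. -/
@[reducible] def nullSets (_M : InsuranceMarket P) : MeasurableSpace Ω :=
  MeasurableSpace.generateFrom {A | MeasurableSet A ∧ P A = 0}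

/-- The history, completed with the null sets. -/
def completedHistory : Filtration ℝ≥0 ‹MeasurableSpace Ω› where
  seq t := M.history t ⊔ M.nullSets
  mono' := by
    intro s t hst
    refine sup_le_sup_right (MeasurableSpace.generateFrom_mono ?_) _
    rintro A ⟨u, hu, huT, h⟩
    exact ⟨u, hu.trans hst, huT, h⟩
  le' := by
    intro t
    refine sup_le (MeasurableSpace.generateFrom_le ?_) (MeasurableSpace.generateFrom_le ?_)
    · rintro A ⟨s, -, hsT, i, B, hB, rfl⟩
      exact ((M.poisson.measurable s hsT) (measurableSet_Ioi (a := i))).inter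
        (M.Y_measurable i hB)
    · rintro A ⟨hA, -⟩
      exact hA

/-- The filtration of the market: the usual augmentation (completed and right-continuous) of the
filtration generated by the claim times and claim sizes. -/
def filtration : Filtration ℝ≥0 ‹MeasurableSpace Ω› := M.completedHistory.rightCont

/-- `X` is a strong solution on `[t, T]` of
`dX(s) = [b(s) + ρ(s) X(s)] ds - ∫ h(s, y) N(ds, dy)`, `X(t) = x`:
adapted, càdlàg, and solving the integrated equation, where the integral of `h` over `(t, s]`
against the Poisson random measure is the sum over the claims that occur in `(t, s]`. -/
structure IsStrongSolution (ρ : ℝ → ℝ) (b : ℝ≥0 → Ω → ℝ) (h : ℝ≥0 → ℝ → Ω → ℝ)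
    (t : ℝ≥0) (x : ℝ) (X : ℝ≥0 → Ω → ℝ) : Prop where
  adapted : ∀ s ∈ Icc t M.T, StronglyMeasurable[M.filtration s] (X s)
  cadlag : ∀ᵐ ω ∂P,
    (∀ s ∈ Ico t M.T, ContinuousWithinAt (fun u => X u ω) (Ici s) s) ∧
    (∀ s ∈ Ioc t M.T, ∃ a, Tendsto (fun u => X u ω) (𝓝[<] s) (𝓝 a))
  integrable : ∀ᵐ ω ∂P, IntervalIntegrable
    (fun r : ℝ => b r.toNNReal ω + ρ r * X r.toNNReal ω) volume t M.T
  eq : ∀ᵐ ω ∂P, ∀ s ∈ Icc t M.T,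
    X s ω = x + (∫ r in (t : ℝ)..s, (b r.toNNReal ω + ρ r * X r.toNNReal ω))
      - ∑ i ∈ Finset.Ico (M.N t ω) (M.N s ω), h (M.arrival i ω) (M.Y i ω) ω

/-- The equation of `IsStrongSolution`, started at time `0`, has a solution which is square
integrable uniformly in time, and any other solution is indistinguishable from it. -/
def HasUniqueSolution (ρ : ℝ → ℝ) (b : ℝ≥0 → Ω → ℝ) (h : ℝ≥0 → ℝ → Ω → ℝ) (x : ℝ) : Prop :=
  ∃ X : ℝ≥0 → Ω → ℝ, M.IsStrongSolution ρ b h 0 x X ∧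
    (∫⁻ ω, ⨆ s ∈ Icc (0 : ℝ≥0) M.T, ‖X s ω‖ₑ ^ 2 ∂P) < ∞ ∧
    ∀ X', M.IsStrongSolution ρ b h 0 x X' → ∀ᵐ ω ∂P, ∀ s ∈ Icc (0 : ℝ≥0) M.T, X' s ω = X s ω

/-- The premium rate of reinsurer 1 (variance principle) for the treaty `l` and loading `ξ`. -/
def p1 (l : ℝ≥0 → ℝ → Ω → ℝ) (ξ : ℝ≥0 → Ω → ℝ) (t : ℝ≥0) (ω : Ω) : ℝ :=
  (∫ y, l t y ω ∂M.v) + ξ t ω * ∫ y, l t y ω ^ 2 ∂M.v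

/-- The premium rate of reinsurer 2 (expected value principle). -/
def p2 (l : ℝ≥0 → ℝ → Ω → ℝ) (ξ : ℝ≥0 → Ω → ℝ) (t : ℝ≥0) (ω : Ω) : ℝ :=
  (1 + ξ t ω) * ∫ y, l t y ω ∂M.v

/-- A premium strategy of reinsurer 1: predictable, with values in `[θ a_Y/σ_Y², η a_Y/σ_Y²]`. -/
def IsPremiumStrategy1 (ξ : ℝ≥0 → Ω → ℝ) : Prop :=
  IsStronglyPredictable M.filtration ξ ∧
    ∀ t ≤ M.T, ∀ ω, ξ t ω ∈ Icc (M.θ * M.aY / M.sigmaSq) (M.η * M.aY / M.sigmaSq)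

/-- A premium strategy of reinsurer 2: predictable, with values in `[θ, η]`. -/
def IsPremiumStrategy2 (ξ : ℝ≥0 → Ω → ℝ) : Prop :=
  IsStronglyPredictable M.filtration ξ ∧ ∀ t ≤ M.T, ∀ ω, ξ t ω ∈ Icc M.θ M.η

/-- A predictable random field `(t, y, ω) ↦ l t y ω`: jointly measurable for the product of the
predictable σ-algebra (in `(t, ω)`) and the Borel σ-algebra (in `y`). -/
def IsPredictableField (l : ℝ≥0 → ℝ → Ω → ℝ) : Prop :=
  @Measurable ((ℝ≥0 × Ω) × ℝ) ℝ
    (@Prod.instMeasurableSpace (ℝ≥0 × Ω) ℝ M.filtration.predictable inferInstance) inferInstance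
    (fun p => l p.1.1 p.2 p.1.2)

/-- `X` is a surplus process of the insurer on `[t, T]`, started from the surplus `x` at
time `t`. -/
def IsInsurerSurplus (l₁ l₂ : ℝ≥0 → ℝ → Ω → ℝ) (ξ₁ ξ₂ : ℝ≥0 → Ω → ℝ)
    (t : ℝ≥0) (x : ℝ) (X : ℝ≥0 → Ω → ℝ) : Prop :=
  M.IsStrongSolution M.ρI (fun s ω => M.c - M.p1 l₁ ξ₁ s ω - M.p2 l₂ ξ₂ s ω)
    (fun s y ω => y - l₁ s y ω - l₂ s y ω) t x X

/-- Admissibility of the market strategy `{l₁, l₂, ξ₁, ξ₂}`. -/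
structure IsAdmissible (l₁ l₂ : ℝ≥0 → ℝ → Ω → ℝ) (ξ₁ ξ₂ : ℝ≥0 → Ω → ℝ) : Prop where
  predictable₁ : M.IsPredictableField l₁
  predictable₂ : M.IsPredictableField l₂
  nonneg₁ : ∀ t ≤ M.T, ∀ y, 0 ≤ y → ∀ ω, 0 ≤ l₁ t y ω
  nonneg₂ : ∀ t ≤ M.T, ∀ y, 0 ≤ y → ∀ ω, 0 ≤ l₂ t y ω
  add_le : ∀ t ≤ M.T, ∀ y, 0 ≤ y → ∀ ω, l₁ t y ω + l₂ t y ω ≤ y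
  premium₁ : M.IsPremiumStrategy1 ξ₁
  premium₂ : M.IsPremiumStrategy2 ξ₂
  surplusI : M.HasUniqueSolution M.ρI (fun s ω => M.c - M.p1 l₁ ξ₁ s ω - M.p2 l₂ ξ₂ s ω)
    (fun s y ω => y - l₁ s y ω - l₂ s y ω) M.xI
  surplusR1 : M.HasUniqueSolution M.ρR1 (M.p1 l₁ ξ₁) l₁ M.xR1
  surplusR2 : M.HasUniqueSolution M.ρR2 (M.p2 l₂ ξ₂) l₂ M.xR2

/-- A surplus process of the insurer on `[t, T]` with surplus `x` at time `t`. -/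
def insurerSurplus (l₁ l₂ : ℝ≥0 → ℝ → Ω → ℝ) (ξ₁ ξ₂ : ℝ≥0 → Ω → ℝ) (t : ℝ≥0) (x : ℝ) :
    ℝ≥0 → Ω → ℝ :=
  Classical.epsilon (M.IsInsurerSurplus l₁ l₂ ξ₁ ξ₂ t x)

/-- The mean-variance objective `J_I(t, x; l₁, l₂, ξ₁, ξ₂)` of the insurer: conditional mean minus
`γ/2` times the conditional variance, given the information at time `t`, of the terminal surplus
when the surplus at time `t` is `x`. -/
def insurerObjective (l₁ l₂ : ℝ≥0 → ℝ → Ω → ℝ) (ξ₁ ξ₂ : ℝ≥0 → Ω → ℝ) (t : ℝ≥0) (x : ℝ) :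
    Ω → ℝ := fun ω =>
  (P[M.insurerSurplus l₁ l₂ ξ₁ ξ₂ t x M.T | M.filtration t]) ω
    - M.γ / 2 * (Var[M.insurerSurplus l₁ l₂ ξ₁ ξ₂ t x M.T; P | M.filtration t]) ω

end InsuranceMarket

open Classical in
/-- The treaty that is `l'` during `[t, t + ε)` and `l` at all other times. -/
def perturbTreaty {Ω : Type*} (l : ℝ≥0 → ℝ → Ω → ℝ) (t ε : ℝ≥0) (l' : ℝ → ℝ) :
    ℝ≥0 → ℝ → Ω → ℝ :=
  fun s y ω => if s ∈ Ico t (t + ε) then l' y else l s y ω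

namespace InsuranceMarket

variable {Ω : Type*} [MeasurableSpace Ω] {P : Measure Ω} (M : InsuranceMarket P)

/-- `{l₁, l₂}` is an equilibrium reinsurance strategy associated with `ξ₁` and `ξ₂`: it is
admissible, and no admissible deviation to treaties `l₁'`, `l₂'` during `[t, t + ε)` improves the
objective to first order as `ε → 0`. The objectives are random variables that are defined almost
surely only, so the lower limit is taken along arbitrary sequences `ε n → 0+`. -/
def IsEquilibriumReinsurance (l₁ l₂ : ℝ≥0 → ℝ → Ω → ℝ) (ξ₁ ξ₂ : ℝ≥0 → Ω → ℝ) : Prop :=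
  M.IsAdmissible l₁ l₂ ξ₁ ξ₂ ∧
  ∀ t ≤ M.T, ∀ (x : ℝ) (l₁' l₂' : ℝ → ℝ) (ε : ℕ → ℝ≥0),
    (∀ n, 0 < ε n) → Tendsto ε atTop (𝓝 0) →
    (∀ n, M.IsAdmissible (perturbTreaty l₁ t (ε n) l₁') (perturbTreaty l₂ t (ε n) l₂') ξ₁ ξ₂) →
    ∀ᵐ ω ∂P, (0 : EReal) ≤ liminf (fun n =>
      (((M.insurerObjective l₁ l₂ ξ₁ ξ₂ t x ω
        - M.insurerObjective (perturbTreaty l₁ t (ε n) l₁') (perturbTreaty l₂ t (ε n) l₂')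
            ξ₁ ξ₂ t x ω) / (ε n : ℝ) : ℝ) : EReal)) atTop

/-- `γ_I exp (∫_t^T ρ_I(s) ds)`. -/
def gammaExp (t : ℝ≥0) : ℝ := M.γ * Real.exp (∫ s in (t : ℝ)..M.T, M.ρI s)

/-- The ceding proportion `q(t)`. -/
def q (ξ₁ : ℝ≥0 → ℝ) (t : ℝ≥0) : ℝ := M.gammaExp t / (2 * ξ₁ t + M.gammaExp t)

/-- The deductible `d(t)`. -/
def d (ξ₁ ξ₂ : ℝ≥0 → ℝ) (t : ℝ≥0) : ℝ := ξ₂ t / M.gammaExp t + ξ₂ t / (2 * ξ₁ t)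

/-- The capped proportional treaty with reinsurer 1. -/
def optTreaty1 (ξ₁ ξ₂ : ℝ≥0 → ℝ) (t : ℝ≥0) (y : ℝ) : ℝ :=
  if y ≤ M.d ξ₁ ξ₂ t then M.q ξ₁ t * y else ξ₂ t / (2 * ξ₁ t)

/-- The stop-loss treaty with reinsurer 2. -/
def optTreaty2 (ξ₁ ξ₂ : ℝ≥0 → ℝ) (t : ℝ≥0) (y : ℝ) : ℝ :=
  if y ≤ M.d ξ₁ ξ₂ t then 0 else y - M.d ξ₁ ξ₂ t

end InsuranceMarket

end

/-! Write `A(s) = exp ∫_s^T ρ_I`. For deterministic treaties and loadings the surplus equation is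
linear with deterministic coefficients, and variation of constants gives the terminal surplus as `x
A(t) + ∫_t^T A(r) b(r) dr` minus the sum of `A(T_i) h(T_i, Y_i)` over the claims in `(t, T]`. Here
`b` is the net premium rate and `h(s, y) = y - l₁ - l₂` the retained claim.

The claims after `t` are independent of the information at time `t`, with intensity `ds ⊗ v`.
Campbell's formulas for the first two moments, proved conditionally on the past
(`setLIntegral_claimSum`, `setLIntegral_claimSum_sq`), give the conditional mean and variance of
that sum as `∫∫ A h` and `∫∫ A² h²`. Hence the objective is almost surely the constant `x A(t) +
∫_t^T reward` (`IsTreatyPair.insurerObjective_ae_eq`). At each time `reward` is a constant minus the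
cost `ξ₁ ∫ l₁² + ξ₂ ∫ l₂ + (γ A / 2) ∫ (y - l₁ - l₂)²`, the difference being multiplied by `A`.

The cost is the integral over `y` of a strictly convex quadratic in the pair `(l₁, l₂)`. The
treaties `optTreaty1`, `optTreaty2` satisfy its first order conditions pointwise, with `l₂ ≥ 0` as
the only constraint that can be active (`optTreaty_first_order`, `cost_density_le`). They therefore
minimise the cost at every time, and no deviation to functions of `y` gains anything, for any length
`ε`.

Conversely, let a deterministic equilibrium deviate at time `t` to the optimal treaties frozen at
`t`. By Lebesgue differentiation the difference quotient converges, for almost every `t`, to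
`reward(l) - reward(l*)`. The equilibrium condition makes this nonnegative, so `l` costs no more
than `l*`, and strict convexity forces equality almost everywhere (`IsTreatyPair.ae_eq_optTreaty`).
-/

/-! ### Moments of the Poisson law and independence of its increments from the past. -/

/-- The Chen–Stein identity for the Poisson distribution. -/
theorem lintegral_poissonMeasure_natCast_mul (r : ℝ≥0) (g : ℕ → ℝ≥0∞) :
    ∫⁻ n, (n : ℝ≥0∞) * g n ∂poissonMeasure r = r * ∫⁻ n, g (n + 1) ∂poissonMeasure r := by
  have key (f : ℕ → ℝ≥0∞) : ∫⁻ n, f n ∂poissonMeasure r =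
      ∑' n : ℕ, ENNReal.ofReal (Real.exp (-r) * r ^ n / n.factorial) * f n := by
    simp [poissonMeasure, lintegral_sum_measure, lintegral_smul_measure, lintegral_dirac]
  -- The term `n = 0` vanishes, and `n r^n / n! = r · r^(n-1) / (n-1)!` shifts the index of the
  -- others.
  rw [key, key, tsum_eq_zero_add' ENNReal.summable, ← ENNReal.tsum_mul_left]
  simp only [Nat.cast_zero, zero_mul, mul_zero, zero_add]
  refine tsum_congr fun n => ?_
  rw [← mul_assoc, ← mul_assoc]
  congr 1
  rw [← ENNReal.ofReal_natCast, ← ENNReal.ofReal_coe_nnreal, ← ENNReal.ofReal_mul (by positivity),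
    ← ENNReal.ofReal_mul (by positivity)]
  congr 1
  rw [Nat.factorial_succ, pow_succ]
  push_cast
  field_simp

theorem lintegral_poissonMeasure_natCast (r : ℝ≥0) :
    ∫⁻ n, (n : ℝ≥0∞) ∂poissonMeasure r = r := by
  simpa using lintegral_poissonMeasure_natCast_mul r 1

theorem lintegral_poissonMeasure_natCast_sq (r : ℝ≥0) :
    ∫⁻ n, (n : ℝ≥0∞) ^ 2 ∂poissonMeasure r = r * (r + 1) := by
  simp_rw [sq]
  rw [lintegral_poissonMeasure_natCast_mul]
  simp [lintegral_add_right, lintegral_poissonMeasure_natCast]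

/-- The σ-algebra generated by the process `N` up to time `u`. -/
@[reducible] def pastSigma {Ω : Type*} (N : ℝ≥0 → Ω → ℕ) (u : ℝ≥0) : MeasurableSpace Ω :=
  MeasurableSpace.comap (fun ω (r : Iic u) => N r ω) inferInstance

theorem pastSigma_mono {Ω : Type*} (N : ℝ≥0 → Ω → ℕ) {u s : ℝ≥0} (hus : u ≤ s) :
    pastSigma N u ≤ pastSigma N s := by
  have : (fun ω (r : Iic u) => N r ω) =
      (fun (x : Iic s → ℕ) (r : Iic u) => x ⟨r, r.2.trans hus⟩) ∘ fun ω (r : Iic s) => N r ω := rfl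
  rw [pastSigma, this, ← MeasurableSpace.comap_comp]
  exact MeasurableSpace.comap_mono
    (measurable_pi_lambda _ fun r => measurable_pi_apply _).comap_le

theorem measurable_pastSigma {Ω : Type*} (N : ℝ≥0 → Ω → ℕ) {u r : ℝ≥0} (hr : r ≤ u) :
    Measurable[pastSigma N u] (N r) :=
  (measurable_pi_apply (⟨r, hr⟩ : Iic u)).comp
    (comap_measurable (fun ω (r : Iic u) => N r ω))

namespace IsPoissonProcessOn

variable {Ω : Type*} [MeasurableSpace Ω] {P : Measure Ω} {T lam : ℝ≥0} {N : ℝ≥0 → Ω → ℕ}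

theorem measurable_past (h : IsPoissonProcessOn P T lam N) {u : ℝ≥0} (hu : u ≤ T) :
    Measurable (fun ω (r : Iic u) => N r ω) :=
  measurable_pi_lambda _ fun r => h.measurable _ (r.2.trans hu)

/-- A function of the past is independent of a future increment. -/
theorem lintegral_past_mul_increment (h : IsPoissonProcessOn P T lam N) {u c : ℝ≥0}
    (huc : u ≤ c) (hc : c ≤ T) {X : Ω → ℝ≥0∞}
    (hX : Measurable[pastSigma N u] X)
    (g : ℕ → ℝ≥0∞) :
    ∫⁻ ω, X ω * g (N c ω - N u ω) ∂P =
      (∫⁻ ω, X ω ∂P) * ∫⁻ n, g n ∂poissonMeasure (lam * (c - u)) := by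
  have hind := h.indep u c huc hc
  have hm : Measurable (fun ω => N c ω - N u ω) :=
    (h.measurable c hc).sub (h.measurable u (huc.trans hc))
  rw [← h.law u c huc hc, lintegral_map (measurable_of_countable g) hm]
  refine lintegral_mul_eq_lintegral_mul_lintegral_of_independent_measurableSpace
    (h.measurable_past (huc.trans hc)).comap_le hm.comap_le
    ((IndepFun_iff_Indep _ _ _).1 hind) hX ((measurable_of_countable g).comp (comap_measurable _))

end IsPoissonProcessOn

/-! ### Arrival times of the claims. -/

namespace InsuranceMarket

variable {Ω : Type*} [MeasurableSpace Ω] {P : Measure Ω} (M : InsuranceMarket P)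

/-- A right-continuous integer-valued path is constant just after the infimum, and points of the
defining set lie arbitrarily close to its right. So the infimum is attained. -/
theorem lt_N_arrival {i : ℕ} {ω : Ω} (hi : i < M.N M.T ω) :
    M.arrival i ω ≤ M.T ∧ i < M.N (M.arrival i ω) ω := by
  have hne : {s : ℝ≥0 | s ≤ M.T ∧ i < M.N s ω}.Nonempty := ⟨M.T, le_rfl, hi⟩
  have hle : M.arrival i ω ≤ M.T := csInf_le (OrderBot.bddBelow _) ⟨le_rfl, hi⟩
  refine ⟨hle, ?_⟩
  rcases hle.eq_or_lt with h | h
  · rwa [h]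
  · have hc := M.poisson.rightCont ω _ h
    have hev : ∀ᶠ u in 𝓝[≥] (M.arrival i ω), M.N u ω = M.N (M.arrival i ω) ω :=
      hc.eventually_mem ((isOpen_discrete {M.N (M.arrival i ω) ω}).mem_nhds rfl)
    obtain ⟨v, hv, hvs⟩ := (mem_nhdsGE_iff_exists_Ico_subset' h).1 hev
    obtain ⟨s, hs, hsv⟩ := exists_lt_of_csInf_lt hne (show sInf _ < v from hv)
    rw [← hvs ⟨csInf_le (OrderBot.bddBelow _) hs, hsv⟩]
    exact hs.2

theorem arrival_le_iff {i : ℕ} {ω : Ω} (hi : i < M.N M.T ω) {c : ℝ≥0} (hc : c ≤ M.T) :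
    M.arrival i ω ≤ c ↔ i < M.N c ω := by
  refine ⟨fun h => (M.lt_N_arrival hi).2.trans_le (M.poisson.mono ω _ _ h hc), fun h => ?_⟩
  exact csInf_le (OrderBot.bddBelow _) ⟨hc, h⟩

/-- A claim that does not occur by `T` gets the infimum of the empty set, whose default value is
`0`. This makes `arrival_le` unconditional. -/
theorem arrival_eq_zero {i : ℕ} {ω : Ω} (hi : M.N M.T ω ≤ i) : M.arrival i ω = 0 := by
  have : {s : ℝ≥0 | s ≤ M.T ∧ i < M.N s ω} = ∅ := by
    ext s
    simp only [mem_ofPred_eq, mem_empty_iff_false, iff_false, not_and, not_lt]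
    exact fun hs => (M.poisson.mono ω _ _ hs le_rfl).trans hi
  rw [arrival, this, NNReal.sInf_empty]

theorem arrival_le (i : ℕ) (ω : Ω) : M.arrival i ω ≤ M.T := by
  rcases lt_or_ge i (M.N M.T ω) with h | h
  · exact (M.lt_N_arrival h).1
  · simp [M.arrival_eq_zero h]

theorem lt_arrival {i : ℕ} {ω : Ω} {t : ℝ≥0} (ht : t ≤ M.T) (h : M.N t ω ≤ i)
    (hi : i < M.N M.T ω) : t < M.arrival i ω :=
  lt_of_not_ge fun h' => absurd ((M.arrival_le_iff hi ht).1 h') (not_lt.2 h)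

theorem measurable_arrival (i : ℕ) : Measurable (M.arrival i) := by
  refine measurable_of_Iic fun c => ?_
  rcases le_total M.T c with hc | hc
  · have : M.arrival i ⁻¹' Iic c = univ := eq_univ_of_forall fun ω => (M.arrival_le i ω).trans hc
    rw [this]; exact MeasurableSet.univ
  · have : M.arrival i ⁻¹' Iic c = {ω | i < M.N c ω} ∪ {ω | M.N M.T ω ≤ i} := by
      ext ω
      simp only [mem_preimage, mem_Iic, mem_union, mem_ofPred_eq]
      rcases lt_or_ge i (M.N M.T ω) with h | h
      · simp [M.arrival_le_iff h hc, h]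
      · simp [M.arrival_eq_zero h, h]
    rw [this]
    exact (measurableSet_lt measurable_const (M.poisson.measurable c hc)).union
      (measurableSet_le (M.poisson.measurable _ le_rfl) measurable_const)

end InsuranceMarket

/-! ### Counting single claims and pairs of distinct claims, given the past. -/

theorem ENNReal.tsum_mul_tsum_eq_add_offDiag (x y : ℕ → ℝ≥0∞) :
    (∑' i, x i) * (∑' j, y j) =
      ∑' i, x i * y i + ∑' i, ∑' j, if j = i then 0 else x i * y j := by
  rw [← ENNReal.tsum_add, ← ENNReal.tsum_mul_right]
  refine tsum_congr fun i => ?_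
  rw [← ENNReal.tsum_mul_left, ENNReal.tsum_eq_add_tsum_ite i]
  congr 1
  exact tsum_congr fun j => by congr

theorem tsum_indicator_Ico_one (a b : ℕ) :
    ∑' i, (Ico a b).indicator (1 : ℕ → ℝ≥0∞) i = ((b - a : ℕ) : ℝ≥0∞) := by
  rw [tsum_eq_sum (s := Finset.Ico a b)]
  · rw [Finset.sum_congr rfl (g := fun _ => 1)]
    · simp
    · intro i hi
      exact indicator_of_mem (by simpa using hi) _
  · intro i hi
    exact indicator_of_notMem (by simpa using hi) _

namespace InsuranceMarket

variable {Ω : Type*} [MeasurableSpace Ω] {P : Measure Ω} (M : InsuranceMarket P)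

/-- The event that claim number `i + 1` occurs in `(u, c]`. -/
def claimIn (u c : ℝ≥0) (i : ℕ) : Set Ω := {ω | M.N u ω ≤ i ∧ i < M.N c ω}

/-- The time and the size of claim number `i + 1`. -/
noncomputable def claimPoint (i : ℕ) (ω : Ω) : ℝ × ℝ := ((M.arrival i ω : ℝ), M.Y i ω)

/-- The event that the claim sizes with index in `K` lie in the sets `B`. -/
def marksIn (K : Finset ℕ) (B : ℕ → Set ℝ) : Set Ω := {ω | ∀ k ∈ K, M.Y k ω ∈ B k}

/-- A π-system that generates the claim history up to time `u`. -/
def pastSets (u : ℝ≥0) : Set (Set Ω) :=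
  {A | ∃ (E : Set Ω) (K : Finset ℕ) (B : ℕ → Set ℝ), MeasurableSet[pastSigma M.N u] E ∧
    (∀ k, MeasurableSet (B k)) ∧ (∀ ω ∈ E, ∀ k ∈ K, k < M.N u ω) ∧ A = E ∩ M.marksIn K B}

/-- The intensity measure of the claims in `(u, T]`. -/
noncomputable def intensity (u : ℝ≥0) : Measure (ℝ × ℝ) :=
  (volume.restrict (Ioc (u : ℝ) M.T)).prod M.v

theorem measurable_claimPoint (i : ℕ) : Measurable (M.claimPoint i) :=
  (measurable_coe_nnreal_real.comp (M.measurable_arrival i)).prodMk (M.Y_measurable i)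

theorem map_Y (i : ℕ) : P.map (M.Y i) = M.claimLaw := (M.Y_ident i).map_eq

theorem isProbabilityMeasure_claimLaw [IsProbabilityMeasure P] :
    IsProbabilityMeasure M.claimLaw :=
  Measure.isProbabilityMeasure_map (M.Y_measurable 0).aemeasurable

theorem isFiniteMeasure_v [IsProbabilityMeasure P] : IsFiniteMeasure M.v := by
  have := M.isProbabilityMeasure_claimLaw
  unfold v; infer_instance

theorem pastSigma_le {u : ℝ≥0} (hu : u ≤ M.T) : pastSigma M.N u ≤ ‹MeasurableSpace Ω› :=
  (M.poisson.measurable_past hu).comap_le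

theorem measurableSet_claimIn_pastSigma {u c : ℝ≥0} (hu : u ≤ M.T) (hc : c ≤ M.T) (i : ℕ) :
    MeasurableSet[pastSigma M.N M.T] (M.claimIn u c i) :=
  MeasurableSet.inter (m := pastSigma M.N M.T)
    (measurable_pastSigma M.N hu (measurableSet_Iic (a := i)))
    (measurable_pastSigma M.N hc (measurableSet_Ioi (a := i)))

theorem measurableSet_claimIn {u c : ℝ≥0} (hu : u ≤ M.T) (hc : c ≤ M.T) (i : ℕ) :
    MeasurableSet (M.claimIn u c i) :=
  M.pastSigma_le le_rfl _ (M.measurableSet_claimIn_pastSigma hu hc i)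

theorem measurableSet_marksIn (K : Finset ℕ) {B : ℕ → Set ℝ} (hB : ∀ k, MeasurableSet (B k)) :
    MeasurableSet (M.marksIn K B) := by
  have : M.marksIn K B = ⋂ k ∈ K, M.Y k ⁻¹' B k := by ext; simp [marksIn]
  rw [this]
  exact Finset.measurableSet_biInter _ fun k _ => M.Y_measurable k (hB k)

theorem measurableSet_of_mem_pastSets {u : ℝ≥0} (hu : u ≤ M.T) {A : Set Ω}
    (hA : A ∈ M.pastSets u) : MeasurableSet A := by
  obtain ⟨E, K, B, hE, hB, -, rfl⟩ := hA
  exact (M.pastSigma_le hu _ hE).inter (M.measurableSet_marksIn K hB)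

theorem isPiSystem_pastSets (u : ℝ≥0) : IsPiSystem (M.pastSets u) := by
  classical
  rintro _ ⟨E, K, B, hE, hB, hEK, rfl⟩ _ ⟨E', K', B', hE', hB', hEK', rfl⟩ -
  refine ⟨E ∩ E', K ∪ K', fun k => (if k ∈ K then B k else univ) ∩ (if k ∈ K' then B' k else univ),
    hE.inter hE', fun k => ?_, ?_, ?_⟩
  · refine MeasurableSet.inter ?_ ?_ <;> split_ifs
    exacts [hB k, .univ, hB' k, .univ]
  · rintro ω ⟨h1, h2⟩ k hk
    rcases Finset.mem_union.1 hk with h | h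
    exacts [hEK ω h1 k h, hEK' ω h2 k h]
  · ext ω
    simp only [marksIn, mem_inter_iff, mem_ofPred_eq, Finset.mem_union]
    constructor
    · rintro ⟨⟨h1, h2⟩, h3, h4⟩
      refine ⟨⟨h1, h3⟩, fun k _ => ⟨?_, ?_⟩⟩ <;> split_ifs with h
      exacts [h2 k h, trivial, h4 k h, trivial]
    · rintro ⟨⟨h1, h3⟩, h⟩
      refine ⟨⟨h1, fun k hk => ?_⟩, h3, fun k hk => ?_⟩
      · simpa [hk] using (h k (Or.inl hk)).1
      · simpa [hk] using (h k (Or.inr hk)).2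

theorem univ_mem_pastSets (u : ℝ≥0) : univ ∈ M.pastSets u :=
  ⟨univ, ∅, fun _ => univ, MeasurableSet.univ, fun _ => .univ, by simp, by simp [marksIn]⟩

theorem history_le_generateFrom_pastSets {u : ℝ≥0} (hu : u ≤ M.T) :
    M.history u ≤ MeasurableSpace.generateFrom (M.pastSets u) := by
  refine MeasurableSpace.generateFrom_mono ?_
  rintro _ ⟨s, hsu, hsT, i, B, hB, rfl⟩
  -- The condition at `u` follows from the one at `s` by monotonicity. It is included because
  -- `pastSets` only allows marks of claims that have occurred by `u`.
  refine ⟨{ω | i < M.N s ω ∧ i < M.N u ω}, {i}, fun _ => B, ?_, fun _ => hB, ?_, ?_⟩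
  · exact MeasurableSet.inter (m := pastSigma M.N u)
      (measurable_pastSigma M.N hsu (measurableSet_Ioi (a := i)))
      (measurable_pastSigma M.N le_rfl (measurableSet_Ioi (a := i)))
  · rintro ω ⟨-, h⟩ k hk
    simpa [Finset.mem_singleton.1 hk] using h
  · ext ω
    have := M.poisson.mono ω s u hsu hu
    simp only [marksIn, Finset.mem_singleton, forall_eq, mem_inter_iff, mem_ofPred_eq]
    exact ⟨fun h => ⟨⟨h.1, h.1.trans_le this⟩, h.2⟩, fun h => ⟨h.1.1, h.2⟩⟩

theorem measure_inter_marksIn {E : Set Ω} (hE : MeasurableSet[pastSigma M.N M.T] E)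
    (K : Finset ℕ) {B : ℕ → Set ℝ} (hB : ∀ k, MeasurableSet (B k)) :
    P (E ∩ M.marksIn K B) = P E * ∏ k ∈ K, M.claimLaw (B k) := by
  obtain ⟨S, hS, rfl⟩ := hE
  have h1 : M.marksIn K B = (fun ω i => M.Y i ω) ⁻¹' {x : ℕ → ℝ | ∀ k ∈ K, x k ∈ B k} := rfl
  have h2 : MeasurableSet {x : ℕ → ℝ | ∀ k ∈ K, x k ∈ B k} := by
    have : {x : ℕ → ℝ | ∀ k ∈ K, x k ∈ B k} = ⋂ k ∈ K, (fun x => x k) ⁻¹' B k := by ext; simp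
    rw [this]
    exact Finset.measurableSet_biInter _ fun k _ => measurable_pi_apply k (hB k)
  have h3 : M.marksIn K B = ⋂ k ∈ K, M.Y k ⁻¹' B k := by ext; simp [marksIn]
  have h4 : P (M.marksIn K B) = ∏ k ∈ K, M.claimLaw (B k) := by
    rw [h3, M.Y_indep.measure_inter_preimage_eq_mul K fun k _ => hB k]
    refine Finset.prod_congr rfl fun k _ => ?_
    rw [← M.map_Y k, Measure.map_apply (M.Y_measurable k) (hB k)]
  rw [← h4, h1]
  exact M.N_indep_Y.measure_inter_preimage_eq_mul _ _ hS h2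

/-- The sizes of past and of future claims are independent of each other and of the
claim number process. -/
theorem measure_past_inter_future {u : ℝ≥0} (hu : u ≤ M.T) {E H : Set Ω}
    (hE : MeasurableSet[pastSigma M.N u] E) (hH : MeasurableSet[pastSigma M.N M.T] H)
    {K J : Finset ℕ} {B C : ℕ → Set ℝ} (hB : ∀ k, MeasurableSet (B k))
    (hC : ∀ k, MeasurableSet (C k)) (hEK : ∀ ω ∈ E, ∀ k ∈ K, k < M.N u ω)
    (hHJ : ∀ ω ∈ H, ∀ k ∈ J, M.N u ω ≤ k) :
    P (E ∩ M.marksIn K B ∩ (H ∩ M.marksIn J C)) =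
      P (E ∩ H) * (∏ k ∈ K, M.claimLaw (B k)) * ∏ k ∈ J, M.claimLaw (C k) := by
  classical
  -- A common index would have to be both less than `N u` and at least `N u`. If `K` and `J` meet,
  -- then `E ∩ H` is empty and both sides are zero.
  by_cases hKJ : Disjoint K J
  · have h1 : E ∩ M.marksIn K B ∩ (H ∩ M.marksIn J C) =
        (E ∩ H) ∩ M.marksIn (K ∪ J) (fun k => if k ∈ J then C k else B k) := by
      ext ω
      simp only [marksIn, mem_inter_iff, mem_ofPred_eq, Finset.mem_union]
      constructor
      · rintro ⟨⟨h1, h2⟩, h3, h4⟩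
        refine ⟨⟨h1, h3⟩, fun k hk => ?_⟩
        split_ifs with h
        exacts [h4 k h, h2 k (hk.resolve_right h)]
      · rintro ⟨⟨h1, h3⟩, h⟩
        refine ⟨⟨h1, fun k hk => ?_⟩, h3, fun k hk => ?_⟩
        · simpa [Finset.disjoint_left.1 hKJ hk] using h k (Or.inl hk)
        · simpa [hk] using h k (Or.inr hk)
    rw [h1, M.measure_inter_marksIn ((pastSigma_mono M.N hu _ hE).inter hH) _ fun k => by
      split_ifs; exacts [hC k, hB k], Finset.prod_union hKJ, mul_assoc]
    congr 2
    · exact Finset.prod_congr rfl fun k hk => by simp [Finset.disjoint_left.1 hKJ hk]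
    · exact Finset.prod_congr rfl fun k hk => by simp [hk]
  · obtain ⟨k, hkK, hkJ⟩ := Finset.not_disjoint_iff.1 hKJ
    have h0 : E ∩ H = ∅ := by
      ext ω
      simp only [mem_inter_iff, mem_empty_iff_false, iff_false, not_and]
      exact fun h1 h2 => absurd (hEK ω h1 k hkK) (not_lt.2 (hHJ ω h2 k hkJ))
    have h1 : E ∩ M.marksIn K B ∩ (H ∩ M.marksIn J C) = ∅ :=
      subset_empty_iff.1 (h0 ▸ fun ω h => ⟨h.1.1, h.2.1⟩)
    simp [h0, h1]

theorem tsum_claimIn_indicator (u c : ℝ≥0) (ω : Ω) :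
    ∑' i, (M.claimIn u c i).indicator (1 : Ω → ℝ≥0∞) ω = ((M.N c ω - M.N u ω : ℕ) : ℝ≥0∞) := by
  rw [← tsum_indicator_Ico_one]
  exact tsum_congr fun i => by simp [indicator, claimIn]; congr

theorem setLIntegral_increment {u c : ℝ≥0} (huc : u ≤ c) (hc : c ≤ M.T) {E : Set Ω}
    (hE : MeasurableSet[pastSigma M.N u] E) (g : ℕ → ℝ≥0∞) :
    ∫⁻ ω in E, g (M.N c ω - M.N u ω) ∂P =
      P E * ∫⁻ n, g n ∂poissonMeasure (M.lam * (c - u)) := by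
  have hE' := M.pastSigma_le (huc.trans hc) _ hE
  have := M.poisson.lintegral_past_mul_increment huc hc (X := E.indicator 1)
    (by refine Measurable.indicator ?_ hE; exact measurable_const) g
  rw [lintegral_indicator_one hE'] at this
  rw [← this, ← lintegral_indicator hE']
  refine lintegral_congr fun ω => ?_
  by_cases h : ω ∈ E <;> simp [h]

/-- The indicators sum to the increment `N c - N u`, which is independent of `E` and has mean `lam
(c - u)`. -/
theorem tsum_measure_claimIn {u c : ℝ≥0} (huc : u ≤ c) (hc : c ≤ M.T) {E : Set Ω}
    (hE : MeasurableSet[pastSigma M.N u] E) :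
    ∑' i, P (E ∩ M.claimIn u c i) = P E * (M.lam * (c - u) : ℝ≥0) := by
  have hu := huc.trans hc
  have h1 (i : ℕ) : P (E ∩ M.claimIn u c i) =
      ∫⁻ ω in E, (M.claimIn u c i).indicator 1 ω ∂P := by
    rw [lintegral_indicator_one (M.measurableSet_claimIn hu hc i),
      Measure.restrict_apply (M.measurableSet_claimIn hu hc i), inter_comm]
  simp_rw [h1]
  rw [← lintegral_tsum fun i =>
    (measurable_one.indicator (M.measurableSet_claimIn hu hc i)).aemeasurable]
  simp_rw [M.tsum_claimIn_indicator]
  rw [M.setLIntegral_increment huc hc hE (fun n => n), lintegral_poissonMeasure_natCast]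

/-- With `a = N c - N u` and `b = N d - N c`, the number of pairs of distinct claims is `a (a + b) -
a`. If `m`, `m'` are the means of the independent Poisson variables `a`, `b`, its expectation is `m
(m + 1) + m m' - m = m (m + m')`. The subtraction is carried out by adding the finite diagonal term
to both sides. -/
theorem tsum_measure_claimIn_pair_of_le [IsFiniteMeasure P] {u c d : ℝ≥0} (huc : u ≤ c)
    (hcd : c ≤ d) (hd : d ≤ M.T) {E : Set Ω} (hE : MeasurableSet[pastSigma M.N u] E) :
    ∑' i, ∑' j, (if j = i then 0 else P (E ∩ (M.claimIn u c i ∩ M.claimIn u d j))) =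
      P E * ((M.lam * (c - u) : ℝ≥0) * (M.lam * (d - u) : ℝ≥0)) := by
  have hc := hcd.trans hd
  have hu := huc.trans hc
  have hE' := M.pastSigma_le hu _ hE
  have hm (i : ℕ) := M.measurableSet_claimIn hu hc i
  have hm' (i : ℕ) := M.measurableSet_claimIn hu hd i
  set X := ∑' i, ∑' j, (if j = i then 0 else P (E ∩ (M.claimIn u c i ∩ M.claimIn u d j)))
  have hX : X = ∫⁻ ω in E, ∑' i, ∑' j, (if j = i then 0 else
      (M.claimIn u c i).indicator 1 ω * (M.claimIn u d j).indicator 1 ω) ∂P := by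
    rw [lintegral_tsum]
    · refine tsum_congr fun i => ?_
      rw [lintegral_tsum]
      · refine tsum_congr fun j => ?_
        split_ifs with h
        · simp
        · rw [← setLIntegral_one, inter_comm, ← Measure.restrict_restrict ((hm i).inter (hm' j)),
            ← lintegral_indicator ((hm i).inter (hm' j))]
          refine lintegral_congr fun ω => ?_
          simp only [indicator, mem_inter_iff]
          split_ifs <;> simp_all
      · intro j
        split_ifs
        · fun_prop
        · exact ((measurable_one.indicator (hm i)).mul
            (measurable_one.indicator (hm' j))).aemeasurable
    · intro i
      refine (Measurable.tsum fun j => ?_).aemeasurable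
      split_ifs
      · fun_prop
      · exact (measurable_one.indicator (hm i)).mul (measurable_one.indicator (hm' j))
  have hdiag (ω : Ω) : ∑' i, (M.claimIn u c i).indicator (1 : Ω → ℝ≥0∞) ω *
      (M.claimIn u d i).indicator 1 ω = ((M.N c ω - M.N u ω : ℕ) : ℝ≥0∞) := by
    rw [← M.tsum_claimIn_indicator]
    refine tsum_congr fun i => ?_
    have := M.poisson.mono ω c d hcd hd
    by_cases h : ω ∈ M.claimIn u c i
    · have : ω ∈ M.claimIn u d i := ⟨h.1, h.2.trans_le this⟩
      simp [h, this]
    · simp [h]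
  have hprod (ω : Ω) : ((M.N c ω - M.N u ω : ℕ) : ℝ≥0∞) ^ 2 +
      ((M.N c ω - M.N u ω : ℕ) : ℝ≥0∞) * ((M.N d ω - M.N c ω : ℕ) : ℝ≥0∞) =
      ((M.N c ω - M.N u ω : ℕ) : ℝ≥0∞) + ∑' i, ∑' j, (if j = i then 0 else
      (M.claimIn u c i).indicator 1 ω * (M.claimIn u d j).indicator 1 ω) := by
    have h1 := M.poisson.mono ω c d hcd hd
    have h2 := M.poisson.mono ω u c huc hc
    have := ENNReal.tsum_mul_tsum_eq_add_offDiag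
      (fun i => (M.claimIn u c i).indicator (1 : Ω → ℝ≥0∞) ω)
      (fun i => (M.claimIn u d i).indicator 1 ω)
    rw [hdiag, M.tsum_claimIn_indicator, M.tsum_claimIn_indicator] at this
    rw [← this, sq, ← mul_add]
    congr 1
    norm_cast
    omega
  have hmN (a b : ℝ≥0) (ha : a ≤ M.T) (hb : b ≤ M.T) :
      Measurable fun ω => ((M.N b ω - M.N a ω : ℕ) : ℝ≥0∞) :=
    (measurable_of_countable (fun n : ℕ => (n : ℝ≥0∞))).comp
      ((M.poisson.measurable b hb).sub (M.poisson.measurable a ha))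
  have e1 : ∫⁻ ω in E, ((M.N c ω - M.N u ω : ℕ) : ℝ≥0∞) ∂P =
      P E * (M.lam * (c - u) : ℝ≥0) := by
    rw [M.setLIntegral_increment huc hc hE (fun n => n), lintegral_poissonMeasure_natCast]
  have e2 : ∫⁻ ω in E, ((M.N c ω - M.N u ω : ℕ) : ℝ≥0∞) ^ 2 ∂P =
      P E * ((M.lam * (c - u) : ℝ≥0) * ((M.lam * (c - u) : ℝ≥0) + 1)) := by
    rw [M.setLIntegral_increment huc hc hE (fun n => (n : ℝ≥0∞) ^ 2),
      lintegral_poissonMeasure_natCast_sq]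
  have e3 : ∫⁻ ω in E, ((M.N c ω - M.N u ω : ℕ) : ℝ≥0∞) * ((M.N d ω - M.N c ω : ℕ) : ℝ≥0∞) ∂P =
      P E * (M.lam * (c - u) : ℝ≥0) * (M.lam * (d - c) : ℝ≥0) := by
    have := M.poisson.lintegral_past_mul_increment hcd hd
      (X := E.indicator fun ω => ((M.N c ω - M.N u ω : ℕ) : ℝ≥0∞)) ?_ (fun n => n)
    · rw [lintegral_indicator hE', e1, lintegral_poissonMeasure_natCast] at this
      rw [← this, ← lintegral_indicator hE']
      refine lintegral_congr fun ω => ?_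
      by_cases h : ω ∈ E <;> simp [h]
    · refine Measurable.indicator ?_ (pastSigma_mono M.N huc _ hE)
      exact (measurable_of_countable (fun n : ℕ => (n : ℝ≥0∞))).comp
        ((measurable_pastSigma M.N le_rfl).sub (measurable_pastSigma M.N huc))
  have key : ∫⁻ ω in E, (((M.N c ω - M.N u ω : ℕ) : ℝ≥0∞) ^ 2 +
      ((M.N c ω - M.N u ω : ℕ) : ℝ≥0∞) * ((M.N d ω - M.N c ω : ℕ) : ℝ≥0∞)) ∂P =
      P E * (M.lam * (c - u) : ℝ≥0) + X := by
    rw [hX, ← e1, ← lintegral_add_left (hmN u c hu hc)]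
    exact lintegral_congr hprod
  rw [lintegral_add_left ((hmN u c hu hc).pow_const 2), e2, e3] at key
  have hfin : P E * (M.lam * (c - u) : ℝ≥0) ≠ ∞ :=
    ENNReal.mul_ne_top (measure_ne_top _ _) ENNReal.coe_ne_top
  have hsplit : (M.lam * (d - u) : ℝ≥0) = M.lam * (c - u) + M.lam * (d - c) := by
    rw [← mul_add]; congr 1
    rw [add_comm, tsub_add_tsub_cancel hcd huc]
  refine (ENNReal.add_right_inj hfin).1 (key.symm.trans ?_)
  rw [hsplit, ENNReal.coe_add]
  ring

theorem tsum_measure_claimIn_pair [IsFiniteMeasure P] {u c d : ℝ≥0} (huc : u ≤ c) (hc : c ≤ M.T)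
    (hud : u ≤ d) (hd : d ≤ M.T) {E : Set Ω} (hE : MeasurableSet[pastSigma M.N u] E) :
    ∑' i, ∑' j, (if j = i then 0 else P (E ∩ (M.claimIn u c i ∩ M.claimIn u d j))) =
      P E * ((M.lam * (c - u) : ℝ≥0) * (M.lam * (d - u) : ℝ≥0)) := by
  rcases le_total c d with h | h
  · exact M.tsum_measure_claimIn_pair_of_le huc h hd hE
  · rw [mul_comm (_ : ℝ≥0∞) ((M.lam * (d - u) : ℝ≥0) : ℝ≥0∞),
      ← M.tsum_measure_claimIn_pair_of_le hud h hc hE, ENNReal.tsum_comm]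
    refine tsum_congr fun i => tsum_congr fun j => ?_
    rw [inter_comm (M.claimIn u c j)]
    simp only [eq_comm]

end InsuranceMarket

/-! ### Campbell's formulas conditionally on the claim history. -/

namespace InsuranceMarket

variable {Ω : Type*} [MeasurableSpace Ω] {P : Measure Ω} (M : InsuranceMarket P)

/-- Clamping an arbitrary real `b` to `[u, T]` turns the half-line `Iic b` of arrival times into a
counting event, to which the formulas for increments apply. -/
theorem mem_claimIn_clamp {u : ℝ≥0} (hu : u ≤ M.T) {i : ℕ} {ω : Ω} (b : ℝ) :
    ω ∈ M.claimIn u (max u (min b.toNNReal M.T)) i ↔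
      ω ∈ M.claimIn u M.T i ∧ (M.arrival i ω : ℝ) ≤ b := by
  have hc : max u (min b.toNNReal M.T) ≤ M.T := max_le hu (min_le_right _ _)
  by_cases hω : ω ∈ M.claimIn u M.T i
  · have hlt := M.lt_arrival hu hω.1 hω.2
    have h1 : ω ∈ M.claimIn u (max u (min b.toNNReal M.T)) i ↔
        M.arrival i ω ≤ max u (min b.toNNReal M.T) := by
      rw [M.arrival_le_iff hω.2 hc]
      exact ⟨fun h => h.2, fun h => ⟨hω.1, h⟩⟩
    rw [h1, le_max_iff, or_iff_right (not_le.2 hlt), le_min_iff, and_iff_left (M.arrival_le i ω)]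
    simp only [hω, true_and]
    have hpos : 0 < M.arrival i ω := bot_le.trans_lt hlt
    rw [Real.le_toNNReal_iff_coe_le' hpos]
  · simp only [hω, false_and, iff_false]
    exact fun h => hω ⟨h.1, h.2.trans_le (M.poisson.mono ω _ _ hc le_rfl)⟩

theorem volume_restrict_Ioc_Iic {u : ℝ≥0} (hu : u ≤ M.T) (b : ℝ) :
    (volume.restrict (Ioc (u : ℝ) M.T)) (Iic b) =
      ((max u (min b.toNNReal M.T) - u : ℝ≥0) : ℝ≥0∞) := by
  have h1 : Iic b ∩ Ioc (u : ℝ) M.T = Ioc (u : ℝ) (min b M.T) := by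
    ext x; simp only [mem_inter_iff, mem_Iic, mem_Ioc, le_min_iff]; tauto
  rw [Measure.restrict_apply measurableSet_Iic, h1, Real.volume_Ioc, ENNReal.ofReal]
  congr 1
  apply NNReal.eq
  have hu' : (u : ℝ) ≤ M.T := hu
  rw [Real.coe_toNNReal', NNReal.coe_sub (le_max_left _ _)]
  push_cast
  rw [Real.coe_toNNReal']
  rcases le_total b 0 with h | h
  · rw [max_eq_right h, min_eq_left M.T.coe_nonneg, max_eq_left u.coe_nonneg, min_eq_left (h.trans M.T.coe_nonneg)]
    rw [max_eq_right] <;> simp; linarith [u.coe_nonneg]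
  · rw [max_eq_left h]
    rcases le_total (min b M.T) (u : ℝ) with h' | h'
    · rw [max_eq_left h', max_eq_right (by linarith)]; simp
    · rw [max_eq_right h', max_eq_left (by linarith)]

/-- The rectangles `Iic b × B`. -/
def iicRects : Set (Set (ℝ × ℝ)) := image2 (· ×ˢ ·) (range Iic) {B | MeasurableSet B}

/-- Countably many half-lines of finite measure cover the line. -/
def iicSpanning (μ : Measure ℝ) [IsFiniteMeasure μ] : μ.FiniteSpanningSetsIn (range Iic) where
  set n := Iic (n : ℝ)
  set_mem n := mem_range_self _
  finite n := measure_lt_top _ _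
  spanning := by
    refine eq_univ_of_forall fun x => mem_iUnion.2 ?_
    exact exists_nat_ge x

/-- A finite measure is spanned by the whole space. -/
def univSpanning {α : Type*} [MeasurableSpace α] (μ : Measure α) [IsFiniteMeasure μ] :
    μ.FiniteSpanningSetsIn {B | MeasurableSet B} where
  set _ := univ
  set_mem _ := MeasurableSet.univ
  finite _ := measure_lt_top _ _
  spanning := iUnion_const _

theorem isPiSystem_range_Iic : IsPiSystem (range (Iic : ℝ → Set ℝ)) := by
  rintro _ ⟨a, rfl⟩ _ ⟨b, rfl⟩ -
  exact ⟨min a b, by rw [Iic_inter_Iic]⟩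

theorem isPiSystem_iicRects : IsPiSystem iicRects :=
  isPiSystem_range_Iic.prod MeasurableSpace.isPiSystem_measurableSet

theorem generateFrom_iicRects :
    MeasurableSpace.generateFrom iicRects = (inferInstance : MeasurableSpace (ℝ × ℝ)) :=
  generateFrom_eq_prod (borel_eq_generateFrom_Iic ℝ ▸ (BorelSpace.measurable_eq (α := ℝ)).symm)
    MeasurableSpace.generateFrom_measurableSet
    (iicSpanning (0 : Measure ℝ)).isCountablySpanning
    (univSpanning (0 : Measure ℝ)).isCountablySpanning

/-- Splits a past event into its counting part `E` and the probability `κ` of its marks. Sums over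
future claims then involve the claim number process alone. -/
theorem measure_mem_pastSets_inter [IsProbabilityMeasure P] {u : ℝ≥0} (hu : u ≤ M.T)
    {A : Set Ω} (hA : A ∈ M.pastSets u) :
    ∃ E κ, MeasurableSet[pastSigma M.N u] E ∧ P A = P E * κ ∧
      ∀ (H : Set Ω), MeasurableSet[pastSigma M.N M.T] H → ∀ (J : Finset ℕ) (C : ℕ → Set ℝ),
        (∀ k, MeasurableSet (C k)) → (∀ ω ∈ H, ∀ k ∈ J, M.N u ω ≤ k) →
        P (A ∩ (H ∩ M.marksIn J C)) = P (E ∩ H) * (κ * ∏ k ∈ J, M.claimLaw (C k)) := by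
  obtain ⟨E, K, B, hE, hB, hEK, rfl⟩ := hA
  refine ⟨E, ∏ k ∈ K, M.claimLaw (B k), hE,
    M.measure_inter_marksIn (pastSigma_mono M.N hu _ hE) K hB, fun H hH J C hC hHJ => ?_⟩
  rw [M.measure_past_inter_future hu hE hH hB hC hEK hHJ, mul_assoc]

/-- The mean measure of the claim points on the event `A`. On rectangles `Iic b ×ˢ B` it reduces to
`tsum_measure_claimIn`, and these rectangles determine a finite measure. -/
theorem sum_map_claimPoint [IsProbabilityMeasure P] {u : ℝ≥0} (hu : u ≤ M.T)
    {A : Set Ω} (hA : A ∈ M.pastSets u) :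
    Measure.sum (fun i => (P.restrict (A ∩ M.claimIn u M.T i)).map (M.claimPoint i)) =
      P A • M.intensity u := by
  have := M.isFiniteMeasure_v
  have hPA : IsFiniteMeasure (P A • volume.restrict (Ioc (u : ℝ) M.T)) :=
    Measure.smul_finite _ (measure_ne_top _ _)
  rw [intensity, ← Measure.prod_smul_left]
  symm
  refine Measure.prod_eq_generateFrom
    (borel_eq_generateFrom_Iic ℝ ▸ (BorelSpace.measurable_eq (α := ℝ)).symm)
    MeasurableSpace.generateFrom_measurableSet isPiSystem_range_Iic
    MeasurableSpace.isPiSystem_measurableSet (iicSpanning _) (univSpanning _) ?_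
  rintro _ ⟨b, rfl⟩ B (hB : MeasurableSet B)
  obtain ⟨E, κ, hE, hPA, hfac⟩ := M.measure_mem_pastSets_inter hu hA
  have hAm := M.measurableSet_of_mem_pastSets hu hA
  set c := max u (min b.toNNReal M.T) with hc_def
  have hc : c ≤ M.T := max_le hu (min_le_right _ _)
  have huc : u ≤ c := le_max_left _ _
  have hR : MeasurableSet (Iic b ×ˢ B) := measurableSet_Iic.prod hB
  rw [Measure.sum_apply _ hR]
  have hterm (i : ℕ) : ((P.restrict (A ∩ M.claimIn u M.T i)).map (M.claimPoint i)) (Iic b ×ˢ B) =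
      P (E ∩ M.claimIn u c i) * (κ * M.claimLaw B) := by
    have hs : M.claimPoint i ⁻¹' (Iic b ×ˢ B) ∩ (A ∩ M.claimIn u M.T i) =
        A ∩ (M.claimIn u c i ∩ M.marksIn {i} fun _ => B) := by
      ext ω
      have := M.mem_claimIn_clamp hu (i := i) (ω := ω) b
      simp only [mem_inter_iff, mem_preimage, mem_prod, claimPoint, mem_Iic, marksIn,
        mem_ofPred_eq, Finset.mem_singleton, forall_eq, hc_def, this]
      tauto
    rw [Measure.map_apply (M.measurable_claimPoint i) hR,
      Measure.restrict_apply (M.measurable_claimPoint i hR), hs,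
      hfac _ (M.measurableSet_claimIn_pastSigma hu hc i) {i} _ (fun _ => hB) (by
        rintro ω h k hk
        rw [Finset.mem_singleton.1 hk]; exact h.1), Finset.prod_singleton]
  simp_rw [hterm]
  rw [ENNReal.tsum_mul_right, M.tsum_measure_claimIn huc hc hE, Measure.smul_apply,
    M.volume_restrict_Ioc_Iic hu b, hPA, v, Measure.smul_apply, ← hc_def]
  simp only [smul_eq_mul, ENNReal.smul_def, ENNReal.coe_mul]
  ring

/-- The second factorial moment measure: distinct claims are uncorrelated enough for it to be a
product. On products of two rectangles this is `tsum_measure_claimIn_pair`. -/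
theorem sum_map_claimPoint_pair [IsProbabilityMeasure P] {u : ℝ≥0} (hu : u ≤ M.T)
    {A : Set Ω} (hA : A ∈ M.pastSets u) :
    Measure.sum (fun i => Measure.sum fun j => if j = i then 0 else
      (P.restrict (A ∩ (M.claimIn u M.T i ∩ M.claimIn u M.T j))).map
        fun ω => (M.claimPoint i ω, M.claimPoint j ω)) =
      P A • (M.intensity u).prod (M.intensity u) := by
  have := M.isFiniteMeasure_v
  have hPA : IsFiniteMeasure (P A • volume.restrict (Ioc (u : ℝ) M.T)) :=
    Measure.smul_finite _ (measure_ne_top _ _)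
  have hI : P A • M.intensity u = (P A • volume.restrict (Ioc (u : ℝ) M.T)).prod M.v := by
    rw [intensity, Measure.prod_smul_left]
  have hfi : IsFiniteMeasure (M.intensity u) := by unfold intensity; infer_instance
  rw [← Measure.prod_smul_left]
  symm
  refine Measure.prod_eq_generateFrom generateFrom_iicRects generateFrom_iicRects
    isPiSystem_iicRects isPiSystem_iicRects
    (hI ▸ (iicSpanning _).prod (univSpanning _)) ((iicSpanning _).prod (univSpanning _)) ?_
  rintro _ ⟨_, ⟨b₁, rfl⟩, B₁, hB₁, rfl⟩ _ ⟨_, ⟨b₂, rfl⟩, B₂, hB₂, rfl⟩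
  replace hB₁ : MeasurableSet B₁ := hB₁
  replace hB₂ : MeasurableSet B₂ := hB₂
  obtain ⟨E, κ, hE, hPA, hfac⟩ := M.measure_mem_pastSets_inter hu hA
  have hAm := M.measurableSet_of_mem_pastSets hu hA
  set c := max u (min b₁.toNNReal M.T) with hc_def
  set d := max u (min b₂.toNNReal M.T) with hd_def
  have hc : c ≤ M.T := max_le hu (min_le_right _ _)
  have huc : u ≤ c := le_max_left _ _
  have hd : d ≤ M.T := max_le hu (min_le_right _ _)
  have hud : u ≤ d := le_max_left _ _
  have hR : MeasurableSet ((Iic b₁ ×ˢ B₁) ×ˢ (Iic b₂ ×ˢ B₂)) :=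
    (measurableSet_Iic.prod hB₁).prod (measurableSet_Iic.prod hB₂)
  rw [Measure.sum_apply _ hR]
  have hterm (i j : ℕ) : ((if j = i then (0 : Measure ((ℝ × ℝ) × (ℝ × ℝ))) else
      (P.restrict (A ∩ (M.claimIn u M.T i ∩ M.claimIn u M.T j))).map
        fun ω => (M.claimPoint i ω, M.claimPoint j ω)))
        ((Iic b₁ ×ˢ B₁) ×ˢ (Iic b₂ ×ˢ B₂)) =
      (if j = i then 0 else P (E ∩ (M.claimIn u c i ∩ M.claimIn u d j))) *
        (κ * (M.claimLaw B₁ * M.claimLaw B₂)) := by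
    split_ifs with hij
    · simp
    -- Since `i ≠ j`, the family `if k = i then B₁ else B₂` assigns `B₁` to the first claim and `B₂`
    -- to the second.
    have hs : (fun ω => (M.claimPoint i ω, M.claimPoint j ω)) ⁻¹'
        ((Iic b₁ ×ˢ B₁) ×ˢ (Iic b₂ ×ˢ B₂)) ∩ (A ∩ (M.claimIn u M.T i ∩ M.claimIn u M.T j)) =
        A ∩ ((M.claimIn u c i ∩ M.claimIn u d j) ∩
          M.marksIn {i, j} fun k => if k = i then B₁ else B₂) := by
      ext ω
      have h1 := M.mem_claimIn_clamp hu (i := i) (ω := ω) b₁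
      have h2 := M.mem_claimIn_clamp hu (i := j) (ω := ω) b₂
      simp only [mem_inter_iff, mem_preimage, mem_prod, claimPoint, mem_Iic, marksIn,
        mem_ofPred_eq, Finset.mem_insert, Finset.mem_singleton, forall_eq_or_imp, forall_eq,
        hc_def, hd_def, h1, h2, if_true, hij, if_false]
      tauto
    have hm := (M.measurable_claimPoint i).prodMk (M.measurable_claimPoint j)
    rw [Measure.map_apply hm hR, Measure.restrict_apply (hm hR), hs,
      hfac _ (MeasurableSet.inter (m := pastSigma M.N M.T)
        (M.measurableSet_claimIn_pastSigma hu hc i) (M.measurableSet_claimIn_pastSigma hu hd j))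
        {i, j} _ (fun k => by split_ifs; exacts [hB₁, hB₂]) (by
        rintro ω h k hk
        rcases Finset.mem_insert.1 hk with rfl | hk
        · exact h.1.1
        · rw [Finset.mem_singleton.1 hk]; exact h.2.1),
      Finset.prod_pair (Ne.symm hij)]
    simp [hij]
  have hterm' (i : ℕ) : (Measure.sum fun j => if j = i then (0 : Measure ((ℝ × ℝ) × (ℝ × ℝ))) else
      (P.restrict (A ∩ (M.claimIn u M.T i ∩ M.claimIn u M.T j))).map
        fun ω => (M.claimPoint i ω, M.claimPoint j ω)) ((Iic b₁ ×ˢ B₁) ×ˢ (Iic b₂ ×ˢ B₂)) =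
      ∑' j, (if j = i then 0 else P (E ∩ (M.claimIn u c i ∩ M.claimIn u d j))) *
        (κ * (M.claimLaw B₁ * M.claimLaw B₂)) := by
    rw [Measure.sum_apply _ hR]
    exact tsum_congr fun j => hterm i j
  simp_rw [hterm', ENNReal.tsum_mul_right]
  rw [M.tsum_measure_claimIn_pair huc hc hud hd hE, hI, Measure.prod_prod,
    Measure.prod_prod, Measure.smul_apply,
    M.volume_restrict_Ioc_Iic hu b₁, M.volume_restrict_Ioc_Iic hu b₂, hPA, v, Measure.smul_apply,
    Measure.smul_apply, ← hc_def, ← hd_def]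
  simp only [smul_eq_mul, ENNReal.smul_def, ENNReal.coe_mul]
  ring

/-- The sum of `f` over the claims in `(u, T]`. -/
noncomputable def claimSum (f : ℝ × ℝ → ℝ≥0∞) (u : ℝ≥0) (ω : Ω) : ℝ≥0∞ :=
  ∑' i, (M.claimIn u M.T i).indicator (fun ω => f (M.claimPoint i ω)) ω

theorem measurable_claimSum {f : ℝ × ℝ → ℝ≥0∞} (hf : Measurable f) {u : ℝ≥0} (hu : u ≤ M.T) :
    Measurable (M.claimSum f u) :=
  Measurable.tsum fun i =>
    (hf.comp (M.measurable_claimPoint i)).indicator (M.measurableSet_claimIn hu le_rfl i)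

/-- Campbell's formula for the mean. -/
theorem setLIntegral_claimSum_of_mem_pastSets [IsProbabilityMeasure P] {f : ℝ × ℝ → ℝ≥0∞}
    (hf : Measurable f) {u : ℝ≥0} (hu : u ≤ M.T) {A : Set Ω} (hA : A ∈ M.pastSets u) :
    ∫⁻ ω in A, M.claimSum f u ω ∂P = P A * ∫⁻ p, f p ∂M.intensity u := by
  rw [← smul_eq_mul (P A), ← lintegral_smul_measure, ← M.sum_map_claimPoint hu hA, lintegral_sum_measure]
  unfold claimSum
  have hmi (i : ℕ) : Measurable ((M.claimIn u M.T i).indicator fun ω => f (M.claimPoint i ω)) :=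
    (hf.comp (M.measurable_claimPoint i)).indicator (M.measurableSet_claimIn hu le_rfl i)
  rw [lintegral_tsum fun i => (hmi i).aemeasurable]
  refine tsum_congr fun i => ?_
  rw [lintegral_map hf (M.measurable_claimPoint i),
    lintegral_indicator (M.measurableSet_claimIn hu le_rfl i),
    Measure.restrict_restrict (M.measurableSet_claimIn hu le_rfl i), inter_comm]

/-- Campbell's formula for the second moment. -/
theorem setLIntegral_claimSum_sq_of_mem_pastSets [IsProbabilityMeasure P] {f : ℝ × ℝ → ℝ≥0∞}
    (hf : Measurable f) {u : ℝ≥0} (hu : u ≤ M.T) {A : Set Ω} (hA : A ∈ M.pastSets u) :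
    ∫⁻ ω in A, M.claimSum f u ω ^ 2 ∂P =
      P A * (∫⁻ p, f p ^ 2 ∂M.intensity u + (∫⁻ p, f p ∂M.intensity u) ^ 2) := by
  have := M.isFiniteMeasure_v
  have hfi : IsFiniteMeasure (M.intensity u) := by unfold intensity; infer_instance
  have hmC (i : ℕ) := M.measurableSet_claimIn hu le_rfl i
  have hmi (i : ℕ) : Measurable ((M.claimIn u M.T i).indicator fun ω => f (M.claimPoint i ω)) :=
    (hf.comp (M.measurable_claimPoint i)).indicator (hmC i)
  -- The diagonal of the square is again a claim sum, of `f ^ 2`; the rest is integrated against the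
  -- factorial moment measure.
  have hsq (ω : Ω) : M.claimSum f u ω ^ 2 = M.claimSum (fun p => f p ^ 2) u ω +
      ∑' i, ∑' j, (if j = i then 0 else
        (M.claimIn u M.T i).indicator (fun ω => f (M.claimPoint i ω)) ω *
        (M.claimIn u M.T j).indicator (fun ω => f (M.claimPoint j ω)) ω) := by
    rw [sq, claimSum, ENNReal.tsum_mul_tsum_eq_add_offDiag]
    congr 1
    refine tsum_congr fun i => ?_
    by_cases h : ω ∈ M.claimIn u M.T i <;> simp [h, sq]
  have hmij (i j : ℕ) : Measurable fun ω => (if j = i then 0 else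
      (M.claimIn u M.T i).indicator (fun ω => f (M.claimPoint i ω)) ω *
      (M.claimIn u M.T j).indicator (fun ω => f (M.claimPoint j ω)) ω) := by
    split_ifs
    · fun_prop
    · exact (hmi i).mul (hmi j)
  simp_rw [hsq]
  rw [lintegral_add_left (M.measurable_claimSum (hf.pow_const 2) hu),
    M.setLIntegral_claimSum_of_mem_pastSets (hf.pow_const 2) hu hA, mul_add]
  congr 1
  rw [sq (∫⁻ p, f p ∂M.intensity u), ← lintegral_prod_mul hf.aemeasurable hf.aemeasurable,
    ← smul_eq_mul (P A), ← lintegral_smul_measure, ← M.sum_map_claimPoint_pair hu hA, lintegral_sum_measure,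
    lintegral_tsum fun i => (Measurable.tsum fun j => hmij i j).aemeasurable]
  refine tsum_congr fun i => ?_
  rw [lintegral_sum_measure, lintegral_tsum fun j => (hmij i j).aemeasurable]
  refine tsum_congr fun j => ?_
  split_ifs with hij
  · simp
  rw [lintegral_map (by fun_prop)
    ((M.measurable_claimPoint i).prodMk (M.measurable_claimPoint j)), inter_comm A,
    ← Measure.restrict_restrict ((hmC i).inter (hmC j)),
    ← lintegral_indicator ((hmC i).inter (hmC j))]
  refine lintegral_congr fun ω => ?_
  simp only [indicator, mem_inter_iff]
  split_ifs <;> simp_all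

end InsuranceMarket

/-! ### From the claim history to the augmented filtration; adaptedness of claim sums. -/

namespace InsuranceMarket

variable {Ω : Type*} [MeasurableSpace Ω] {P : Measure Ω} (M : InsuranceMarket P)

theorem filtration_eq (t : ℝ≥0) : M.filtration t = ⨅ u > t, M.completedHistory u :=
  M.completedHistory.rightCont_eq t

theorem history_le_filtration (t : ℝ≥0) : M.history t ≤ M.filtration t :=
  (le_sup_left : M.history t ≤ M.completedHistory t).trans
    (M.completedHistory.le_rightCont t)

/-- Completion only changes sets by null sets, so identities between integrals need to be checked
only on the σ-algebra generated by `pastSets`. -/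
theorem completedHistory_le {u : ℝ≥0} (hu : u ≤ M.T) :
    (M.completedHistory u : MeasurableSpace Ω) ≤
      @eventuallyMeasurableSpace Ω (MeasurableSpace.generateFrom (M.pastSets u)) (ae P) _ := by
  refine sup_le ((M.history_le_generateFrom_pastSets hu).trans fun s hs => ⟨s, hs, .rfl⟩)
    (MeasurableSpace.generateFrom_le ?_)
  rintro A ⟨-, hA⟩
  exact ⟨∅, @MeasurableSet.empty _ (MeasurableSpace.generateFrom (M.pastSets u)), ae_eq_empty.2 hA⟩

/-- Both sides are measures in `A` that agree on the π-system `pastSets`. Finiteness of `C` makes `C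
• P` finite, as uniqueness of the extension requires. -/
theorem setLIntegral_of_pastSets [IsProbabilityMeasure P] {u : ℝ≥0} (hu : u ≤ M.T)
    {Z : Ω → ℝ≥0∞} {C : ℝ≥0∞} (hC : C ≠ ∞)
    (h : ∀ A ∈ M.pastSets u, ∫⁻ ω in A, Z ω ∂P = P A * C) {A : Set Ω}
    (hA : MeasurableSet[M.completedHistory u] A) : ∫⁻ ω in A, Z ω ∂P = P A * C := by
  obtain ⟨B, hB, hAB⟩ := M.completedHistory_le hu A hA
  rw [Measure.restrict_congr_set hAB, measure_congr hAB]
  have hle : MeasurableSpace.generateFrom (M.pastSets u) ≤ ‹MeasurableSpace Ω› :=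
    MeasurableSpace.generateFrom_le fun s hs => M.measurableSet_of_mem_pastSets hu hs
  have hfin : IsFiniteMeasure (C • P) := Measure.smul_finite _ hC
  have key (s : Set Ω) (hs : s ∈ M.pastSets u) : (C • P) s = P.withDensity Z s := by
    rw [withDensity_apply _ (M.measurableSet_of_mem_pastSets hu hs), h s hs, Measure.smul_apply,
      smul_eq_mul, mul_comm]
  have := ext_on_measurableSpace_of_generate_finite _ (M.pastSets u) key hle rfl
    (M.isPiSystem_pastSets u) (key _ (M.univ_mem_pastSets u)) hB
  rw [withDensity_apply _ (hle _ hB), Measure.smul_apply, smul_eq_mul, mul_comm] at this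
  exact this.symm

theorem claimIn_antitone {u s : ℝ≥0} (hus : u ≤ s) (hs : s ≤ M.T) (i : ℕ) :
    M.claimIn s M.T i ⊆ M.claimIn u M.T i :=
  fun ω h => ⟨(M.poisson.mono ω u s hus hs).trans h.1, h.2⟩

theorem claimSum_antitone (f : ℝ × ℝ → ℝ≥0∞) {u s : ℝ≥0} (hus : u ≤ s) (hs : s ≤ M.T) (ω : Ω) :
    M.claimSum f s ω ≤ M.claimSum f u ω :=
  ENNReal.tsum_le_tsum fun i =>
    indicator_le_indicator_of_subset (M.claimIn_antitone hus hs i) (fun _ => zero_le) ω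

theorem claimSum_T (f : ℝ × ℝ → ℝ≥0∞) (ω : Ω) : M.claimSum f M.T ω = 0 := by
  refine ENNReal.tsum_eq_zero.2 fun i => indicator_of_notMem ?_ _
  rintro ⟨h1, h2⟩
  exact absurd h2 (not_lt.2 h1)

theorem eventually_N_eq (ω : Ω) {t : ℝ≥0} (ht : t < M.T) :
    ∀ᶠ u in 𝓝[≥] t, M.N u ω = M.N t ω :=
  (M.poisson.rightCont ω t ht).eventually_mem ((isOpen_discrete {M.N t ω}).mem_nhds rfl)

/-- A moment formula that holds conditionally on the strict past also holds conditionally on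
the right-continuous augmented past. -/
theorem setLIntegral_filtration [IsProbabilityMeasure P] {f : ℝ × ℝ → ℝ≥0∞} (hf : Measurable f)
    {φ : ℝ≥0∞ → ℝ≥0∞} (hφ : Monotone φ) (hφ0 : φ 0 = 0) {C : ℝ≥0 → ℝ≥0∞} {t : ℝ≥0}
    (ht : t ≤ M.T) (hC : C t ≠ ∞)
    (h : ∀ u ≤ M.T, ∀ A ∈ M.pastSets u, ∫⁻ ω in A, φ (M.claimSum f u ω) ∂P = P A * C u)
    {A : Set Ω} (hA : MeasurableSet[M.filtration t] A) :
    ∫⁻ ω in A, φ (M.claimSum f t ω) ∂P = P A * C t := by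
  have hCeq (u : ℝ≥0) (hu : u ≤ M.T) : C u = ∫⁻ ω, φ (M.claimSum f u ω) ∂P := by
    simpa using (h u hu univ (M.univ_mem_pastSets u)).symm
  have hCanti (u : ℝ≥0) (htu : t ≤ u) (hu : u ≤ M.T) : C u ≤ C t := by
    rw [hCeq u hu, hCeq t ht]
    exact lintegral_mono fun ω => hφ (M.claimSum_antitone f htu hu ω)
  -- At `t = T` no later time is available, but the claim sum over `(T, T]` is empty and both sides
  -- vanish.
  rcases ht.eq_or_lt with rfl | htT
  · rw [hCeq _ le_rfl]
    simp [claimSum_T, hφ0]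
  · obtain ⟨v, hv, hvt, hlim⟩ := exists_seq_strictAnti_tendsto' htT
    have hmem (n : ℕ) : ∫⁻ ω in A, φ (M.claimSum f (v n) ω) ∂P = P A * C (v n) := by
      refine M.setLIntegral_of_pastSets (hvt n).2.le
        (ne_top_of_le_ne_top hC (hCanti _ (hvt n).1.le (hvt n).2.le)) (h _ (hvt n).2.le) ?_
      have : M.filtration t ≤ M.completedHistory (v n) := by
        rw [M.filtration_eq]
        exact iInf₂_le (v n) (hvt n).1
      exact this A hA
    have hev (ω : Ω) : ∀ᶠ n in atTop, M.claimSum f (v n) ω = M.claimSum f t ω := by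
      have h1 : Tendsto v atTop (𝓝[≥] t) :=
        tendsto_nhdsWithin_iff.2 ⟨hlim, .of_forall fun n => (hvt n).1.le⟩
      filter_upwards [h1.eventually (M.eventually_N_eq ω htT)] with n hn
      have (i : ℕ) : ω ∈ M.claimIn (v n) M.T i ↔ ω ∈ M.claimIn t M.T i := by
        simp [claimIn, hn]
      exact tsum_congr fun i => by
        by_cases h : ω ∈ M.claimIn t M.T i
        · rw [indicator_of_mem h, indicator_of_mem ((this i).2 h)]
        · rw [indicator_of_notMem h, indicator_of_notMem (mt (this i).1 h)]
    have hmono (ω : Ω) : Monotone fun n => φ (M.claimSum f (v n) ω) := fun m n hmn =>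
      hφ (M.claimSum_antitone f (hv.antitone hmn) (hvt m).2.le ω)
    have htend (ω : Ω) : Tendsto (fun n => φ (M.claimSum f (v n) ω)) atTop
        (𝓝 (φ (M.claimSum f t ω))) :=
      tendsto_const_nhds.congr' ((hev ω).mono fun n hn => by simp [hn])
    have hmeas (n : ℕ) : Measurable fun ω => φ (M.claimSum f (v n) ω) :=
      hφ.measurable.comp (M.measurable_claimSum hf (hvt n).2.le)
    have hA1 := lintegral_tendsto_of_tendsto_of_monotone (μ := P.restrict A)
      (fun n => (hmeas n).aemeasurable) (.of_forall hmono) (.of_forall htend)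
    have hA2 := lintegral_tendsto_of_tendsto_of_monotone (μ := P)
      (fun n => (hmeas n).aemeasurable) (.of_forall hmono) (.of_forall htend)
    rw [← hCeq t ht] at hA2
    simp_rw [← fun n => hCeq (v n) (hvt n).2.le] at hA2
    simp_rw [hmem] at hA1
    exact tendsto_nhds_unique hA1
      (ENNReal.Tendsto.const_mul hA2 (Or.inr (measure_ne_top _ _)))

theorem setLIntegral_claimSum [IsProbabilityMeasure P] {f : ℝ × ℝ → ℝ≥0∞} (hf : Measurable f)
    {t : ℝ≥0} (ht : t ≤ M.T) (hfin : ∫⁻ p, f p ∂M.intensity t ≠ ∞) {A : Set Ω}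
    (hA : MeasurableSet[M.filtration t] A) :
    ∫⁻ ω in A, M.claimSum f t ω ∂P = P A * ∫⁻ p, f p ∂M.intensity t :=
  M.setLIntegral_filtration hf (φ := id) (C := fun u => ∫⁻ p, f p ∂M.intensity u) monotone_id rfl
    ht hfin (fun _ hu _ hB => M.setLIntegral_claimSum_of_mem_pastSets hf hu hB) hA

theorem setLIntegral_claimSum_sq [IsProbabilityMeasure P] {f : ℝ × ℝ → ℝ≥0∞} (hf : Measurable f)
    {t : ℝ≥0} (ht : t ≤ M.T) (hfin : ∫⁻ p, f p ∂M.intensity t ≠ ∞)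
    (hfin2 : ∫⁻ p, f p ^ 2 ∂M.intensity t ≠ ∞) {A : Set Ω}
    (hA : MeasurableSet[M.filtration t] A) :
    ∫⁻ ω in A, M.claimSum f t ω ^ 2 ∂P =
      P A * (∫⁻ p, f p ^ 2 ∂M.intensity t + (∫⁻ p, f p ∂M.intensity t) ^ 2) :=
  M.setLIntegral_filtration hf (φ := fun z => z ^ 2)
    (C := fun u => ∫⁻ p, f p ^ 2 ∂M.intensity u + (∫⁻ p, f p ∂M.intensity u) ^ 2)
    (fun _ _ h => pow_le_pow_left' h 2) (by simp) ht
    (ENNReal.add_ne_top.2 ⟨hfin2, ENNReal.pow_ne_top hfin⟩)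
    (fun _ hu _ hB => M.setLIntegral_claimSum_sq_of_mem_pastSets hf hu hB) hA

/-- The sum of `g` over the claims that occur in `(t, s]`. -/
noncomputable def jumpSum (g : ℝ≥0 → ℝ → ℝ) (t s : ℝ≥0) (ω : Ω) : ℝ :=
  ∑ i ∈ Finset.Ico (M.N t ω) (M.N s ω), g (M.arrival i ω) (M.Y i ω)

theorem measurableSet_history_lt {r s : ℝ≥0} (hrs : r ≤ s) (hr : r ≤ M.T) (i : ℕ) {B : Set ℝ}
    (hB : MeasurableSet B) : MeasurableSet[M.history s] {ω | i < M.N r ω ∧ M.Y i ω ∈ B} :=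
  MeasurableSpace.measurableSet_generateFrom ⟨r, hrs, hr, i, B, hB, rfl⟩

theorem measurable_N_history {r s : ℝ≥0} (hrs : r ≤ s) (hr : r ≤ M.T) :
    Measurable[M.history s] (M.N r) := by
  refine measurable_of_Ioi (mδ := M.history s) fun i => ?_
  have : M.N r ⁻¹' Ioi i = {ω | i < M.N r ω ∧ M.Y i ω ∈ (univ : Set ℝ)} := by ext; simp
  rw [this]
  exact M.measurableSet_history_lt hrs hr i MeasurableSet.univ

/-- Arrival times and sizes are replaced by `0` for claims not yet seen at `s`, since only the
truncated variables `a i`, `y i` belong to the history at `s`. The sum of random length is the limit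
of the eventually constant sums `S n`. -/
theorem measurable_jumpSum_history {g : ℝ≥0 → ℝ → ℝ} (hg : Measurable (Function.uncurry g))
    {t s : ℝ≥0} (hts : t ≤ s) (hs : s ≤ M.T) : Measurable[M.history s] (M.jumpSum g t s) := by
  have hNs := M.measurable_N_history le_rfl hs
  have hNt := M.measurable_N_history hts (hts.trans hs)
  let a (i : ℕ) (ω : Ω) : ℝ≥0 := if i < M.N s ω then M.arrival i ω else 0
  let y (i : ℕ) (ω : Ω) : ℝ := if i < M.N s ω then M.Y i ω else 0
  have ha (i : ℕ) : Measurable[M.history s] (a i) := by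
    refine measurable_of_Iic (mδ := M.history s) fun c => ?_
    have : a i ⁻¹' Iic c = {ω | M.N s ω ≤ i} ∪ {ω | i < M.N (min c s) ω} := by
      ext ω
      simp only [a, mem_preimage, mem_Iic, mem_union, mem_ofPred_eq]
      have hmono := M.poisson.mono ω _ _ (min_le_right c s) hs
      split_ifs with h
      · have hT : i < M.N M.T ω := h.trans_le (M.poisson.mono ω _ _ hs le_rfl)
        have h1 := (M.arrival_le_iff hT hs).2 h
        rw [← M.arrival_le_iff hT ((min_le_right c s).trans hs)]
        simp [h1, h]
      · simp [not_lt.1 h]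
    rw [this]
    exact MeasurableSet.union (m := M.history s) (hNs measurableSet_Iic)
      (M.measurable_N_history (min_le_right c s) ((min_le_right c s).trans hs) measurableSet_Ioi)
  have hy (i : ℕ) : Measurable[M.history s] (y i) := by
    intro B hB
    have : y i ⁻¹' B = {ω | i < M.N s ω ∧ M.Y i ω ∈ B} ∪
        ({ω | M.N s ω ≤ i} ∩ {_ω | (0 : ℝ) ∈ B}) := by
      ext ω
      simp only [y, mem_preimage, mem_union, mem_inter_iff, mem_ofPred_eq]
      split_ifs with h
      · simp [h]
      · simp [not_lt.1 h, h]
    rw [this]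
    exact MeasurableSet.union (m := M.history s) (M.measurableSet_history_lt le_rfl hs i hB)
      (MeasurableSet.inter (m := M.history s) (hNs measurableSet_Iic)
        (@MeasurableSet.const _ (M.history s) _))
  let S (n : ℕ) (ω : Ω) : ℝ := ∑ i ∈ Finset.range n,
    if M.N t ω ≤ i ∧ i < M.N s ω then g (a i ω) (y i ω) else 0
  have hS (n : ℕ) : Measurable[M.history s] (S n) := by
    refine @Finset.measurable_fun_sum _ _ _ _ _ _ (M.history s) _ _ fun i _ => ?_
    refine Measurable.ite (m := M.history s) ?_ ?_ ?_
    · exact MeasurableSet.inter (m := M.history s) (hNt measurableSet_Iic)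
        (hNs measurableSet_Ioi)
    · exact hg.comp (Measurable.prodMk (ha i) (hy i))
    · exact @measurable_const _ _ _ (M.history s) _
  refine @measurable_of_tendsto_metrizable _ _ (M.history s) _ _ _ _ S _ hS ?_
  rw [tendsto_pi_nhds]
  intro ω
  refine tendsto_const_nhds.congr' ?_
  filter_upwards [eventually_ge_atTop (M.N s ω)] with n hn
  simp only [S, jumpSum, ← Finset.sum_filter]
  have : (Finset.range n).filter (fun i => M.N t ω ≤ i ∧ i < M.N s ω) =
      Finset.Ico (M.N t ω) (M.N s ω) := by
    ext i
    simp only [Finset.mem_filter, Finset.mem_range, Finset.mem_Ico]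
    omega
  rw [this]
  refine Finset.sum_congr rfl fun i hi => ?_
  simp [a, y, (Finset.mem_Ico.1 hi).2]

theorem stronglyMeasurable_jumpSum {g : ℝ≥0 → ℝ → ℝ} (hg : Measurable (Function.uncurry g))
    {t s : ℝ≥0} (hts : t ≤ s) (hs : s ≤ M.T) :
    StronglyMeasurable[M.filtration s] (M.jumpSum g t s) :=
  ((M.measurable_jumpSum_history hg hts hs).mono (M.history_le_filtration s)
    le_rfl).stronglyMeasurable

theorem measurable_jumpSum {g : ℝ≥0 → ℝ → ℝ} (hg : Measurable (Function.uncurry g))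
    {t s : ℝ≥0} (hts : t ≤ s) (hs : s ≤ M.T) : Measurable (M.jumpSum g t s) :=
  (M.stronglyMeasurable_jumpSum hg hts hs).measurable.mono (M.filtration.le s) le_rfl

theorem ae_Y_pos : ∀ᵐ ω ∂P, ∀ i, 0 < M.Y i ω := ae_all_iff.2 M.Y_pos

theorem ae_v_pos : ∀ᵐ y ∂M.v, 0 < y := by
  have : ∀ᵐ y ∂M.claimLaw, 0 < y := by
    rw [claimLaw, ae_map_iff (M.Y_measurable 0).aemeasurable measurableSet_Ioi]
    exact M.Y_pos 0
  exact Measure.ae_smul_measure this _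

theorem ae_intensity (t : ℝ≥0) : ∀ᵐ p ∂M.intensity t, p.1 ∈ Ioc (t : ℝ) M.T ∧ 0 < p.2 := by
  have h1 : ∀ᵐ r ∂(volume.restrict (Ioc (t : ℝ) M.T)), r ∈ Ioc (t : ℝ) M.T :=
    ae_restrict_mem measurableSet_Ioc
  exact (Measure.quasiMeasurePreserving_fst.ae h1).and
    (Measure.quasiMeasurePreserving_snd.ae M.ae_v_pos)

theorem memLp_claimLaw : MemLp (fun y => y) 2 M.claimLaw :=
  (memLp_map_measure_iff aestronglyMeasurable_id (M.Y_measurable 0).aemeasurable).2 (M.Y_memLp 0)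

theorem memLp_v : MemLp (fun y => y) 2 M.v :=
  M.memLp_claimLaw.smul_measure ENNReal.coe_ne_top

/-- The function `g` is dominated by a multiple of the claim size. -/
structure IsClaimBounded (g : ℝ≥0 → ℝ → ℝ) (K : ℝ) : Prop where
  measurable : Measurable (Function.uncurry g)
  nonneg : ∀ s ≤ M.T, ∀ y, 0 ≤ y → 0 ≤ g s y
  le : ∀ s ≤ M.T, ∀ y, 0 ≤ y → g s y ≤ K * y

variable {M}

namespace IsClaimBounded

variable {g : ℝ≥0 → ℝ → ℝ} {K : ℝ}

theorem measurable_prod (hg : M.IsClaimBounded g K) :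
    Measurable fun p : ℝ × ℝ => g p.1.toNNReal p.2 :=
  hg.measurable.comp ((measurable_real_toNNReal.comp measurable_fst).prodMk measurable_snd)

theorem ae_bounds (hg : M.IsClaimBounded g K) (t : ℝ≥0) : ∀ᵐ p ∂M.intensity t,
    0 ≤ g p.1.toNNReal p.2 ∧ g p.1.toNNReal p.2 ≤ K * p.2 := by
  filter_upwards [M.ae_intensity t] with p hp
  have : p.1.toNNReal ≤ M.T := Real.toNNReal_le_iff_le_coe.2 hp.1.2
  exact ⟨hg.nonneg _ this _ hp.2.le, hg.le _ this _ hp.2.le⟩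

theorem memLp_intensity [IsProbabilityMeasure P] (hg : M.IsClaimBounded g K) (t : ℝ≥0) :
    MemLp (fun p : ℝ × ℝ => g p.1.toNNReal p.2) 2 (M.intensity t) := by
  have := M.isFiniteMeasure_v
  have h2 : MemLp (fun p : ℝ × ℝ => K * p.2) 2 (M.intensity t) :=
    (M.memLp_v.comp_snd _).const_mul K
  refine h2.of_le hg.measurable_prod.aestronglyMeasurable ?_
  filter_upwards [hg.ae_bounds t] with p hp
  rw [Real.norm_of_nonneg hp.1]
  exact hp.2.trans (le_abs_self _)

end IsClaimBounded

variable (M)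

theorem ofReal_jumpSum {g : ℝ≥0 → ℝ → ℝ} {K : ℝ} (hg : M.IsClaimBounded g K) (t : ℝ≥0) :
    ∀ᵐ ω ∂P, 0 ≤ M.jumpSum g t M.T ω ∧ ENNReal.ofReal (M.jumpSum g t M.T ω) =
      M.claimSum (fun p => ENNReal.ofReal (g p.1.toNNReal p.2)) t ω := by
  filter_upwards [M.ae_Y_pos] with ω hω
  have h0 : ∀ i ∈ Finset.Ico (M.N t ω) (M.N M.T ω), 0 ≤ g (M.arrival i ω) (M.Y i ω) :=
    fun i _ => hg.nonneg _ (M.arrival_le i ω) _ (hω i).le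
  refine ⟨Finset.sum_nonneg h0, ?_⟩
  rw [jumpSum, ENNReal.ofReal_sum_of_nonneg h0, claimSum,
    tsum_eq_sum (s := Finset.Ico (M.N t ω) (M.N M.T ω))]
  · refine Finset.sum_congr rfl fun i hi => ?_
    rw [indicator_of_mem (show ω ∈ M.claimIn t M.T i from Finset.mem_Ico.1 hi)]
    simp [claimPoint]
  · exact fun i hi => indicator_of_notMem
      (fun h : ω ∈ M.claimIn t M.T i => hi (Finset.mem_Ico.2 h)) _

end InsuranceMarket

/-! ### Conditional mean and variance of a sum over future claims. -/

namespace InsuranceMarket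

variable {Ω : Type*} [MeasurableSpace Ω] {P : Measure Ω} (M : InsuranceMarket P)

namespace IsClaimBounded

variable {M} {g : ℝ≥0 → ℝ → ℝ} {K : ℝ}

theorem integrable_intensity [IsProbabilityMeasure P] (hg : M.IsClaimBounded g K) (t : ℝ≥0) :
    Integrable (fun p : ℝ × ℝ => g p.1.toNNReal p.2) (M.intensity t) := by
  have := M.isFiniteMeasure_v
  have hfi : IsFiniteMeasure (M.intensity t) := by unfold intensity; infer_instance
  exact (hg.memLp_intensity t).integrable one_le_two

theorem lintegral_intensity [IsProbabilityMeasure P] (hg : M.IsClaimBounded g K) (t : ℝ≥0) :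
    ∫⁻ p, ENNReal.ofReal (g p.1.toNNReal p.2) ∂M.intensity t =
      ENNReal.ofReal (∫ p, g p.1.toNNReal p.2 ∂M.intensity t) :=
  (ofReal_integral_eq_lintegral_ofReal (hg.integrable_intensity t)
    ((hg.ae_bounds t).mono fun _ h => h.1)).symm

theorem lintegral_sq_intensity [IsProbabilityMeasure P] (hg : M.IsClaimBounded g K) (t : ℝ≥0) :
    ∫⁻ p, ENNReal.ofReal (g p.1.toNNReal p.2) ^ 2 ∂M.intensity t =
      ENNReal.ofReal (∫ p, g p.1.toNNReal p.2 ^ 2 ∂M.intensity t) := by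
  rw [ofReal_integral_eq_lintegral_ofReal (hg.memLp_intensity t).integrable_sq
    (.of_forall fun _ => sq_nonneg _)]
  refine lintegral_congr_ae ((hg.ae_bounds t).mono fun p hp => ?_)
  simp only
  rw [ENNReal.ofReal_pow hp.1]

theorem measurable_ofReal (hg : M.IsClaimBounded g K) :
    Measurable fun p : ℝ × ℝ => ENNReal.ofReal (g p.1.toNNReal p.2) :=
  hg.measurable_prod.ennreal_ofReal

theorem setLIntegral_jumpSum [IsProbabilityMeasure P] (hg : M.IsClaimBounded g K) {t : ℝ≥0}
    (ht : t ≤ M.T) {A : Set Ω} (hA : MeasurableSet[M.filtration t] A) :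
    ∫⁻ ω in A, ENNReal.ofReal (M.jumpSum g t M.T ω) ∂P =
      P A * ENNReal.ofReal (∫ p, g p.1.toNNReal p.2 ∂M.intensity t) := by
  rw [← hg.lintegral_intensity, ← M.setLIntegral_claimSum hg.measurable_ofReal ht
    (by rw [hg.lintegral_intensity]; exact ENNReal.ofReal_ne_top) hA]
  exact lintegral_congr_ae (ae_restrict_of_ae ((M.ofReal_jumpSum hg t).mono fun _ h => h.2))

theorem setLIntegral_jumpSum_sq [IsProbabilityMeasure P] (hg : M.IsClaimBounded g K) {t : ℝ≥0}
    (ht : t ≤ M.T) {A : Set Ω} (hA : MeasurableSet[M.filtration t] A) :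
    ∫⁻ ω in A, ENNReal.ofReal (M.jumpSum g t M.T ω ^ 2) ∂P =
      P A * ENNReal.ofReal (∫ p, g p.1.toNNReal p.2 ^ 2 ∂M.intensity t +
        (∫ p, g p.1.toNNReal p.2 ∂M.intensity t) ^ 2) := by
  have h0 : 0 ≤ ∫ p, g p.1.toNNReal p.2 ∂M.intensity t :=
    integral_nonneg_of_ae ((hg.ae_bounds t).mono fun _ h => h.1)
  rw [ENNReal.ofReal_add (integral_nonneg fun _ => sq_nonneg _) (sq_nonneg _),
    ENNReal.ofReal_pow h0, ← hg.lintegral_sq_intensity, ← hg.lintegral_intensity,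
    ← M.setLIntegral_claimSum_sq hg.measurable_ofReal ht
    (by rw [hg.lintegral_intensity]; exact ENNReal.ofReal_ne_top)
    (by rw [hg.lintegral_sq_intensity]; exact ENNReal.ofReal_ne_top) hA]
  refine lintegral_congr_ae (ae_restrict_of_ae ((M.ofReal_jumpSum hg t).mono fun ω h => ?_))
  simp only
  rw [ENNReal.ofReal_pow h.1, h.2]

theorem memLp_jumpSum [IsProbabilityMeasure P] (hg : M.IsClaimBounded g K) {t : ℝ≥0}
    (ht : t ≤ M.T) : MemLp (M.jumpSum g t M.T) 2 P := by
  have hm := M.measurable_jumpSum hg.measurable ht le_rfl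
  refine (memLp_two_iff_integrable_sq hm.aestronglyMeasurable).2
    ⟨(hm.pow_const 2).aestronglyMeasurable, ?_⟩
  rw [hasFiniteIntegral_iff_ofReal (.of_forall fun _ => sq_nonneg _)]
  have := hg.setLIntegral_jumpSum_sq ht (A := univ) MeasurableSet.univ
  rw [Measure.restrict_univ] at this
  rw [this, measure_univ, one_mul]
  exact ENNReal.ofReal_lt_top

theorem condExp_eq_const_of_setLIntegral [IsProbabilityMeasure P] {t : ℝ≥0} {Z : Ω → ℝ} {C : ℝ}
    (hZ : Integrable Z P) (hZ0 : 0 ≤ᵐ[P] Z) (hC : 0 ≤ C)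
    (h : ∀ A, MeasurableSet[M.filtration t] A →
      ∫⁻ ω in A, ENNReal.ofReal (Z ω) ∂P = P A * ENNReal.ofReal C) :
    P[Z | M.filtration t] =ᵐ[P] fun _ => C := by
  symm
  refine ae_eq_condExp_of_forall_setIntegral_eq (M.filtration.le t) hZ
    (fun _ _ _ => (integrable_const C).integrableOn) (fun A hA _ => ?_)
    stronglyMeasurable_const.aestronglyMeasurable
  rw [integral_eq_lintegral_of_nonneg_ae (ae_restrict_of_ae hZ0) hZ.1.restrict, h A hA,
    ENNReal.toReal_mul, ENNReal.toReal_ofReal hC]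
  simp [measureReal_def]

theorem condExp_jumpSum [IsProbabilityMeasure P] (hg : M.IsClaimBounded g K) {t : ℝ≥0}
    (ht : t ≤ M.T) : P[M.jumpSum g t M.T | M.filtration t] =ᵐ[P]
      fun _ => ∫ p, g p.1.toNNReal p.2 ∂M.intensity t :=
  condExp_eq_const_of_setLIntegral ((hg.memLp_jumpSum ht).integrable one_le_two)
    ((M.ofReal_jumpSum hg t).mono fun _ h => h.1)
    (integral_nonneg_of_ae ((hg.ae_bounds t).mono fun _ h => h.1))
    fun _ hA => hg.setLIntegral_jumpSum ht hA

theorem condVar_jumpSum [IsProbabilityMeasure P] (hg : M.IsClaimBounded g K) {t : ℝ≥0}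
    (ht : t ≤ M.T) : Var[M.jumpSum g t M.T; P | M.filtration t] =ᵐ[P]
      fun _ => ∫ p, g p.1.toNNReal p.2 ^ 2 ∂M.intensity t := by
  have h2 : P[(M.jumpSum g t M.T) ^ 2 | M.filtration t] =ᵐ[P] fun _ =>
      ∫ p, g p.1.toNNReal p.2 ^ 2 ∂M.intensity t +
        (∫ p, g p.1.toNNReal p.2 ∂M.intensity t) ^ 2 :=
    condExp_eq_const_of_setLIntegral (hg.memLp_jumpSum ht).integrable_sq
      (.of_forall fun _ => sq_nonneg _)
      (add_nonneg (integral_nonneg fun _ => sq_nonneg _) (sq_nonneg _))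
      fun _ hA => hg.setLIntegral_jumpSum_sq ht hA
  filter_upwards [condVar_ae_eq_condExp_sq_sub_sq_condExp (M.filtration.le t)
    (hg.memLp_jumpSum ht), h2, hg.condExp_jumpSum ht] with ω h1 h2 h3
  rw [h1, Pi.sub_apply, Pi.pow_apply, h2, h3]
  ring

/-- The integral against the intensity as an iterated integral. -/
theorem integral_intensity [IsProbabilityMeasure P] {G : ℝ × ℝ → ℝ} {t : ℝ≥0} (ht : t ≤ M.T)
    (hG : Integrable G (M.intensity t)) :
    ∫ p, G p ∂M.intensity t = ∫ r in (t : ℝ)..M.T, ∫ y, G (r, y) ∂M.v := by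
  have := M.isFiniteMeasure_v
  rw [intervalIntegral.integral_of_le (NNReal.coe_le_coe.2 ht)]
  exact integral_prod _ hG

end IsClaimBounded

end InsuranceMarket

/-! ### The growth factor and linear integral equations. -/

/-- Rates are controlled on `[0, T]` only, so integrability is not available for all endpoints.
Viewing the endpoints as parameters of a jointly measurable integrand avoids it. -/
theorem measurable_intervalIntegral_prod {ρ : ℝ → ℝ} (hρ : Measurable ρ) :
    Measurable fun p : ℝ × ℝ => ∫ r in p.1..p.2, ρ r := by
  have key : Measurable fun p : ℝ × ℝ => ∫ r in Ioc p.1 p.2, ρ r := by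
    have h1 : (fun p : ℝ × ℝ => ∫ r in Ioc p.1 p.2, ρ r) = fun p : ℝ × ℝ =>
        ∫ r, {z : (ℝ × ℝ) × ℝ | z.1.1 < z.2 ∧ z.2 ≤ z.1.2}.indicator (fun z => ρ z.2) (p, r) := by
      funext p
      rw [← integral_indicator measurableSet_Ioc]
      congr
    rw [h1]
    refine (StronglyMeasurable.integral_prod_right' (f := fun z : (ℝ × ℝ) × ℝ =>
      {z : (ℝ × ℝ) × ℝ | z.1.1 < z.2 ∧ z.2 ≤ z.1.2}.indicator (fun z => ρ z.2) z)
      (Measurable.stronglyMeasurable ?_)).measurable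
    refine (hρ.comp measurable_snd).indicator (MeasurableSet.inter ?_ ?_)
    · exact measurableSet_lt (measurable_fst.comp measurable_fst) measurable_snd
    · exact measurableSet_le measurable_snd (measurable_snd.comp measurable_fst)
  have h2 : (fun p : ℝ × ℝ => ∫ r in p.1..p.2, ρ r) =
      fun p => (∫ r in Ioc p.1 p.2, ρ r) - ∫ r in Ioc p.2 p.1, ρ r := rfl
  rw [h2]
  exact key.sub (key.comp (measurable_snd.prodMk measurable_fst))

/-- The value at time `s` of one unit invested at time `0` at the rate `ρ`. -/
noncomputable def growth (ρ : ℝ → ℝ) (s : ℝ) : ℝ := Real.exp (∫ r in (0 : ℝ)..s, ρ r)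

theorem growth_pos (ρ : ℝ → ℝ) (s : ℝ) : 0 < growth ρ s := Real.exp_pos _

theorem measurable_growth {ρ : ℝ → ℝ} (hρ : Measurable ρ) : Measurable (growth ρ) :=
  Real.measurable_exp.comp
    ((measurable_intervalIntegral_prod hρ).comp (measurable_const.prodMk measurable_id))

/-- A rate that is measurable, and bounded on `[0, T]`. -/
structure IsBoundedRate (T : ℝ) (ρ : ℝ → ℝ) (K : ℝ) : Prop where
  measurable : Measurable ρ
  abs_le : ∀ s ∈ Icc 0 T, |ρ s| ≤ K

namespace IsBoundedRate

variable {T K : ℝ} {ρ : ℝ → ℝ}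

theorem neg (h : IsBoundedRate T ρ K) : IsBoundedRate T (fun s => -ρ s) K :=
  ⟨h.measurable.neg, fun s hs => by rw [abs_neg]; exact h.abs_le s hs⟩

theorem intervalIntegrable (h : IsBoundedRate T ρ K) {a b : ℝ} (ha : a ∈ Icc 0 T)
    (hb : b ∈ Icc 0 T) : IntervalIntegrable ρ volume a b := by
  rw [intervalIntegrable_iff]
  refine Measure.integrableOn_of_bounded (M := K) measure_Ioc_lt_top.ne
    h.measurable.aestronglyMeasurable ((ae_restrict_mem measurableSet_uIoc).mono fun r hr => ?_)
  exact h.abs_le r (uIcc_subset_Icc ha hb (uIoc_subset_uIcc hr))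

theorem abs_integral_le (h : IsBoundedRate T ρ K) {a b : ℝ} (ha : a ∈ Icc 0 T)
    (hb : b ∈ Icc 0 T) : |∫ r in a..b, ρ r| ≤ K * |b - a| :=
  intervalIntegral.norm_integral_le_of_norm_le_const (f := ρ) fun r hr =>
    h.abs_le r (uIcc_subset_Icc ha hb (uIoc_subset_uIcc hr))

theorem growth_eq_mul (h : IsBoundedRate T ρ K) {a b : ℝ} (ha : a ∈ Icc 0 T)
    (hb : b ∈ Icc 0 T) : growth ρ b = growth ρ a * Real.exp (∫ r in a..b, ρ r) := by
  have h0 : (0 : ℝ) ∈ Icc 0 T := ⟨le_rfl, ha.1.trans ha.2⟩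
  rw [growth, growth, ← Real.exp_add, intervalIntegral.integral_add_adjacent_intervals
    (h.intervalIntegrable h0 ha) (h.intervalIntegrable ha hb)]

/-- The rate is merely measurable, so the growth factor need not be differentiable everywhere. It is
Lipschitz, because its exponent is `K`-Lipschitz and bounded by `K * T`; this suffices for
integration by parts. -/
theorem absolutelyContinuous_growth (h : IsBoundedRate T ρ K) {a b : ℝ} (ha : a ∈ Icc 0 T)
    (hb : b ∈ Icc 0 T) : AbsolutelyContinuousOnInterval (growth ρ) a b := by
  have h0 : (0 : ℝ) ∈ Icc 0 T := ⟨le_rfl, ha.1.trans ha.2⟩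
  have hK : 0 ≤ K := (abs_nonneg _).trans (h.abs_le 0 h0)
  have hbd (s : ℝ) (hs : s ∈ Icc 0 T) : ∫ r in (0 : ℝ)..s, ρ r ≤ K * T := by
    refine (le_abs_self _).trans ((h.abs_integral_le h0 hs).trans ?_)
    rw [sub_zero, abs_of_nonneg hs.1]
    exact mul_le_mul_of_nonneg_left hs.2 hK
  refine LipschitzOnWith.absolutelyContinuousOnInterval (K := (Real.exp (K * T) * K).toNNReal)
    (LipschitzOnWith.of_dist_le_mul fun x hx y hy => ?_)
  have hx' := uIcc_subset_Icc ha hb hx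
  have hy' := uIcc_subset_Icc ha hb hy
  rw [Real.coe_toNNReal _ (by positivity), Real.dist_eq, Real.dist_eq]
  have h1 : ‖growth ρ x - growth ρ y‖ ≤
      Real.exp (K * T) * ‖(∫ r in (0 : ℝ)..x, ρ r) - ∫ r in (0 : ℝ)..y, ρ r‖ := by
    refine (convex_Iic (K * T)).norm_image_sub_le_of_norm_deriv_le (f := Real.exp)
      (fun z _ => Real.differentiableAt_exp) (fun z hz => ?_) (hbd y hy') (hbd x hx')
    rw [Real.deriv_exp, Real.norm_of_nonneg (Real.exp_pos z).le]
    exact Real.exp_le_exp.2 hz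
  refine h1.trans ?_
  rw [mul_assoc, intervalIntegral.integral_interval_sub_left (h.intervalIntegrable h0 hx')
    (h.intervalIntegrable h0 hy')]
  exact mul_le_mul_of_nonneg_left (h.abs_integral_le hy' hx') (Real.exp_pos _).le

theorem ae_hasDerivAt_growth (h : IsBoundedRate T ρ K) :
    ∀ᵐ x, x ∈ Icc 0 T → HasDerivAt (growth ρ) (growth ρ x * ρ x) x := by
  rcases le_or_gt 0 T with hT | hT
  · have h0 : (0 : ℝ) ∈ Icc 0 T := ⟨le_rfl, hT⟩
    filter_upwards [(h.intervalIntegrable h0 ⟨hT, le_rfl⟩).ae_hasDerivAt_integral] with x hx hxT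
    rw [uIcc_of_le hT] at hx
    exact (hx hxT 0 h0).exp
  · filter_upwards with x hx
    exact absurd (hx.1.trans hx.2) (not_le.2 hT)

/-- Integration by parts against the growth factor. -/
theorem integral_rate_mul_growth (h : IsBoundedRate T ρ K) {t s : ℝ} (ht : t ∈ Icc 0 T)
    (hs : s ∈ Icc 0 T) {β : ℝ → ℝ} (hβ : IntervalIntegrable β volume t s) (k : ℝ) :
    ∫ r in t..s, ρ r * (growth ρ r * (k + ∫ u in t..r, β u)) =
      growth ρ s * (k + ∫ u in t..s, β u) - growth ρ t * k - ∫ r in t..s, growth ρ r * β r := by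
  have hsub := uIcc_subset_Icc ht hs
  have hg := h.absolutelyContinuous_growth ht hs
  have hc : AbsolutelyContinuousOnInterval (fun _ : ℝ => k) t s :=
    LipschitzOnWith.absolutelyContinuousOnInterval (K := 0)
      (LipschitzWith.const k).lipschitzOnWith
  have hD : AbsolutelyContinuousOnInterval (fun r => k + ∫ u in t..r, β u) t s :=
    hc.add (hβ.absolutelyContinuousOnInterval_intervalIntegral left_mem_uIcc)
  have hparts := hg.integral_mul_deriv_eq_deriv_mul hD
  have e1 : ∫ r in t..s, growth ρ r * deriv (fun r => k + ∫ u in t..r, β u) r =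
      ∫ r in t..s, growth ρ r * β r := by
    refine intervalIntegral.integral_congr_ae ?_
    filter_upwards [hβ.ae_hasDerivAt_integral] with r hr hrI
    rw [((hr (uIoc_subset_uIcc hrI) t left_mem_uIcc).const_add k).deriv]
  have e2 : ∫ r in t..s, deriv (growth ρ) r * (k + ∫ u in t..r, β u) =
      ∫ r in t..s, ρ r * (growth ρ r * (k + ∫ u in t..r, β u)) := by
    refine intervalIntegral.integral_congr_ae ?_
    filter_upwards [h.ae_hasDerivAt_growth] with r hr hrI
    rw [(hr (hsub (uIoc_subset_uIcc hrI))).deriv]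
    ring
  rw [e1, e2, intervalIntegral.integral_same, add_zero] at hparts
  linarith

theorem integral_rate_mul_growth_const (h : IsBoundedRate T ρ K) {t s : ℝ} (ht : t ∈ Icc 0 T)
    (hs : s ∈ Icc 0 T) (k : ℝ) :
    ∫ r in t..s, ρ r * (growth ρ r * k) = growth ρ s * k - growth ρ t * k := by
  simpa using h.integral_rate_mul_growth ht hs
    (intervalIntegrable_const : IntervalIntegrable (fun _ => (0 : ℝ)) volume t s) k

theorem continuousOn_growth (h : IsBoundedRate T ρ K) {t s : ℝ} (ht : t ∈ Icc 0 T)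
    (hs : s ∈ Icc 0 T) : ContinuousOn (growth ρ) (uIcc t s) :=
  (h.absolutelyContinuous_growth ht hs).continuousOn

theorem intervalIntegrable_rate_mul_growth_mul (h : IsBoundedRate T ρ K) {t s : ℝ}
    (ht : t ∈ Icc 0 T) (hs : s ∈ Icc 0 T) {D : ℝ → ℝ} (hD : ContinuousOn D (uIcc t s)) :
    IntervalIntegrable (fun r => ρ r * (growth ρ r * D r)) volume t s :=
  (h.intervalIntegrable ht hs).mul_continuousOn ((h.continuousOn_growth ht hs).mul hD)

theorem intervalIntegrable_step (h : IsBoundedRate T ρ K) {t s : ℝ} (ht : t ∈ Icc 0 T)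
    (hs : s ∈ Icc 0 T) (τ a : ℝ) :
    IntervalIntegrable (fun r => ρ r * (growth ρ r * if τ ≤ r then a else 0)) volume t s := by
  have h1 := h.intervalIntegrable_rate_mul_growth_mul ht hs
    (continuousOn_const (c := a) (s := uIcc t s))
  rw [intervalIntegrable_iff] at h1 ⊢
  refine (h1.indicator (measurableSet_Ici (a := τ))).congr (.of_forall fun r => ?_)
  by_cases hr : τ ≤ r <;> simp [indicator, hr]

/-- The effect of one claim at time `τ`: the interest earned on it from `τ` on accounts for its
accumulated value at `s`, except for the jump `growth ρ τ * a` itself. -/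
theorem integral_step (h : IsBoundedRate T ρ K) {t s : ℝ} (ht : t ∈ Icc 0 T)
    (hs : s ∈ Icc 0 T) {τ : ℝ} (htτ : t ≤ τ) (hτs : τ ≤ s) (a : ℝ) :
    ∫ r in t..s, ρ r * (growth ρ r * if τ ≤ r then a else 0) =
      growth ρ s * a - growth ρ τ * a := by
  have hτ : τ ∈ Icc 0 T := ⟨ht.1.trans htτ, hτs.trans hs.2⟩
  rw [← intervalIntegral.integral_add_adjacent_intervals (h.intervalIntegrable_step ht hτ τ a)
    (h.intervalIntegrable_step hτ hs τ a), ← h.integral_rate_mul_growth_const hτ hs]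
  have e1 : ∫ r in t..τ, ρ r * (growth ρ r * if τ ≤ r then a else 0) = ∫ r in t..τ, (0 : ℝ) := by
    refine intervalIntegral.integral_congr_ae ?_
    filter_upwards [Measure.ae_ne volume τ] with r hr hrI
    rw [uIoc_of_le htτ] at hrI
    rw [if_neg (not_le.2 (lt_of_le_of_ne hrI.2 hr)), mul_zero, mul_zero]
  have e2 : ∫ r in τ..s, ρ r * (growth ρ r * if τ ≤ r then a else 0) =
      ∫ r in τ..s, ρ r * (growth ρ r * a) := by
    refine intervalIntegral.integral_congr fun r hr => ?_
    rw [uIcc_of_le hτs] at hr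
    simp only [if_pos hr.1]
  rw [e1, e2, intervalIntegral.integral_zero, zero_add]

/-- The homogeneous linear integral equation has only the zero solution. -/
theorem eq_zero_of_eq_integral (h : IsBoundedRate T ρ K) {t : ℝ} (ht : t ∈ Icc 0 T) {D : ℝ → ℝ}
    (hD : IntervalIntegrable (fun r => ρ r * D r) volume t T)
    (heq : ∀ s ∈ Icc t T, D s = ∫ r in t..s, ρ r * D r) {s : ℝ} (hs : s ∈ Icc t T) : D s = 0 := by
  have hs' : s ∈ Icc 0 T := ⟨ht.1.trans hs.1, hs.2⟩
  have hsub : uIcc t s ⊆ uIcc t T := by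
    rw [uIcc_of_le hs.1, uIcc_of_le ht.2]; exact Icc_subset_Icc_right hs.2
  have hDs := hD.mono_set hsub
  -- The growth factor of `-ρ` is the integrating factor. The integrals on the two sides cancel,
  -- leaving its product with `D s` equal to zero.
  have key := h.neg.integral_rate_mul_growth ht hs' hDs 0
  have e1 : ∫ r in t..s, -ρ r * (growth (fun s => -ρ s) r * (0 + ∫ u in t..r, ρ u * D u)) =
      - ∫ r in t..s, growth (fun s => -ρ s) r * (ρ r * D r) := by
    rw [← intervalIntegral.integral_neg]
    refine intervalIntegral.integral_congr fun r hr => ?_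
    rw [uIcc_of_le hs.1] at hr
    simp only [zero_add]
    rw [← heq r ⟨hr.1, hr.2.trans hs.2⟩]
    ring
  rw [e1, mul_zero, zero_add, ← heq s hs] at key
  have : growth (fun s => -ρ s) s * D s = 0 := by linarith
  exact (mul_eq_zero.1 this).resolve_left (growth_pos _ _).ne'

end IsBoundedRate

theorem IsInterestRate.exists_isBoundedRate {T : ℝ≥0} {ρ : ℝ → ℝ} (h : IsInterestRate T ρ) :
    ∃ K, IsBoundedRate T ρ K := by
  obtain ⟨K, hK⟩ := h.bdd
  exact ⟨K, h.measurable, fun s hs => by rw [abs_of_pos (h.pos s hs)]; exact hK s hs⟩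

theorem IsBoundedRate.growth_le {T K : ℝ} {ρ : ℝ → ℝ} (h : IsBoundedRate T ρ K) {s : ℝ}
    (hs : s ∈ Icc 0 T) : growth ρ s ≤ Real.exp (K * T) ∧ (growth ρ s)⁻¹ ≤ Real.exp (K * T) := by
  have h0 : (0 : ℝ) ∈ Icc 0 T := ⟨le_rfl, hs.1.trans hs.2⟩
  have hK : 0 ≤ K := (abs_nonneg _).trans (h.abs_le 0 h0)
  have : |∫ r in (0 : ℝ)..s, ρ r| ≤ K * T := by
    refine (h.abs_integral_le h0 hs).trans ?_
    rw [sub_zero, abs_of_nonneg hs.1]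
    exact mul_le_mul_of_nonneg_left hs.2 hK
  rw [growth, ← Real.exp_neg]
  exact ⟨Real.exp_le_exp.2 (_root_.abs_le.1 this).2, Real.exp_le_exp.2 (by linarith [(_root_.abs_le.1 this).1])⟩

theorem IntervalIntegrable.fun_sum_of_mem {ι : Type*} (I : Finset ι) {f : ι → ℝ → ℝ} {a b : ℝ}
    (h : ∀ i ∈ I, IntervalIntegrable (f i) volume a b) :
    IntervalIntegrable (fun r => ∑ i ∈ I, f i r) volume a b := by
  have := IntervalIntegrable.sum I h
  rwa [Finset.sum_fn] at this

theorem NNReal.coe_mem_Icc_zero {s T : ℝ≥0} (h : s ≤ T) : (s : ℝ) ∈ Icc (0 : ℝ) T :=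
  ⟨s.coe_nonneg, NNReal.coe_le_coe.2 h⟩

/-! ### Existence, uniqueness and square integrability for the surplus equations. -/

namespace InsuranceMarket

variable {Ω : Type*} [MeasurableSpace Ω] {P : Measure Ω} (M : InsuranceMarket P)

/-- The explicit solution of the linear equation with deterministic coefficients. -/
noncomputable def linearSolution (ρ : ℝ → ℝ) (b : ℝ≥0 → ℝ) (h : ℝ≥0 → ℝ → ℝ) (t : ℝ≥0) (x : ℝ)
    (s : ℝ≥0) (ω : Ω) : ℝ :=
  growth ρ s * (x / growth ρ t + (∫ r in (t : ℝ)..s, b r.toNNReal / growth ρ r)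
    - M.jumpSum (fun r y => h r y / growth ρ r) t s ω)

/-- The index set on the right does not depend on `r`, so the claim sum becomes a finite sum of step
functions that can be integrated in `r` term by term. -/
theorem jumpSum_toNNReal (g : ℝ≥0 → ℝ → ℝ) {t s : ℝ≥0} (hs : s ≤ M.T) {r : ℝ}
    (hr : r ∈ Icc (t : ℝ) s) (ω : Ω) :
    M.jumpSum g t r.toNNReal ω = ∑ i ∈ Finset.Ico (M.N t ω) (M.N s ω),
      if (M.arrival i ω : ℝ) ≤ r then g (M.arrival i ω) (M.Y i ω) else 0 := by
  have h0 : 0 ≤ r := t.coe_nonneg.trans hr.1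
  have hrs : r.toNNReal ≤ s := Real.toNNReal_le_iff_le_coe.2 hr.2
  rw [← Finset.sum_filter, jumpSum]
  refine Finset.sum_congr ?_ fun _ _ => rfl
  ext i
  simp only [Finset.mem_Ico, Finset.mem_filter]
  have hmono := M.poisson.mono ω _ _ hrs hs
  have hmono' := M.poisson.mono ω _ _ hs le_rfl
  have key (hi : i < M.N s ω) : (M.arrival i ω : ℝ) ≤ r ↔ i < M.N r.toNNReal ω := by
    rw [← M.arrival_le_iff (hi.trans_le hmono') (hrs.trans hs), Real.le_toNNReal_iff_coe_le h0]
  constructor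
  · rintro ⟨h1, h2⟩
    have := h2.trans_le hmono
    exact ⟨⟨h1, this⟩, (key this).2 h2⟩
  · rintro ⟨⟨h1, h2⟩, h3⟩
    exact ⟨h1, (key h2).1 h3⟩

section LinearEquation

variable {ρ : ℝ → ℝ} {b : ℝ≥0 → ℝ} {h : ℝ≥0 → ℝ → ℝ} {t : ℝ≥0} {x : ℝ}

theorem intervalIntegrable_drift (hb : IntervalIntegrable (fun r : ℝ => b r.toNNReal) volume 0 M.T)
    {t s : ℝ≥0} (ht : t ≤ M.T) (hs : s ≤ M.T) :
    IntervalIntegrable (fun r : ℝ => b r.toNNReal) volume t s := by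
  refine hb.mono_set ?_
  rw [uIcc_of_le M.T.coe_nonneg]
  exact uIcc_subset_Icc (NNReal.coe_mem_Icc_zero ht) (NNReal.coe_mem_Icc_zero hs)

theorem intervalIntegrable_drift_div {K : ℝ} (hρ : IsBoundedRate M.T ρ K)
    (hb : IntervalIntegrable (fun r : ℝ => b r.toNNReal) volume 0 M.T)
    {t s : ℝ≥0} (ht : t ≤ M.T) (hs : s ≤ M.T) :
    IntervalIntegrable (fun r : ℝ => b r.toNNReal / growth ρ r) volume t s := by
  simp_rw [div_eq_mul_inv]
  exact (M.intervalIntegrable_drift hb ht hs).mul_continuousOn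
    ((hρ.continuousOn_growth (NNReal.coe_mem_Icc_zero ht) (NNReal.coe_mem_Icc_zero hs)).inv₀
      fun r _ => (growth_pos ρ r).ne')

theorem linearSolution_eq_sub {s : ℝ≥0} (hs : s ≤ M.T) {r : ℝ} (hr : r ∈ Icc (t : ℝ) s) (ω : Ω) :
    ρ r * M.linearSolution ρ b h t x r.toNNReal ω =
      ρ r * (growth ρ r * (x / growth ρ t + ∫ u in (t : ℝ)..r, b u.toNNReal / growth ρ u)) -
      ∑ i ∈ Finset.Ico (M.N t ω) (M.N s ω), ρ r * (growth ρ r *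
        if (M.arrival i ω : ℝ) ≤ r then h (M.arrival i ω) (M.Y i ω) / growth ρ (M.arrival i ω)
        else 0) := by
  have h0 : 0 ≤ r := t.coe_nonneg.trans hr.1
  rw [linearSolution, M.jumpSum_toNNReal _ hs hr, Real.coe_toNNReal r h0, ← Finset.mul_sum,
    ← Finset.mul_sum]
  ring

theorem intervalIntegrable_linearSolution {K : ℝ} (hρ : IsBoundedRate M.T ρ K)
    (hb : IntervalIntegrable (fun r : ℝ => b r.toNNReal) volume 0 M.T)
    {s : ℝ≥0} (hts : t ≤ s) (hs : s ≤ M.T) (ω : Ω) :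
    IntervalIntegrable (fun r => ρ r * M.linearSolution ρ b h t x r.toNNReal ω) volume t s := by
  have ht' := NNReal.coe_mem_Icc_zero (hts.trans hs)
  have hs' := NNReal.coe_mem_Icc_zero hs
  have hβ := M.intervalIntegrable_drift_div hρ hb (hts.trans hs) hs
  have hD : ContinuousOn (fun r => x / growth ρ t + ∫ u in (t : ℝ)..r, b u.toNNReal / growth ρ u)
      (uIcc (t : ℝ) s) :=
    continuousOn_const.add
      (hβ.absolutelyContinuousOnInterval_intervalIntegral left_mem_uIcc).continuousOn
  refine IntervalIntegrable.congr (fun r hr => (M.linearSolution_eq_sub hs ?_ ω).symm)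
    ((hρ.intervalIntegrable_rate_mul_growth_mul ht' hs' hD).sub
      (IntervalIntegrable.fun_sum_of_mem _ fun i _ => hρ.intervalIntegrable_step ht' hs' _ _))
  rw [uIoc_of_le (NNReal.coe_le_coe.2 hts)] at hr
  exact ⟨hr.1.le, hr.2⟩

/-- Variation of constants: integration by parts handles the continuous part and `integral_step`
each claim. The discounting of a claim cancels against the growth factor at its arrival time. -/
theorem linearSolution_integral_eq {K : ℝ} (hρ : IsBoundedRate M.T ρ K)
    (hb : IntervalIntegrable (fun r : ℝ => b r.toNNReal) volume 0 M.T)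
    {s : ℝ≥0} (hts : t ≤ s) (hs : s ≤ M.T) (ω : Ω) :
    M.linearSolution ρ b h t x s ω = x + (∫ r in (t : ℝ)..s,
      (b r.toNNReal + ρ r * M.linearSolution ρ b h t x r.toNNReal ω)) - M.jumpSum h t s ω := by
  have ht' := NNReal.coe_mem_Icc_zero (hts.trans hs)
  have hs' := NNReal.coe_mem_Icc_zero hs
  have hts' : (t : ℝ) ≤ s := NNReal.coe_le_coe.2 hts
  have hβ := M.intervalIntegrable_drift_div hρ hb (hts.trans hs) hs
  have hD : ContinuousOn (fun r => x / growth ρ t + ∫ u in (t : ℝ)..r, b u.toNNReal / growth ρ u)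
      (uIcc (t : ℝ) s) :=
    continuousOn_const.add
      (hβ.absolutelyContinuousOnInterval_intervalIntegral left_mem_uIcc).continuousOn
  have hτ (i : ℕ) (hi : i ∈ Finset.Ico (M.N t ω) (M.N s ω)) :
      (t : ℝ) ≤ M.arrival i ω ∧ (M.arrival i ω : ℝ) ≤ s := by
    rw [Finset.mem_Ico] at hi
    have hiT := hi.2.trans_le (M.poisson.mono ω _ _ hs le_rfl)
    exact ⟨NNReal.coe_le_coe.2 (M.lt_arrival (hts.trans hs) hi.1 hiT).le,
      NNReal.coe_le_coe.2 ((M.arrival_le_iff hiT hs).2 hi.2)⟩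
  rw [intervalIntegral.integral_add (M.intervalIntegrable_drift hb (hts.trans hs) hs)
    (M.intervalIntegrable_linearSolution hρ hb hts hs ω)]
  have e1 : ∫ r in (t : ℝ)..s, ρ r * M.linearSolution ρ b h t x r.toNNReal ω =
      ∫ r in (t : ℝ)..s, (ρ r * (growth ρ r *
        (x / growth ρ t + ∫ u in (t : ℝ)..r, b u.toNNReal / growth ρ u)) -
      ∑ i ∈ Finset.Ico (M.N t ω) (M.N s ω), ρ r * (growth ρ r *
        if (M.arrival i ω : ℝ) ≤ r then h (M.arrival i ω) (M.Y i ω) / growth ρ (M.arrival i ω)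
        else 0)) := by
    refine intervalIntegral.integral_congr fun r hr => ?_
    rw [uIcc_of_le hts'] at hr
    exact M.linearSolution_eq_sub hs hr ω
  have e2 : ∫ r in (t : ℝ)..s, growth ρ r * (b r.toNNReal / growth ρ r) =
      ∫ r in (t : ℝ)..s, b r.toNNReal :=
    intervalIntegral.integral_congr fun r _ => mul_div_cancel₀ _ (growth_pos ρ r).ne'
  rw [e1, intervalIntegral.integral_sub (hρ.intervalIntegrable_rate_mul_growth_mul ht' hs' hD)
    (IntervalIntegrable.fun_sum_of_mem _ fun i _ => hρ.intervalIntegrable_step ht' hs' _ _),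
    hρ.integral_rate_mul_growth ht' hs' hβ, e2,
    intervalIntegral.integral_finsetSum fun i _ => hρ.intervalIntegrable_step ht' hs' _ _,
    Finset.sum_congr rfl fun i hi => hρ.integral_step ht' hs' (hτ i hi).1 (hτ i hi).2 _,
    Finset.sum_sub_distrib, ← Finset.mul_sum, mul_div_cancel₀ _ (growth_pos ρ t).ne']
  have e3 : ∑ i ∈ Finset.Ico (M.N t ω) (M.N s ω), growth ρ (M.arrival i ω) *
      (h (M.arrival i ω) (M.Y i ω) / growth ρ (M.arrival i ω)) = M.jumpSum h t s ω :=
    Finset.sum_congr rfl fun i _ => mul_div_cancel₀ _ (growth_pos ρ _).ne'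
  rw [e3, linearSolution, jumpSum]
  ring

/-- The values taken before `s` are bounded integers, so their supremum is attained, and by
monotonicity the path stays there until `s`. -/
theorem exists_eventually_N_eq_left (ω : Ω) {s : ℝ≥0} (h0 : 0 < s) (hs : s ≤ M.T) :
    ∃ n, ∀ᶠ u in 𝓝[<] s, M.N u ω = n := by
  have hbdd : BddAbove ((fun u => M.N u ω) '' Iio s) := by
    refine ⟨M.N s ω, ?_⟩
    rintro _ ⟨u, hu, rfl⟩
    exact M.poisson.mono ω u s (le_of_lt hu) hs
  obtain ⟨v, hv, hveq⟩ := Nat.sSup_mem (s := (fun u => M.N u ω) '' Iio s) ⟨_, 0, h0, rfl⟩ hbdd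
  refine ⟨M.N v ω, ?_⟩
  filter_upwards [Ioo_mem_nhdsLT (show v < s from hv)] with u hu
  refine le_antisymm ?_ (M.poisson.mono ω v u hu.1.le (hu.2.le.trans hs))
  simp only at hveq
  rw [hveq]
  exact le_csSup hbdd ⟨u, hu.2, rfl⟩

theorem linearSolution_cadlag {K : ℝ} (hρ : IsBoundedRate M.T ρ K)
    (hb : IntervalIntegrable (fun r : ℝ => b r.toNNReal) volume 0 M.T) (ht : t ≤ M.T) (ω : Ω) :
    (∀ s ∈ Ico t M.T, ContinuousWithinAt (fun u => M.linearSolution ρ b h t x u ω) (Ici s) s) ∧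
    (∀ s ∈ Ioc t M.T, ∃ a, Tendsto (fun u => M.linearSolution ρ b h t x u ω) (𝓝[<] s) (𝓝 a)) := by
  have ht' := NNReal.coe_mem_Icc_zero ht
  have hT' := NNReal.coe_mem_Icc_zero (le_refl M.T)
  have hβ := M.intervalIntegrable_drift_div hρ hb ht le_rfl
  have hD : ContinuousOn (fun r => x / growth ρ t + ∫ u in (t : ℝ)..r, b u.toNNReal / growth ρ u)
      (uIcc (t : ℝ) M.T) :=
    continuousOn_const.add
      (hβ.absolutelyContinuousOnInterval_intervalIntegral left_mem_uIcc).continuousOn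
  have hE := hρ.continuousOn_growth ht' hT'
  rw [uIcc_of_le (NNReal.coe_le_coe.2 ht)] at hD hE
  have hcoe : MapsTo ((↑) : ℝ≥0 → ℝ) (Icc t M.T) (Icc (t : ℝ) M.T) := fun u hu =>
    ⟨NNReal.coe_le_coe.2 hu.1, NNReal.coe_le_coe.2 hu.2⟩
  have hE' := hE.comp NNReal.continuous_coe.continuousOn hcoe
  have hD' := hD.comp NNReal.continuous_coe.continuousOn hcoe
  constructor
  · intro s hs
    have hmem : Icc t M.T ∈ 𝓝[≥] s :=
      mem_of_superset (Icc_mem_nhdsGE hs.2) (Icc_subset_Icc_left hs.1)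
    have hsI : s ∈ Icc t M.T := ⟨hs.1, hs.2.le⟩
    have hle : 𝓝[≥] s ≤ 𝓝[Icc t M.T] s := nhdsWithin_le_of_mem hmem
    refine ((hE' s hsI).mono_left hle).mul (((hD' s hsI).mono_left hle).sub ?_)
    refine tendsto_const_nhds.congr' ?_
    filter_upwards [M.eventually_N_eq ω hs.2] with u hu
    simp only [jumpSum, hu]
  · intro s hs
    have hmem : Icc t M.T ∈ 𝓝[<] s :=
      mem_of_superset (Ioo_mem_nhdsLT hs.1) fun u hu => ⟨hu.1.le, hu.2.le.trans hs.2⟩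
    have hsI : s ∈ Icc t M.T := ⟨hs.1.le, hs.2⟩
    have hle : 𝓝[<] s ≤ 𝓝[Icc t M.T] s := nhdsWithin_le_of_mem hmem
    obtain ⟨n, hn⟩ := M.exists_eventually_N_eq_left ω (bot_le.trans_lt hs.1) hs.2
    refine ⟨_, ((hE' s hsI).mono_left hle).mul (((hD' s hsI).mono_left hle).sub
      (?_ : Tendsto _ _ (𝓝 (∑ i ∈ Finset.Ico (M.N t ω) n,
        h (M.arrival i ω) (M.Y i ω) / growth ρ (M.arrival i ω)))))⟩
    refine tendsto_const_nhds.congr' ?_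
    filter_upwards [hn] with u hu
    simp only [jumpSum, hu]

theorem measurable_div_growth (hρ : Measurable ρ) (hh : Measurable (Function.uncurry h)) :
    Measurable (Function.uncurry fun (r : ℝ≥0) y => h r y / growth ρ r) :=
  hh.div ((measurable_growth hρ).comp (measurable_coe_nnreal_real.comp measurable_fst))

theorem isStrongSolution_linearSolution {K : ℝ} (hρ : IsBoundedRate M.T ρ K)
    (hb : IntervalIntegrable (fun r : ℝ => b r.toNNReal) volume 0 M.T)
    (hh : Measurable (Function.uncurry h)) (ht : t ≤ M.T) :
    M.IsStrongSolution ρ (fun s _ => b s) (fun s y _ => h s y) t x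
      (M.linearSolution ρ b h t x) where
  adapted _ hs := (stronglyMeasurable_const.sub (M.stronglyMeasurable_jumpSum
      (measurable_div_growth hρ.measurable hh) hs.1 hs.2)).const_mul _
  cadlag := .of_forall fun ω => M.linearSolution_cadlag hρ hb ht ω
  integrable := .of_forall fun ω => (M.intervalIntegrable_drift hb ht le_rfl).add
    (M.intervalIntegrable_linearSolution hρ hb ht le_rfl ω)
  eq := .of_forall fun ω _ hs => M.linearSolution_integral_eq hρ hb hs.1 hs.2 ω

variable {M}

/-- Drift and claims cancel in the difference of two solutions, which therefore solves the
homogeneous equation pathwise. -/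
theorem IsStrongSolution.unique {K : ℝ} (hρ : IsBoundedRate M.T ρ K) {B : ℝ≥0 → Ω → ℝ}
    {H : ℝ≥0 → ℝ → Ω → ℝ} {X X' : ℝ≥0 → Ω → ℝ} (ht : t ≤ M.T)
    (hX : M.IsStrongSolution ρ B H t x X) (hX' : M.IsStrongSolution ρ B H t x X') :
    ∀ᵐ ω ∂P, ∀ s ∈ Icc t M.T, X' s ω = X s ω := by
  filter_upwards [hX.integrable, hX'.integrable, hX.eq, hX'.eq] with ω i1 i2 e1 e2 s hs
  have ht' := NNReal.coe_mem_Icc_zero ht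
  have hD : IntervalIntegrable (fun r : ℝ => ρ r * (X' r.toNNReal ω - X r.toNNReal ω))
      volume t M.T :=
    (i2.sub i1).congr fun r _ => by ring
  have heq : ∀ r ∈ Icc (t : ℝ) M.T, X' r.toNNReal ω - X r.toNNReal ω =
      ∫ u in (t : ℝ)..r, ρ u * (X' u.toNNReal ω - X u.toNNReal ω) := by
    intro r hr
    have h0 : 0 ≤ r := t.coe_nonneg.trans hr.1
    have hmem : r.toNNReal ∈ Icc t M.T :=
      ⟨(Real.le_toNNReal_iff_coe_le h0).2 hr.1, Real.toNNReal_le_iff_le_coe.2 hr.2⟩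
    have hsub : uIcc (t : ℝ) r ⊆ uIcc (t : ℝ) M.T := by
      rw [uIcc_of_le hr.1, uIcc_of_le ht'.2]; exact Icc_subset_Icc_right hr.2
    have e3 := e1 _ hmem
    have e4 := e2 _ hmem
    rw [Real.coe_toNNReal r h0] at e3 e4
    have e5 : ∫ u in (t : ℝ)..r, ρ u * (X' u.toNNReal ω - X u.toNNReal ω) =
        (∫ u in (t : ℝ)..r, (B u.toNNReal ω + ρ u * X' u.toNNReal ω)) -
        ∫ u in (t : ℝ)..r, (B u.toNNReal ω + ρ u * X u.toNNReal ω) := by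
      rw [← intervalIntegral.integral_sub (i2.mono_set hsub) (i1.mono_set hsub)]
      exact intervalIntegral.integral_congr fun u _ => by ring
    rw [e5, e3, e4]
    ring
  have hs' : (s : ℝ) ∈ Icc (t : ℝ) M.T := ⟨NNReal.coe_le_coe.2 hs.1, NNReal.coe_le_coe.2 hs.2⟩
  have := hρ.eq_zero_of_eq_integral ht' (D := fun r => X' r.toNNReal ω - X r.toNNReal ω)
    hD heq hs'
  simpa [sub_eq_zero] using this

variable (M)

/-- The whole path is dominated by an affine function of the total claim amount on `(0, T]`, which
is square integrable by Campbell's formula. The constant `G` bounds both the growth factor and its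
inverse. -/
theorem lintegral_iSup_linearSolution_lt_top [IsProbabilityMeasure P] {K L : ℝ}
    (hρ : IsBoundedRate M.T ρ K)
    (hb : IntervalIntegrable (fun r : ℝ => b r.toNNReal) volume 0 M.T)
    (hh : M.IsClaimBounded h L) :
    ∫⁻ ω, ⨆ s ∈ Icc (0 : ℝ≥0) M.T, ‖M.linearSolution ρ b h 0 x s ω‖ₑ ^ 2 ∂P < ∞ := by
  have h0' := NNReal.coe_mem_Icc_zero (zero_le (a := M.T))
  have hT' := NNReal.coe_mem_Icc_zero (le_refl M.T)
  have hβ := M.intervalIntegrable_drift_div hρ hb zero_le le_rfl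
  have hD : ContinuousOn (fun r => x / growth ρ (0 : ℝ≥0) +
      ∫ u in ((0 : ℝ≥0) : ℝ)..r, b u.toNNReal / growth ρ u) (uIcc ((0 : ℝ≥0) : ℝ) M.T) :=
    continuousOn_const.add
      (hβ.absolutelyContinuousOnInterval_intervalIntegral left_mem_uIcc).continuousOn
  obtain ⟨C, hC⟩ := isCompact_uIcc.exists_bound_of_continuousOn hD
  rw [uIcc_of_le h0'.2] at hC
  set G := Real.exp (K * M.T) with hG
  have hid : M.IsClaimBounded (fun _ y => y) 1 :=
    ⟨measurable_snd, fun _ _ _ h => h, fun _ _ _ _ => by simp⟩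
  have hS := hid.memLp_jumpSum (t := 0) zero_le
  have hZ : MemLp (fun ω => G * (C + G * L * M.jumpSum (fun _ y => y) 0 M.T ω)) 2 P :=
    ((memLp_const C).add (hS.const_mul (G * L))).const_mul G
  refine lt_of_le_of_lt (lintegral_mono_ae ?_)
    ((hasFiniteIntegral_iff_enorm.1 hZ.integrable_sq.2))
  filter_upwards [M.ae_Y_pos] with ω hω
  refine iSup₂_le fun s hs => ?_
  rw [← enorm_pow]
  have hs' := NNReal.coe_mem_Icc_zero hs.2
  have hEs := hρ.growth_le hs'
  have hpos := growth_pos ρ s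
  have hDs := hC s hs'
  have hJ : |M.jumpSum (fun r y => h r y / growth ρ r) 0 s ω| ≤
      G * L * M.jumpSum (fun _ y => y) 0 M.T ω := by
    rw [jumpSum, jumpSum, Finset.mul_sum]
    refine (Finset.abs_sum_le_sum_abs _ _).trans ?_
    have hterm (i : ℕ) : |h (M.arrival i ω) (M.Y i ω) / growth ρ (M.arrival i ω)| ≤
        G * L * M.Y i ω := by
      have h1 := hh.nonneg _ (M.arrival_le i ω) _ (hω i).le
      have h2 := hh.le _ (M.arrival_le i ω) _ (hω i).le
      have h3 := (hρ.growth_le (NNReal.coe_mem_Icc_zero (M.arrival_le i ω))).2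
      have h4 := inv_pos.2 (growth_pos ρ (M.arrival i ω))
      rw [div_eq_mul_inv, abs_of_nonneg (mul_nonneg h1 h4.le), mul_comm, mul_assoc]
      exact mul_le_mul h3 h2 h1 (Real.exp_pos _).le
    refine (Finset.sum_le_sum fun i _ => hterm i).trans
      (Finset.sum_le_sum_of_subset_of_nonneg (Finset.Ico_subset_Ico_right
        (M.poisson.mono ω _ _ hs.2 le_rfl)) fun i _ _ => (abs_nonneg _).trans (hterm i))
  have key : |M.linearSolution ρ b h 0 x s ω| ≤
      G * (C + G * L * M.jumpSum (fun _ y => y) 0 M.T ω) := by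
    rw [linearSolution, abs_mul, abs_of_pos hpos]
    refine mul_le_mul hEs.1 ((abs_sub _ _).trans (add_le_add hDs hJ)) (abs_nonneg _)
      (Real.exp_pos _).le
  rw [Real.enorm_eq_ofReal (sq_nonneg _), Real.enorm_eq_ofReal (sq_nonneg _)]
  refine ENNReal.ofReal_le_ofReal ?_
  rw [← sq_abs]
  exact pow_le_pow_left₀ (abs_nonneg _) key 2

theorem hasUniqueSolution [IsProbabilityMeasure P] {L : ℝ} (hρ : IsInterestRate M.T ρ)
    (hb : IntervalIntegrable (fun r : ℝ => b r.toNNReal) volume 0 M.T)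
    (hh : M.IsClaimBounded h L) :
    M.HasUniqueSolution ρ (fun s _ => b s) (fun s y _ => h s y) x := by
  obtain ⟨K, hK⟩ := hρ.exists_isBoundedRate
  have hX := M.isStrongSolution_linearSolution (x := x) hK hb hh.measurable zero_le
  exact ⟨_, hX, M.lintegral_iSup_linearSolution_lt_top hK hb hh,
    fun X' hX' => hX.unique hK zero_le hX'⟩

end LinearEquation

end InsuranceMarket

/-! ### Deterministic strategies and their admissibility. -/

theorem condExp_const_sub_ae {Ω : Type*} {m m₀ : MeasurableSpace Ω} {P : Measure Ω}
    [IsFiniteMeasure P] (hm : m ≤ m₀) {S : Ω → ℝ} (hS : Integrable S P) (a : ℝ) :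
    P[fun ω => a - S ω | m] =ᵐ[P] fun ω => a - (P[S | m]) ω := by
  filter_upwards [condExp_sub (m := m) (integrable_const a) hS] with ω h
  rw [condExp_const hm] at h
  exact h

theorem condVar_const_sub_ae {Ω : Type*} {m m₀ : MeasurableSpace Ω} {P : Measure Ω}
    [IsFiniteMeasure P] (hm : m ≤ m₀) {S : Ω → ℝ} (hS : Integrable S P) (a : ℝ) :
    Var[fun ω => a - S ω; P | m] =ᵐ[P] Var[S; P | m] := by
  refine condExp_congr_ae ?_
  filter_upwards [condExp_const_sub_ae hm hS a] with ω h
  simp only [Pi.pow_apply, Pi.sub_apply, h]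
  ring

namespace InsuranceMarket

variable {Ω : Type*} [MeasurableSpace Ω] {P : Measure Ω} (M : InsuranceMarket P)

theorem predictable_le : M.filtration.predictable ≤ (inferInstance : MeasurableSpace (ℝ≥0 × Ω)) :=
  measurableSpace_le_predictable_of_measurableSet
    (fun _ hA => (measurableSet_singleton _).prod (M.filtration.le _ _ hA))
    (fun _ _ hA => measurableSet_Ioi.prod (M.filtration.le _ _ hA))

theorem measurable_fst_predictable :
    Measurable[M.filtration.predictable] (Prod.fst : ℝ≥0 × Ω → ℝ≥0) := by
  refine measurable_of_Ioi (mδ := M.filtration.predictable) fun c => ?_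
  have : (Prod.fst : ℝ≥0 × Ω → ℝ≥0) ⁻¹' Ioi c = Ioi c ×ˢ univ := by ext; simp
  rw [this]
  exact measurableSet_predictable_Ioi_prod
    (@MeasurableSet.univ _ (M.filtration c : MeasurableSpace Ω))

theorem measurable_of_isPredictableField [Nonempty Ω] {l : ℝ≥0 → ℝ → ℝ}
    (hl : M.IsPredictableField fun t y _ => l t y) : Measurable (Function.uncurry l) := by
  obtain ⟨ω⟩ := ‹Nonempty Ω›
  have hl' : Measurable fun p : (ℝ≥0 × Ω) × ℝ => l p.1.1 p.2 :=
    hl.mono (sup_le_sup (MeasurableSpace.comap_mono M.predictable_le) le_rfl) le_rfl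
  exact hl'.comp ((measurable_fst.prodMk measurable_const).prodMk measurable_snd :
    Measurable fun p : ℝ≥0 × ℝ => ((p.1, ω), p.2))

theorem isPredictableField_of_measurable {l : ℝ≥0 → ℝ → ℝ} (hl : Measurable (Function.uncurry l)) :
    M.IsPredictableField fun t y _ => l t y := by
  let m : MeasurableSpace (ℝ≥0 × Ω) := M.filtration.predictable
  exact hl.comp (((M.measurable_fst_predictable).comp
    (@measurable_fst (ℝ≥0 × Ω) ℝ M.filtration.predictable inferInstance)).prodMk
    (@measurable_snd (ℝ≥0 × Ω) ℝ M.filtration.predictable inferInstance))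

theorem measurable_of_isStronglyPredictable [Nonempty Ω] {ξ : ℝ≥0 → ℝ}
    (hξ : IsStronglyPredictable M.filtration fun t (_ : Ω) => ξ t) : Measurable ξ := by
  obtain ⟨ω⟩ := ‹Nonempty Ω›
  have h' : Measurable (Function.uncurry fun t (_ : Ω) => ξ t) :=
    (StronglyMeasurable.measurable hξ).mono M.predictable_le le_rfl
  exact h'.comp (measurable_id.prodMk (measurable_const (a := ω)))

/-- A pair of deterministic treaties that satisfies the treaty constraints up to time `T`. -/
structure IsTreatyPair (l₁ l₂ : ℝ≥0 → ℝ → ℝ) : Prop where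
  measurable₁ : Measurable (Function.uncurry l₁)
  measurable₂ : Measurable (Function.uncurry l₂)
  nonneg₁ : ∀ t ≤ M.T, ∀ y, 0 ≤ y → 0 ≤ l₁ t y
  nonneg₂ : ∀ t ≤ M.T, ∀ y, 0 ≤ y → 0 ≤ l₂ t y
  add_le : ∀ t ≤ M.T, ∀ y, 0 ≤ y → l₁ t y + l₂ t y ≤ y

/-- A pair of deterministic premium loadings, measurable and bounded up to time `T`. -/
structure IsLoadingPair (ξ₁ ξ₂ : ℝ≥0 → ℝ) : Prop where
  measurable₁ : Measurable ξ₁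
  measurable₂ : Measurable ξ₂
  pos₁ : ∀ t ≤ M.T, 0 < ξ₁ t
  pos₂ : ∀ t ≤ M.T, 0 < ξ₂ t
  bdd₁ : ∃ C, ∀ t ≤ M.T, |ξ₁ t| ≤ C
  bdd₂ : ∃ C, ∀ t ≤ M.T, |ξ₂ t| ≤ C

theorem intervalIntegrable_of_bounded {f : ℝ≥0 → ℝ} (hf : Measurable f)
    (hb : ∃ C, ∀ s ≤ M.T, |f s| ≤ C) {s t : ℝ≥0} (hs : s ≤ M.T) (ht : t ≤ M.T) :
    IntervalIntegrable (fun r : ℝ => f r.toNNReal) volume s t := by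
  obtain ⟨C, hC⟩ := hb
  rw [intervalIntegrable_iff]
  refine Measure.integrableOn_of_bounded (M := C) measure_Ioc_lt_top.ne
    (hf.comp measurable_real_toNNReal).aestronglyMeasurable
    ((ae_restrict_mem measurableSet_uIoc).mono fun r hr => ?_)
  have := uIcc_subset_Icc (NNReal.coe_mem_Icc_zero hs) (NNReal.coe_mem_Icc_zero ht)
    (uIoc_subset_uIcc hr)
  exact hC _ (Real.toNNReal_le_iff_le_coe.2 this.2)

theorem aY_pos [IsProbabilityMeasure P] : 0 < M.aY := by
  have := M.isProbabilityMeasure_claimLaw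
  have hpos : ∀ᵐ y ∂M.claimLaw, 0 < y := by
    rw [claimLaw, ae_map_iff (M.Y_measurable 0).aemeasurable measurableSet_Ioi]
    exact M.Y_pos 0
  rw [aY, integral_pos_iff_support_of_nonneg_ae (hpos.mono fun _ h => h.le)
    (M.memLp_claimLaw.integrable one_le_two)]
  have : M.claimLaw (Function.support fun y : ℝ => y) = 1 :=
    (measure_congr (eventuallyEq_univ.2 (hpos.mono fun y h => h.ne'))).trans measure_univ
  rw [this]
  exact one_pos

theorem sigmaSq_pos [IsProbabilityMeasure P] : 0 < M.sigmaSq := by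
  have := M.isProbabilityMeasure_claimLaw
  have hpos : ∀ᵐ y ∂M.claimLaw, 0 < y := by
    rw [claimLaw, ae_map_iff (M.Y_measurable 0).aemeasurable measurableSet_Ioi]
    exact M.Y_pos 0
  rw [sigmaSq, integral_pos_iff_support_of_nonneg_ae (.of_forall fun _ => sq_nonneg _)
    M.memLp_claimLaw.integrable_sq]
  have : M.claimLaw (Function.support fun y : ℝ => y ^ 2) = 1 :=
    (measure_congr (eventuallyEq_univ.2 (hpos.mono fun y h => (pow_pos h 2).ne'))).trans
      measure_univ
  rw [this]
  exact one_pos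

variable {M} in
theorem isLoadingPair [IsProbabilityMeasure P] {ξ₁ ξ₂ : ℝ≥0 → ℝ}
    (hξ₁ : M.IsPremiumStrategy1 fun t _ => ξ₁ t) (hξ₂ : M.IsPremiumStrategy2 fun t _ => ξ₂ t) :
    M.IsLoadingPair ξ₁ ξ₂ := by
  have hne : Nonempty Ω := nonempty_of_isProbabilityMeasure P
  have ω := Classical.arbitrary Ω
  have h1 : ∀ t ≤ M.T, 0 < ξ₁ t := fun t ht =>
    (div_pos (mul_pos M.θ_pos M.aY_pos) M.sigmaSq_pos).trans_le (hξ₁.2 t ht ω).1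
  have h2 : ∀ t ≤ M.T, 0 < ξ₂ t := fun t ht => M.θ_pos.trans_le (hξ₂.2 t ht ω).1
  exact ⟨M.measurable_of_isStronglyPredictable hξ₁.1, M.measurable_of_isStronglyPredictable hξ₂.1,
    h1, h2, ⟨_, fun t ht => by rw [abs_of_pos (h1 t ht)]; exact (hξ₁.2 t ht ω).2⟩,
    ⟨_, fun t ht => by rw [abs_of_pos (h2 t ht)]; exact (hξ₂.2 t ht ω).2⟩⟩

theorem measurable_integral_v [IsProbabilityMeasure P] {l : ℝ≥0 → ℝ → ℝ}
    (hl : Measurable (Function.uncurry l)) : Measurable fun s => ∫ y, l s y ∂M.v := by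
  have := M.isFiniteMeasure_v
  exact (StronglyMeasurable.integral_prod_right' (f := Function.uncurry l)
    hl.stronglyMeasurable).measurable

namespace IsClaimBounded

variable {M} {l : ℝ≥0 → ℝ → ℝ} {K : ℝ}

theorem memLp_v (hl : M.IsClaimBounded l K) {s : ℝ≥0} (hs : s ≤ M.T) : MemLp (l s) 2 M.v := by
  refine (M.memLp_v.const_mul K).of_le
    (hl.measurable.comp measurable_prodMk_left).aestronglyMeasurable ?_
  filter_upwards [M.ae_v_pos] with y hy
  rw [Real.norm_of_nonneg (hl.nonneg s hs y hy.le)]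
  exact (hl.le s hs y hy.le).trans (le_abs_self _)

theorem integrable_v [IsProbabilityMeasure P] (hl : M.IsClaimBounded l K) {s : ℝ≥0}
    (hs : s ≤ M.T) : Integrable (l s) M.v := by
  have := M.isFiniteMeasure_v
  exact (hl.memLp_v hs).integrable one_le_two

theorem bdd_integral [IsProbabilityMeasure P] (hl : M.IsClaimBounded l K) :
    ∃ C, ∀ s ≤ M.T, |∫ y, l s y ∂M.v| ≤ C := by
  have := M.isFiniteMeasure_v
  refine ⟨∫ y, K * y ∂M.v, fun s hs => ?_⟩
  rw [abs_of_nonneg (integral_nonneg_of_ae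
    (M.ae_v_pos.mono fun y hy => hl.nonneg s hs y hy.le))]
  exact integral_mono_ae (hl.integrable_v hs) ((M.memLp_v.integrable one_le_two).const_mul K)
    (M.ae_v_pos.mono fun y hy => hl.le s hs y hy.le)

theorem bdd_integral_sq [IsProbabilityMeasure P] (hl : M.IsClaimBounded l K) :
    ∃ C, ∀ s ≤ M.T, |∫ y, l s y ^ 2 ∂M.v| ≤ C := by
  refine ⟨∫ y, (K * y) ^ 2 ∂M.v, fun s hs => ?_⟩
  rw [abs_of_nonneg (integral_nonneg fun y => sq_nonneg _)]
  exact integral_mono_ae (hl.memLp_v hs).integrable_sq (M.memLp_v.const_mul K).integrable_sq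
    (M.ae_v_pos.mono fun y hy =>
      pow_le_pow_left₀ (hl.nonneg s hs y hy.le) (hl.le s hs y hy.le) 2)

end IsClaimBounded

/-- Functions of time that are measurable and bounded up to time `T`. -/
structure IsBoundedMeasurable (f : ℝ≥0 → ℝ) : Prop where
  measurable : Measurable f
  bdd : ∃ C, ∀ s ≤ M.T, |f s| ≤ C

namespace IsBoundedMeasurable

variable {M} {f g : ℝ≥0 → ℝ}

theorem const (a : ℝ) : M.IsBoundedMeasurable fun _ => a :=
  ⟨measurable_const, |a|, fun _ _ => le_rfl⟩

theorem add (hf : M.IsBoundedMeasurable f) (hg : M.IsBoundedMeasurable g) :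
    M.IsBoundedMeasurable fun s => f s + g s := by
  obtain ⟨C, hC⟩ := hf.bdd
  obtain ⟨D, hD⟩ := hg.bdd
  exact ⟨hf.measurable.add hg.measurable, C + D, fun s hs =>
    (abs_add_le _ _).trans (add_le_add (hC s hs) (hD s hs))⟩

theorem mul (hf : M.IsBoundedMeasurable f) (hg : M.IsBoundedMeasurable g) :
    M.IsBoundedMeasurable fun s => f s * g s := by
  obtain ⟨C, hC⟩ := hf.bdd
  obtain ⟨D, hD⟩ := hg.bdd
  refine ⟨hf.measurable.mul hg.measurable, C * D, fun s hs => ?_⟩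
  rw [abs_mul]
  exact mul_le_mul (hC s hs) (hD s hs) (abs_nonneg _) ((abs_nonneg _).trans (hC s hs))

theorem sub (hf : M.IsBoundedMeasurable f) (hg : M.IsBoundedMeasurable g) :
    M.IsBoundedMeasurable fun s => f s - g s := by
  simpa [sub_eq_add_neg] using hf.add ((const (-1)).mul hg)

theorem intervalIntegrable (hf : M.IsBoundedMeasurable f) {s t : ℝ≥0} (hs : s ≤ M.T)
    (ht : t ≤ M.T) : IntervalIntegrable (fun r : ℝ => f r.toNNReal) volume s t :=
  M.intervalIntegrable_of_bounded hf.measurable hf.bdd hs ht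

end IsBoundedMeasurable

theorem IsClaimBounded.isBoundedMeasurable [IsProbabilityMeasure P] {M : InsuranceMarket P}
    {l : ℝ≥0 → ℝ → ℝ} {K : ℝ} (hl : M.IsClaimBounded l K) :
    M.IsBoundedMeasurable fun s => ∫ y, l s y ∂M.v :=
  ⟨M.measurable_integral_v hl.measurable, hl.bdd_integral⟩

theorem IsClaimBounded.isBoundedMeasurable_sq [IsProbabilityMeasure P] {M : InsuranceMarket P}
    {l : ℝ≥0 → ℝ → ℝ} {K : ℝ} (hl : M.IsClaimBounded l K) :
    M.IsBoundedMeasurable fun s => ∫ y, l s y ^ 2 ∂M.v :=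
  ⟨M.measurable_integral_v (l := fun s y => l s y ^ 2) (hl.measurable.pow_const 2),
    hl.bdd_integral_sq⟩

namespace IsTreatyPair

variable {M} {l₁ l₂ : ℝ≥0 → ℝ → ℝ}

theorem isClaimBounded₁ (h : M.IsTreatyPair l₁ l₂) : M.IsClaimBounded l₁ 1 :=
  ⟨h.measurable₁, h.nonneg₁, fun s hs y hy => by
    linarith [h.add_le s hs y hy, h.nonneg₂ s hs y hy]⟩

theorem isClaimBounded₂ (h : M.IsTreatyPair l₁ l₂) : M.IsClaimBounded l₂ 1 :=
  ⟨h.measurable₂, h.nonneg₂, fun s hs y hy => by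
    linarith [h.add_le s hs y hy, h.nonneg₁ s hs y hy]⟩

theorem isClaimBounded_retained (h : M.IsTreatyPair l₁ l₂) :
    M.IsClaimBounded (fun s y => y - l₁ s y - l₂ s y) 1 :=
  ⟨(measurable_snd.sub h.measurable₁).sub h.measurable₂,
    fun s hs y hy => by linarith [h.add_le s hs y hy],
    fun s hs y hy => by linarith [h.nonneg₁ s hs y hy, h.nonneg₂ s hs y hy]⟩

end IsTreatyPair

/-- The premium rate of reinsurer 1 for deterministic treaties and loadings. -/
noncomputable def premium1 (l₁ : ℝ≥0 → ℝ → ℝ) (ξ₁ : ℝ≥0 → ℝ) (s : ℝ≥0) : ℝ :=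
  (∫ y, l₁ s y ∂M.v) + ξ₁ s * ∫ y, l₁ s y ^ 2 ∂M.v

/-- The premium rate of reinsurer 2 for deterministic treaties and loadings. -/
noncomputable def premium2 (l₂ : ℝ≥0 → ℝ → ℝ) (ξ₂ : ℝ≥0 → ℝ) (s : ℝ≥0) : ℝ :=
  (1 + ξ₂ s) * ∫ y, l₂ s y ∂M.v

theorem IsLoadingPair.isBoundedMeasurable₁ {M : InsuranceMarket P} {ξ₁ ξ₂ : ℝ≥0 → ℝ}
    (hξ : M.IsLoadingPair ξ₁ ξ₂) :
    M.IsBoundedMeasurable ξ₁ := ⟨hξ.measurable₁, hξ.bdd₁⟩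

theorem IsLoadingPair.isBoundedMeasurable₂ {M : InsuranceMarket P} {ξ₁ ξ₂ : ℝ≥0 → ℝ}
    (hξ : M.IsLoadingPair ξ₁ ξ₂) :
    M.IsBoundedMeasurable ξ₂ := ⟨hξ.measurable₂, hξ.bdd₂⟩

section Admissible

variable [IsProbabilityMeasure P] {l₁ l₂ : ℝ≥0 → ℝ → ℝ} {ξ₁ ξ₂ : ℝ≥0 → ℝ}

variable {M} in
theorem IsTreatyPair.isBoundedMeasurable_premium1 (hl : M.IsTreatyPair l₁ l₂)
    (hξ : M.IsLoadingPair ξ₁ ξ₂) : M.IsBoundedMeasurable (M.premium1 l₁ ξ₁) :=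
  hl.isClaimBounded₁.isBoundedMeasurable.add
    (hξ.isBoundedMeasurable₁.mul hl.isClaimBounded₁.isBoundedMeasurable_sq)

variable {M} in
theorem IsTreatyPair.isBoundedMeasurable_premium2 (hl : M.IsTreatyPair l₁ l₂)
    (hξ : M.IsLoadingPair ξ₁ ξ₂) : M.IsBoundedMeasurable (M.premium2 l₂ ξ₂) :=
  ((IsBoundedMeasurable.const 1).add hξ.isBoundedMeasurable₂).mul
    hl.isClaimBounded₂.isBoundedMeasurable

variable {M} in
theorem IsTreatyPair.isBoundedMeasurable_drift (hl : M.IsTreatyPair l₁ l₂)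
    (hξ : M.IsLoadingPair ξ₁ ξ₂) :
    M.IsBoundedMeasurable fun s => M.c - M.premium1 l₁ ξ₁ s - M.premium2 l₂ ξ₂ s :=
  ((IsBoundedMeasurable.const M.c).sub (hl.isBoundedMeasurable_premium1 hξ)).sub
    (hl.isBoundedMeasurable_premium2 hξ)

variable {M} in
-- For deterministic strategies the conditions on the surplus processes are automatic: the drifts
-- are bounded and measurable, and the payments are dominated by the claim size.
theorem IsTreatyPair.isAdmissible (hl : M.IsTreatyPair l₁ l₂)
    (hξ₁ : M.IsPremiumStrategy1 fun t _ => ξ₁ t) (hξ₂ : M.IsPremiumStrategy2 fun t _ => ξ₂ t) :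
    M.IsAdmissible (fun t y _ => l₁ t y) (fun t y _ => l₂ t y) (fun t _ => ξ₁ t)
      (fun t _ => ξ₂ t) where
  predictable₁ := M.isPredictableField_of_measurable hl.measurable₁
  predictable₂ := M.isPredictableField_of_measurable hl.measurable₂
  nonneg₁ t ht y hy _ := hl.nonneg₁ t ht y hy
  nonneg₂ t ht y hy _ := hl.nonneg₂ t ht y hy
  add_le t ht y hy _ := hl.add_le t ht y hy
  premium₁ := hξ₁
  premium₂ := hξ₂
  surplusI := M.hasUniqueSolution (b := fun s => M.c - M.premium1 l₁ ξ₁ s - M.premium2 l₂ ξ₂ s)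
    M.ρI_rate
    ((hl.isBoundedMeasurable_drift (isLoadingPair hξ₁ hξ₂)).intervalIntegrable zero_le le_rfl)
    hl.isClaimBounded_retained
  surplusR1 := M.hasUniqueSolution M.ρR1_rate
    ((hl.isBoundedMeasurable_premium1 (isLoadingPair hξ₁ hξ₂)).intervalIntegrable zero_le le_rfl)
    hl.isClaimBounded₁
  surplusR2 := M.hasUniqueSolution M.ρR2_rate
    ((hl.isBoundedMeasurable_premium2 (isLoadingPair hξ₁ hξ₂)).intervalIntegrable zero_le le_rfl)
    hl.isClaimBounded₂

variable {M} in
theorem IsAdmissible.isTreatyPair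
    (h : M.IsAdmissible (fun t y _ => l₁ t y) (fun t y _ => l₂ t y) (fun t _ => ξ₁ t)
      (fun t _ => ξ₂ t)) : M.IsTreatyPair l₁ l₂ := by
  have hne : Nonempty Ω := nonempty_of_isProbabilityMeasure P
  have ω := Classical.arbitrary Ω
  exact ⟨M.measurable_of_isPredictableField h.predictable₁,
    M.measurable_of_isPredictableField h.predictable₂, fun t ht y hy => h.nonneg₁ t ht y hy ω,
    fun t ht y hy => h.nonneg₂ t ht y hy ω, fun t ht y hy => h.add_le t ht y hy ω⟩

end Admissible

end InsuranceMarket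

/-! ### The insurer's objective as an integral of a running reward. -/

namespace InsuranceMarket

variable {Ω : Type*} [MeasurableSpace Ω] {P : Measure Ω} (M : InsuranceMarket P)

/-- The factor by which the insurer's assets grow from time `s` to time `T`. -/
noncomputable def accum (s : ℝ≥0) : ℝ := Real.exp (∫ r in (s : ℝ)..M.T, M.ρI r)

theorem accum_pos (s : ℝ≥0) : 0 < M.accum s := Real.exp_pos _

theorem gammaExp_eq (s : ℝ≥0) : M.gammaExp s = M.γ * M.accum s := rfl

theorem gammaExp_pos (s : ℝ≥0) : 0 < M.gammaExp s := mul_pos M.γ_pos (M.accum_pos s)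

theorem measurable_accum : Measurable M.accum :=
  Real.measurable_exp.comp ((measurable_intervalIntegral_prod M.ρI_rate.measurable).comp
    (measurable_coe_nnreal_real.prodMk measurable_const))

theorem accum_eq_div {s : ℝ≥0} (hs : s ≤ M.T) :
    M.accum s = growth M.ρI M.T / growth M.ρI s := by
  obtain ⟨K, hK⟩ := M.ρI_rate.exists_isBoundedRate
  rw [hK.growth_eq_mul (NNReal.coe_mem_Icc_zero hs) (NNReal.coe_mem_Icc_zero le_rfl),
    mul_div_cancel_left₀ _ (growth_pos _ _).ne']
  rfl

theorem exists_accum_le : ∃ C, ∀ s ≤ M.T, M.accum s ≤ C := by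
  obtain ⟨K, hK⟩ := M.ρI_rate.exists_isBoundedRate
  refine ⟨Real.exp (K * M.T) * Real.exp (K * M.T), fun s hs => ?_⟩
  rw [M.accum_eq_div hs, div_eq_mul_inv]
  exact mul_le_mul (hK.growth_le (NNReal.coe_mem_Icc_zero le_rfl)).1
    (hK.growth_le (NNReal.coe_mem_Icc_zero hs)).2 (inv_pos.2 (growth_pos _ _)).le
    (Real.exp_pos _).le

theorem isBoundedMeasurable_accum : M.IsBoundedMeasurable M.accum := by
  obtain ⟨C, hC⟩ := M.exists_accum_le
  exact ⟨M.measurable_accum, C, fun s hs => by rw [abs_of_pos (M.accum_pos s)]; exact hC s hs⟩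

theorem isBoundedMeasurable_gammaExp : M.IsBoundedMeasurable M.gammaExp :=
  (IsBoundedMeasurable.const M.γ).mul M.isBoundedMeasurable_accum

/-- The running cost of the insurer, at time `s`, of the treaties `f₁` and `f₂`. -/
noncomputable def cost (ξ₁ ξ₂ : ℝ≥0 → ℝ) (s : ℝ≥0) (f₁ f₂ : ℝ → ℝ) : ℝ :=
  ξ₁ s * (∫ y, f₁ y ^ 2 ∂M.v) + ξ₂ s * (∫ y, f₂ y ∂M.v)
    + M.gammaExp s / 2 * ∫ y, (y - f₁ y - f₂ y) ^ 2 ∂M.v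

/-- The rate at which the treaties `f₁` and `f₂` contribute to the insurer's objective. -/
noncomputable def reward (ξ₁ ξ₂ : ℝ≥0 → ℝ) (s : ℝ≥0) (f₁ f₂ : ℝ → ℝ) : ℝ :=
  M.accum s * (M.c - (∫ y, y ∂M.v) - M.cost ξ₁ ξ₂ s f₁ f₂)

variable {l₁ l₂ : ℝ≥0 → ℝ → ℝ} {ξ₁ ξ₂ : ℝ≥0 → ℝ}

variable {M} in
theorem IsTreatyPair.isBoundedMeasurable_reward [IsProbabilityMeasure P]
    (hl : M.IsTreatyPair l₁ l₂) (hξ : M.IsLoadingPair ξ₁ ξ₂) :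
    M.IsBoundedMeasurable fun s => M.reward ξ₁ ξ₂ s (l₁ s) (l₂ s) := by
  refine M.isBoundedMeasurable_accum.mul ((IsBoundedMeasurable.const _).sub
    (((hξ.isBoundedMeasurable₁.mul hl.isClaimBounded₁.isBoundedMeasurable_sq).add
    (hξ.isBoundedMeasurable₂.mul hl.isClaimBounded₂.isBoundedMeasurable)).add
    (IsBoundedMeasurable.mul ?_ hl.isClaimBounded_retained.isBoundedMeasurable_sq)))
  simpa [div_eq_mul_inv] using M.isBoundedMeasurable_gammaExp.mul (IsBoundedMeasurable.const 2⁻¹)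

variable {M} in
-- The pure premiums `∫ l_j dv` cancel against the expected claims ceded, so that only the loadings
-- and the variance penalty remain in `cost`.
theorem IsTreatyPair.reward_eq [IsProbabilityMeasure P] (hl : M.IsTreatyPair l₁ l₂)
    {s : ℝ≥0} (hs : s ≤ M.T) :
    M.reward ξ₁ ξ₂ s (l₁ s) (l₂ s) =
      M.accum s * (M.c - M.premium1 l₁ ξ₁ s - M.premium2 l₂ ξ₂ s) -
      M.accum s * (∫ y, (y - l₁ s y - l₂ s y) ∂M.v) -
      M.γ / 2 * (M.accum s ^ 2 * ∫ y, (y - l₁ s y - l₂ s y) ^ 2 ∂M.v) := by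
  have := M.isFiniteMeasure_v
  have i0 := M.memLp_v.integrable one_le_two
  have i1 := hl.isClaimBounded₁.integrable_v hs
  have i2 := hl.isClaimBounded₂.integrable_v hs
  have e : ∫ y, (y - l₁ s y - l₂ s y) ∂M.v =
      (∫ y, y ∂M.v) - (∫ y, l₁ s y ∂M.v) - ∫ y, l₂ s y ∂M.v := by
    rw [integral_sub (f := fun y => y - l₁ s y) (i0.sub i1) i2, integral_sub i0 i1]
  rw [e, reward, cost, premium1, premium2, gammaExp_eq]
  ring

variable {M} in
/-- The insurer's objective for deterministic treaties and loadings. -/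
theorem IsTreatyPair.insurerObjective_ae_eq [IsProbabilityMeasure P] (hl : M.IsTreatyPair l₁ l₂)
    (hξ : M.IsLoadingPair ξ₁ ξ₂) {t : ℝ≥0} (ht : t ≤ M.T) (x : ℝ) :
    M.insurerObjective (fun t y _ => l₁ t y) (fun t y _ => l₂ t y) (fun t _ => ξ₁ t)
      (fun t _ => ξ₂ t) t x =ᵐ[P] fun _ => x * M.accum t +
        ∫ r in (t : ℝ)..M.T, M.reward ξ₁ ξ₂ r.toNNReal (l₁ r.toNNReal) (l₂ r.toNNReal) := by
  obtain ⟨K, hK⟩ := M.ρI_rate.exists_isBoundedRate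
  obtain ⟨C, hC⟩ := M.exists_accum_le
  have htT : (t : ℝ) ≤ M.T := NNReal.coe_le_coe.2 ht
  set b : ℝ≥0 → ℝ := fun s => M.c - M.premium1 l₁ ξ₁ s - M.premium2 l₂ ξ₂ s with hb_def
  set h : ℝ≥0 → ℝ → ℝ := fun s y => y - l₁ s y - l₂ s y with hh_def
  have hbm : M.IsBoundedMeasurable b := hl.isBoundedMeasurable_drift hξ
  have hb := hbm.intervalIntegrable zero_le (le_refl M.T)
  have hh : M.IsClaimBounded h 1 := hl.isClaimBounded_retained
  have hlin : M.IsInsurerSurplus (fun t y _ => l₁ t y) (fun t y _ => l₂ t y) (fun t _ => ξ₁ t)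
      (fun t _ => ξ₂ t) t x (M.linearSolution M.ρI b h t x) :=
    M.isStrongSolution_linearSolution hK hb hh.measurable ht
  -- The surplus in the objective is an arbitrary choice. The explicit solution shows that there is
  -- something to choose, and uniqueness then identifies the choice almost surely.
  have hX : M.IsInsurerSurplus (fun t y _ => l₁ t y) (fun t y _ => l₂ t y) (fun t _ => ξ₁ t)
      (fun t _ => ξ₂ t) t x (M.insurerSurplus (fun t y _ => l₁ t y) (fun t y _ => l₂ t y)
      (fun t _ => ξ₁ t) (fun t _ => ξ₂ t) t x) := Classical.epsilon_spec ⟨_, hlin⟩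
  -- The value at time `T` of a retained claim paid at time `s`.
  set g : ℝ≥0 → ℝ → ℝ := fun s y => M.accum s * h s y with hg_def
  have hg : M.IsClaimBounded g C := by
    refine ⟨(M.measurable_accum.comp measurable_fst).mul hh.measurable, fun s hs y hy =>
      mul_nonneg (M.accum_pos s).le (hh.nonneg s hs y hy), fun s hs y hy => ?_⟩
    have := hh.le s hs y hy
    rw [one_mul] at this
    exact mul_le_mul (hC s hs) this (hh.nonneg s hs y hy) ((M.accum_pos s).le.trans (hC s hs))
  set a := x * M.accum t + ∫ r in (t : ℝ)..M.T, M.accum r.toNNReal * b r.toNNReal with ha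
  have hXT : M.insurerSurplus (fun t y _ => l₁ t y) (fun t y _ => l₂ t y)
      (fun t _ => ξ₁ t) (fun t _ => ξ₂ t) t x M.T =ᵐ[P] fun ω => a - M.jumpSum g t M.T ω := by
    filter_upwards [hlin.unique hK ht hX] with ω hω
    rw [hω M.T ⟨ht, le_rfl⟩, linearSolution, mul_sub, mul_add, ha]
    congr 1
    · congr 1
      · rw [M.accum_eq_div ht]; ring
      · rw [← intervalIntegral.integral_const_mul]
        refine intervalIntegral.integral_congr fun r hr => ?_
        rw [uIcc_of_le htT] at hr
        have h0 : 0 ≤ r := t.coe_nonneg.trans hr.1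
        rw [M.accum_eq_div (Real.toNNReal_le_iff_le_coe.2 hr.2), Real.coe_toNNReal r h0]
        ring
    · rw [jumpSum, jumpSum, Finset.mul_sum]
      refine Finset.sum_congr rfl fun i _ => ?_
      rw [hg_def]
      simp only
      rw [M.accum_eq_div (M.arrival_le i ω)]
      ring
  have hS := (hg.memLp_jumpSum ht).integrable one_le_two
  have hle := M.filtration.le t
  have e1 : ∫ p, g p.1.toNNReal p.2 ∂M.intensity t =
      ∫ r in (t : ℝ)..M.T, M.accum r.toNNReal * ∫ y, h r.toNNReal y ∂M.v := by
    rw [IsClaimBounded.integral_intensity ht (hg.integrable_intensity t)]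
    refine intervalIntegral.integral_congr fun r _ => ?_
    simp only [hg_def]
    exact integral_const_mul _ _
  have e2 : ∫ p, g p.1.toNNReal p.2 ^ 2 ∂M.intensity t =
      ∫ r in (t : ℝ)..M.T, M.accum r.toNNReal ^ 2 * ∫ y, h r.toNNReal y ^ 2 ∂M.v := by
    rw [IsClaimBounded.integral_intensity ht (hg.memLp_intensity t).integrable_sq]
    refine intervalIntegral.integral_congr fun r _ => ?_
    simp only [hg_def, mul_pow]
    exact integral_const_mul _ _
  have i1 := (M.isBoundedMeasurable_accum.mul hbm).intervalIntegrable ht le_rfl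
  have i2 := (M.isBoundedMeasurable_accum.mul hh.isBoundedMeasurable).intervalIntegrable ht le_rfl
  have i3 := ((M.isBoundedMeasurable_accum.mul M.isBoundedMeasurable_accum).mul
    hh.isBoundedMeasurable_sq).intervalIntegrable ht le_rfl
  simp only [← sq] at i3
  have e3 : ∫ r in (t : ℝ)..M.T, M.reward ξ₁ ξ₂ r.toNNReal (l₁ r.toNNReal) (l₂ r.toNNReal) =
      (∫ r in (t : ℝ)..M.T, M.accum r.toNNReal * b r.toNNReal) -
      (∫ r in (t : ℝ)..M.T, M.accum r.toNNReal * ∫ y, h r.toNNReal y ∂M.v) -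
      M.γ / 2 * ∫ r in (t : ℝ)..M.T, M.accum r.toNNReal ^ 2 * ∫ y, h r.toNNReal y ^ 2 ∂M.v := by
    rw [← intervalIntegral.integral_const_mul, ← intervalIntegral.integral_sub i1 i2,
      ← intervalIntegral.integral_sub (i1.sub i2) (i3.const_mul _)]
    refine intervalIntegral.integral_congr fun r hr => ?_
    rw [uIcc_of_le htT] at hr
    exact hl.reward_eq (Real.toNNReal_le_iff_le_coe.2 hr.2)
  filter_upwards [condExp_congr_ae (m := M.filtration t) hXT,
    condVar_congr_ae (m := M.filtration t) hXT, condExp_const_sub_ae hle hS a,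
    condVar_const_sub_ae hle hS a, hg.condExp_jumpSum ht, hg.condVar_jumpSum ht]
    with ω h1 h2 h3 h4 h5 h6
  rw [insurerObjective, h1, h2, h3, h4, h5, h6, e1, e2, e3, ha]
  ring

end InsuranceMarket

/-! ### Pointwise minimisation of the cost. -/

/-- A quadratic lower bound for the cost density around a point that satisfies the first order
optimality conditions. -/
theorem cost_density_le {a b g y u₁ u₂ l₁ l₂ : ℝ}
    (h₁ : 2 * a * u₁ = g * (y - u₁ - u₂)) (h₂ : 0 ≤ (b - g * (y - u₁ - u₂)) * (l₂ - u₂)) :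
    (a * u₁ ^ 2 + b * u₂ + g / 2 * (y - u₁ - u₂) ^ 2) +
        (a * (l₁ - u₁) ^ 2 + g / 2 * (l₁ + l₂ - u₁ - u₂) ^ 2) ≤
      a * l₁ ^ 2 + b * l₂ + g / 2 * (y - l₁ - l₂) ^ 2 := by
  -- The density is quadratic, so its second order Taylor expansion at `(u₁, u₂)` is exact. What
  -- remains is the gradient term, whose first part vanishes by `h₁` and whose second part is
  -- nonnegative by `h₂`.
  have h : (a * l₁ ^ 2 + b * l₂ + g / 2 * (y - l₁ - l₂) ^ 2) -
      ((a * u₁ ^ 2 + b * u₂ + g / 2 * (y - u₁ - u₂) ^ 2) +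
        (a * (l₁ - u₁) ^ 2 + g / 2 * (l₁ + l₂ - u₁ - u₂) ^ 2)) =
      (2 * a * u₁ - g * (y - u₁ - u₂)) * (l₁ - u₁) + (b - g * (y - u₁ - u₂)) * (l₂ - u₂) := by
    ring
  rw [h₁, sub_self, zero_mul, zero_add] at h
  linarith

namespace InsuranceMarket

variable {Ω : Type*} [MeasurableSpace Ω] {P : Measure Ω} (M : InsuranceMarket P)
  {ξ₁ ξ₂ : ℝ≥0 → ℝ}

theorem measurable_d (h₁ : Measurable ξ₁) (h₂ : Measurable ξ₂) : Measurable (M.d ξ₁ ξ₂) :=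
  (h₂.div M.isBoundedMeasurable_gammaExp.measurable).add (h₂.div (h₁.const_mul 2))

theorem measurable_optTreaty1 (h₁ : Measurable ξ₁) (h₂ : Measurable ξ₂) :
    Measurable (Function.uncurry (M.optTreaty1 ξ₁ ξ₂)) := by
  have hg := M.isBoundedMeasurable_gammaExp.measurable
  refine Measurable.ite (measurableSet_le measurable_snd
    ((M.measurable_d h₁ h₂).comp measurable_fst)) ?_ ?_
  · exact ((hg.div ((h₁.const_mul 2).add hg)).comp measurable_fst).mul measurable_snd
  · exact (h₂.div (h₁.const_mul 2)).comp measurable_fst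

theorem measurable_optTreaty2 (h₁ : Measurable ξ₁) (h₂ : Measurable ξ₂) :
    Measurable (Function.uncurry (M.optTreaty2 ξ₁ ξ₂)) := by
  have hd : Measurable fun p : ℝ≥0 × ℝ => M.d ξ₁ ξ₂ p.1 :=
    (M.measurable_d h₁ h₂).comp measurable_fst
  exact Measurable.ite (measurableSet_le measurable_snd hd) measurable_const
    (measurable_snd.sub hd)

theorem isTreatyPair_optTreaty (hξ : M.IsLoadingPair ξ₁ ξ₂) :
    M.IsTreatyPair (M.optTreaty1 ξ₁ ξ₂) (M.optTreaty2 ξ₁ ξ₂) := by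
  have key (t : ℝ≥0) (ht : t ≤ M.T) : 0 < M.q ξ₁ t ∧ M.q ξ₁ t ≤ 1 ∧
      0 < ξ₂ t / (2 * ξ₁ t) ∧ 0 < ξ₂ t / M.gammaExp t := by
    have h1 := hξ.pos₁ t ht
    have h2 := hξ.pos₂ t ht
    have h3 := M.gammaExp_pos t
    refine ⟨by unfold q; positivity, ?_, by positivity, by positivity⟩
    rw [q, div_le_one (by positivity)]
    linarith
  refine ⟨M.measurable_optTreaty1 hξ.measurable₁ hξ.measurable₂,
    M.measurable_optTreaty2 hξ.measurable₁ hξ.measurable₂, fun t ht y hy => ?_,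
    fun t ht y hy => ?_, fun t ht y hy => ?_⟩ <;> obtain ⟨h1, h2, h3, h4⟩ := key t ht
  · unfold optTreaty1
    split_ifs
    exacts [mul_nonneg h1.le hy, h3.le]
  · unfold optTreaty2
    split_ifs with h
    exacts [le_rfl, sub_nonneg.2 (not_le.1 h).le]
  · unfold optTreaty1 optTreaty2
    split_ifs with h
    · rw [add_zero]
      exact mul_le_of_le_one_left hy h2
    -- Above the deductible the ceded total is `y - ξ₂ / gammaExp`.
    · rw [d]
      linarith

/-- The optimal treaties satisfy the first order optimality conditions. -/
theorem optTreaty_first_order {t : ℝ≥0} (h₁ : 0 < ξ₁ t) {y l₂ : ℝ} (hl₂ : 0 ≤ l₂) :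
    2 * ξ₁ t * M.optTreaty1 ξ₁ ξ₂ t y =
        M.gammaExp t * (y - M.optTreaty1 ξ₁ ξ₂ t y - M.optTreaty2 ξ₁ ξ₂ t y) ∧
      0 ≤ (ξ₂ t - M.gammaExp t * (y - M.optTreaty1 ξ₁ ξ₂ t y - M.optTreaty2 ξ₁ ξ₂ t y)) *
        (l₂ - M.optTreaty2 ξ₁ ξ₂ t y) := by
  have hg := M.gammaExp_pos t
  have hs : 0 < 2 * ξ₁ t + M.gammaExp t := by positivity
  unfold optTreaty1 optTreaty2
  split_ifs with h
  · have e : M.gammaExp t * (y - M.q ξ₁ t * y - 0) = 2 * ξ₁ t * (M.q ξ₁ t * y) := by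
      rw [q]; field_simp; ring
    refine ⟨e.symm, mul_nonneg ?_ (by simpa using hl₂)⟩
    rw [e, sub_nonneg]
    -- The deductible is the claim size at which the marginal cost of retention, equal to that of
    -- ceding to reinsurer 1, reaches the loading `ξ₂`. Below it the second treaty is not worth its
    -- price.
    have e2 : 2 * ξ₁ t * (M.q ξ₁ t * M.d ξ₁ ξ₂ t) = ξ₂ t := by
      rw [q, d]; field_simp
    rw [← e2]
    have hq : 0 ≤ M.q ξ₁ t := by unfold q; positivity
    gcongr
  -- Above the deductible the marginal cost of retention stays at `ξ₂`, so the condition for the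
  -- second treaty holds with equality.
  · have e : M.gammaExp t * (y - ξ₂ t / (2 * ξ₁ t) - (y - M.d ξ₁ ξ₂ t)) = ξ₂ t := by
      rw [d]; field_simp; ring
    rw [e, sub_self, zero_mul]
    exact ⟨by field_simp, le_rfl⟩

section Cost

variable {l₁ l₂ : ℝ≥0 → ℝ → ℝ}

variable {M} in
theorem IsTreatyPair.ae_cost_density_le (hl : M.IsTreatyPair l₁ l₂) (hξ : M.IsLoadingPair ξ₁ ξ₂)
    {s : ℝ≥0} (hs : s ≤ M.T) : ∀ᵐ y ∂M.v,
    (ξ₁ s * M.optTreaty1 ξ₁ ξ₂ s y ^ 2 + ξ₂ s * M.optTreaty2 ξ₁ ξ₂ s y +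
      M.gammaExp s / 2 * (y - M.optTreaty1 ξ₁ ξ₂ s y - M.optTreaty2 ξ₁ ξ₂ s y) ^ 2) +
      (ξ₁ s * (l₁ s y - M.optTreaty1 ξ₁ ξ₂ s y) ^ 2 + M.gammaExp s / 2 *
        (l₁ s y + l₂ s y - M.optTreaty1 ξ₁ ξ₂ s y - M.optTreaty2 ξ₁ ξ₂ s y) ^ 2) ≤
    ξ₁ s * l₁ s y ^ 2 + ξ₂ s * l₂ s y + M.gammaExp s / 2 * (y - l₁ s y - l₂ s y) ^ 2 := by
  filter_upwards [M.ae_v_pos] with y hy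
  have := M.optTreaty_first_order (ξ₂ := ξ₂) (hξ.pos₁ s hs) (y := y) (hl.nonneg₂ s hs y hy.le)
  exact cost_density_le this.1 this.2

variable [IsProbabilityMeasure P]

variable {M} in
theorem IsTreatyPair.cost_eq_integral (hl : M.IsTreatyPair l₁ l₂) {s : ℝ≥0} (hs : s ≤ M.T)
    (r : ℝ≥0) :
    Integrable (fun y => ξ₁ r * l₁ s y ^ 2 + ξ₂ r * l₂ s y +
      M.gammaExp r / 2 * (y - l₁ s y - l₂ s y) ^ 2) M.v ∧
    M.cost ξ₁ ξ₂ r (l₁ s) (l₂ s) = ∫ y, (ξ₁ r * l₁ s y ^ 2 + ξ₂ r * l₂ s y +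
      M.gammaExp r / 2 * (y - l₁ s y - l₂ s y) ^ 2) ∂M.v := by
  have i1 := (hl.isClaimBounded₁.memLp_v hs).integrable_sq.const_mul (ξ₁ r)
  have i2 := (hl.isClaimBounded₂.integrable_v hs).const_mul (ξ₂ r)
  have i3 := (hl.isClaimBounded_retained.memLp_v hs).integrable_sq.const_mul (M.gammaExp r / 2)
  refine ⟨(i1.add i2).add i3, ?_⟩
  rw [integral_add (f := fun y => ξ₁ r * l₁ s y ^ 2 + ξ₂ r * l₂ s y) (i1.add i2) i3, integral_add i1 i2, integral_const_mul, integral_const_mul,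
    integral_const_mul, cost]

variable {M} in
theorem IsTreatyPair.cost_optTreaty_le (hl : M.IsTreatyPair l₁ l₂) (hξ : M.IsLoadingPair ξ₁ ξ₂)
    {s : ℝ≥0} (hs : s ≤ M.T) :
    M.cost ξ₁ ξ₂ s (M.optTreaty1 ξ₁ ξ₂ s) (M.optTreaty2 ξ₁ ξ₂ s) ≤
      M.cost ξ₁ ξ₂ s (l₁ s) (l₂ s) := by
  obtain ⟨i1, e1⟩ := hl.cost_eq_integral (ξ₁ := ξ₁) (ξ₂ := ξ₂) hs s
  obtain ⟨i2, e2⟩ := (M.isTreatyPair_optTreaty hξ).cost_eq_integral (ξ₁ := ξ₁) (ξ₂ := ξ₂) hs s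
  rw [e1, e2]
  refine integral_mono_ae i2 i1 ((hl.ae_cost_density_le hξ hs).mono fun y hy =>
    (le_add_of_nonneg_right ?_).trans hy)
  have h1 := (hξ.pos₁ s hs).le
  have h2 := (M.gammaExp_pos s).le
  positivity

variable {M} in
-- Ordered densities with equal integrals agree almost everywhere, so both squares in the gap of
-- `cost_density_le` vanish. The first gives `l₁`, and the second then gives `l₂`. Null sets of `v`
-- are null sets of the claim law because `lam` is nonzero.
theorem IsTreatyPair.ae_eq_optTreaty (hl : M.IsTreatyPair l₁ l₂) (hξ : M.IsLoadingPair ξ₁ ξ₂)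
    {s : ℝ≥0} (hs : s ≤ M.T) (hcost : M.cost ξ₁ ξ₂ s (l₁ s) (l₂ s) ≤
      M.cost ξ₁ ξ₂ s (M.optTreaty1 ξ₁ ξ₂ s) (M.optTreaty2 ξ₁ ξ₂ s)) :
    ∀ᵐ y ∂M.claimLaw, l₁ s y = M.optTreaty1 ξ₁ ξ₂ s y ∧ l₂ s y = M.optTreaty2 ξ₁ ξ₂ s y := by
  obtain ⟨i1, e1⟩ := hl.cost_eq_integral (ξ₁ := ξ₁) (ξ₂ := ξ₂) hs s
  obtain ⟨i2, e2⟩ := (M.isTreatyPair_optTreaty hξ).cost_eq_integral (ξ₁ := ξ₁) (ξ₂ := ξ₂) hs s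
  have h1 := hξ.pos₁ s hs
  have h2 := M.gammaExp_pos s
  have hle := hl.ae_cost_density_le hξ hs
  have hnn := hle.mono fun y hy => (le_add_of_nonneg_right (by positivity)).trans hy
  have heq := (integral_eq_iff_of_ae_le i2 i1 hnn).1
    (le_antisymm (integral_mono_ae i2 i1 hnn) (by rw [← e1, ← e2]; exact hcost))
  have hv : ∀ᵐ y ∂M.v, l₁ s y = M.optTreaty1 ξ₁ ξ₂ s y ∧ l₂ s y = M.optTreaty2 ξ₁ ξ₂ s y := by
    filter_upwards [hle, heq] with y hy hy'
    rw [← hy', add_le_iff_nonpos_right] at hy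
    have p1 : 0 ≤ ξ₁ s * (l₁ s y - M.optTreaty1 ξ₁ ξ₂ s y) ^ 2 := by positivity
    have p2 : 0 ≤ M.gammaExp s / 2 *
        (l₁ s y + l₂ s y - M.optTreaty1 ξ₁ ξ₂ s y - M.optTreaty2 ξ₁ ξ₂ s y) ^ 2 := by positivity
    have q1 := (mul_eq_zero.1 (le_antisymm (by linarith) p1)).resolve_left h1.ne'
    have q2 := (mul_eq_zero.1 (le_antisymm (by linarith) p2)).resolve_left (by positivity)
    have r1 := pow_eq_zero_iff two_ne_zero |>.1 q1
    have r2 := pow_eq_zero_iff two_ne_zero |>.1 q2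
    exact ⟨by linarith, by linarith⟩
  rw [ae_iff] at hv ⊢
  rw [v, Measure.smul_apply, ENNReal.smul_def, smul_eq_mul, mul_eq_zero] at hv
  exact hv.resolve_left (ENNReal.coe_ne_zero.2 M.lam_pos.ne')

end Cost

/-! ### Deviations, the equilibrium property and uniqueness. -/

open Classical in
/-- The deterministic treaty that is `f` during `[t, t + ε)` and `l` at all other times. -/
noncomputable def deviation (l : ℝ≥0 → ℝ → ℝ) (t ε : ℝ≥0) (f : ℝ → ℝ) : ℝ≥0 → ℝ → ℝ :=
  fun s y => if s ∈ Ico t (t + ε) then f y else l s y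

theorem deviation_of_mem (l : ℝ≥0 → ℝ → ℝ) {t ε s : ℝ≥0} (f : ℝ → ℝ) (hs : s ∈ Ico t (t + ε)) :
    deviation l t ε f s = f := by
  funext y; simp [deviation, hs.1, hs.2]

theorem deviation_of_notMem (l : ℝ≥0 → ℝ → ℝ) {t ε s : ℝ≥0} (f : ℝ → ℝ)
    (hs : s ∉ Ico t (t + ε)) : deviation l t ε f s = l s := by
  funext y; exact if_neg hs

theorem measurable_deviation {l : ℝ≥0 → ℝ → ℝ} (hl : Measurable (Function.uncurry l)) (t ε : ℝ≥0)
    {f : ℝ → ℝ} (hf : Measurable f) : Measurable (Function.uncurry (deviation l t ε f)) :=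
  Measurable.ite (measurable_fst measurableSet_Ico) (hf.comp measurable_snd) hl

variable {M} in
theorem IsTreatyPair.isTreatyPair_deviation {l₁ l₂ k₁ k₂ : ℝ≥0 → ℝ → ℝ} (hl : M.IsTreatyPair l₁ l₂)
    (hk : M.IsTreatyPair k₁ k₂) {t : ℝ≥0} (ht : t ≤ M.T) (ε : ℝ≥0) :
    M.IsTreatyPair (deviation l₁ t ε (k₁ t)) (deviation l₂ t ε (k₂ t)) := by
  refine ⟨measurable_deviation hl.measurable₁ _ _ (hk.measurable₁.comp measurable_prodMk_left),
    measurable_deviation hl.measurable₂ _ _ (hk.measurable₂.comp measurable_prodMk_left),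
    fun s hs => ?_, fun s hs => ?_, fun s hs => ?_⟩ <;>
    by_cases h : s ∈ Ico t (t + ε) <;>
    first | simp only [deviation_of_mem _ _ h] | simp only [deviation_of_notMem _ _ h]
  exacts [hk.nonneg₁ t ht, hl.nonneg₁ s hs, hk.nonneg₂ t ht, hl.nonneg₂ s hs, hk.add_le t ht,
    hl.add_le s hs]

/-- The optimal treaties minimise the cost at every time, so each difference quotient is already
nonnegative and no limit has to be computed. -/
theorem isEquilibriumReinsurance_optTreaty [IsProbabilityMeasure P]
    (hξ₁ : M.IsPremiumStrategy1 fun t _ => ξ₁ t) (hξ₂ : M.IsPremiumStrategy2 fun t _ => ξ₂ t) :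
    M.IsEquilibriumReinsurance
      (fun t y _ => M.optTreaty1 ξ₁ ξ₂ t y) (fun t y _ => M.optTreaty2 ξ₁ ξ₂ t y)
      (fun t _ => ξ₁ t) (fun t _ => ξ₂ t) := by
  have hξ := isLoadingPair hξ₁ hξ₂
  have hopt := M.isTreatyPair_optTreaty hξ
  refine ⟨hopt.isAdmissible hξ₁ hξ₂, fun t ht x f₁ f₂ ε _ _ hadm => ?_⟩
  -- The perturbed treaties are again deterministic: `perturbTreaty` unfolds to `deviation`. Their
  -- admissibility supplies the measurability and constraints that the formula for the objective
  -- needs.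
  have hpert (n : ℕ) : M.IsTreatyPair (deviation (M.optTreaty1 ξ₁ ξ₂) t (ε n) f₁)
      (deviation (M.optTreaty2 ξ₁ ξ₂) t (ε n) f₂) :=
    IsAdmissible.isTreatyPair (hadm n)
  filter_upwards [hopt.insurerObjective_ae_eq hξ ht x,
    ae_all_iff.2 fun n => (hpert n).insurerObjective_ae_eq hξ ht x] with ω h1 h2
  refine le_liminf_of_le (by isBoundedDefault) (.of_forall fun n => ?_)
  rw [EReal.coe_nonneg]
  refine div_nonneg (sub_nonneg.2 ?_) (ε n).coe_nonneg
  rw [h1]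
  refine (h2 n).le.trans (add_le_add_right ?_ _)
  refine intervalIntegral.integral_mono_on (NNReal.coe_le_coe.2 ht)
    (((hpert n).isBoundedMeasurable_reward hξ).intervalIntegrable ht le_rfl)
    ((hopt.isBoundedMeasurable_reward hξ).intervalIntegrable ht le_rfl) fun r hr => ?_
  refine mul_le_mul_of_nonneg_left (sub_le_sub_left ?_ _) (M.accum_pos _).le
  exact (hpert n).cost_optTreaty_le hξ (Real.toNNReal_le_iff_le_coe.2 hr.2)

variable {M} in
/-- Deviating during `[t, t + ε)` changes the integrated reward during that period only. -/
theorem IsTreatyPair.integral_reward_sub_deviation [IsProbabilityMeasure P]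
    {l₁ l₂ k₁ k₂ : ℝ≥0 → ℝ → ℝ} (hl : M.IsTreatyPair l₁ l₂) (hk : M.IsTreatyPair k₁ k₂)
    (hξ : M.IsLoadingPair ξ₁ ξ₂) {t ε : ℝ≥0} (htε : t + ε ≤ M.T) :
    (∫ r in (t : ℝ)..M.T, M.reward ξ₁ ξ₂ r.toNNReal (l₁ r.toNNReal) (l₂ r.toNNReal)) -
      (∫ r in (t : ℝ)..M.T, M.reward ξ₁ ξ₂ r.toNNReal (deviation l₁ t ε (k₁ t) r.toNNReal)
        (deviation l₂ t ε (k₂ t) r.toNNReal)) =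
    ∫ r in (t : ℝ)..(t + ε : ℝ≥0),
      (M.reward ξ₁ ξ₂ r.toNNReal (l₁ r.toNNReal) (l₂ r.toNNReal) -
        M.reward ξ₁ ξ₂ r.toNNReal (k₁ t) (k₂ t)) := by
  have htle : t ≤ t + ε := le_self_add
  have ht := htle.trans htε
  have h1 := hl.isBoundedMeasurable_reward hξ
  have h2 := (hl.isTreatyPair_deviation hk ht ε).isBoundedMeasurable_reward hξ
  rw [← intervalIntegral.integral_sub (h1.intervalIntegrable ht le_rfl)
    (h2.intervalIntegrable ht le_rfl), ← intervalIntegral.integral_add_adjacent_intervals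
    ((h1.sub h2).intervalIntegrable ht htε) ((h1.sub h2).intervalIntegrable htε le_rfl)]
  have e2 : ∫ r in ((t + ε : ℝ≥0) : ℝ)..M.T,
      (M.reward ξ₁ ξ₂ r.toNNReal (l₁ r.toNNReal) (l₂ r.toNNReal) -
        M.reward ξ₁ ξ₂ r.toNNReal (deviation l₁ t ε (k₁ t) r.toNNReal)
        (deviation l₂ t ε (k₂ t) r.toNNReal)) =
      ∫ r in ((t + ε : ℝ≥0) : ℝ)..M.T, (0 : ℝ) := by
    refine intervalIntegral.integral_congr fun r hr => ?_
    rw [uIcc_of_le (NNReal.coe_le_coe.2 htε)] at hr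
    have hr0 : 0 ≤ r := (t + ε).coe_nonneg.trans hr.1
    have hnot : r.toNNReal ∉ Ico t (t + ε) := fun h =>
      absurd h.2 (not_lt.2 ((Real.le_toNNReal_iff_coe_le hr0).2 hr.1))
    simp only [deviation_of_notMem _ _ hnot, sub_self]
  rw [e2, intervalIntegral.integral_zero, add_zero]
  refine intervalIntegral.integral_congr_ae ?_
  -- The deviation period excludes its right endpoint while the interval of integration includes it.
  filter_upwards [Measure.ae_ne volume ((t + ε : ℝ≥0) : ℝ)] with r hr hrI
  rw [uIoc_of_le (NNReal.coe_le_coe.2 htle)] at hrI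
  have hr0 : 0 ≤ r := t.coe_nonneg.trans hrI.1.le
  have hmem : r.toNNReal ∈ Ico t (t + ε) :=
    ⟨(Real.le_toNNReal_iff_coe_le hr0).2 hrI.1.le,
      (Real.toNNReal_lt_iff_lt_coe hr0).2 (lt_of_le_of_ne hrI.2 hr)⟩
  simp only [deviation_of_mem _ _ hmem]

variable {M} in
/-- At almost every time, the reward lost by a deviation to a fixed pair of treaties is
differentiable in the length of the deviation. -/
theorem IsTreatyPair.ae_tendsto_integral_reward_sub [IsProbabilityMeasure P]
    {l₁ l₂ : ℝ≥0 → ℝ → ℝ} (hl : M.IsTreatyPair l₁ l₂) (hξ : M.IsLoadingPair ξ₁ ξ₂) :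
    ∀ᵐ t : ℝ, t ∈ Icc (0 : ℝ) M.T → ∀ (f₁ f₂ : ℝ → ℝ) (ε : ℕ → ℝ≥0), (∀ n, 0 < ε n) →
      Tendsto ε atTop (𝓝 0) → (∀ n, t.toNNReal + ε n ≤ M.T) →
      Tendsto (fun n => (∫ r in t..(t.toNNReal + ε n : ℝ≥0),
        (M.reward ξ₁ ξ₂ r.toNNReal (l₁ r.toNNReal) (l₂ r.toNNReal) -
          M.reward ξ₁ ξ₂ r.toNNReal f₁ f₂)) / (ε n : ℝ)) atTop
        (𝓝 (M.reward ξ₁ ξ₂ t.toNNReal (l₁ t.toNNReal) (l₂ t.toNNReal) -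
          M.reward ξ₁ ξ₂ t.toNNReal f₁ f₂)) := by
  -- The reward of fixed treaties is a linear combination of four functions of time, with
  -- coefficients depending on the treaties. Differentiating these and the reward of `l` gives one
  -- null set of times that serves all `f₁`, `f₂`; this is needed because the treaties inserted
  -- later depend on `t`.
  have b0 := hl.isBoundedMeasurable_reward hξ
  have b1 := M.isBoundedMeasurable_accum
  have b2 := b1.mul hξ.isBoundedMeasurable₁
  have b3 := b1.mul hξ.isBoundedMeasurable₂
  have b4 := b1.mul M.isBoundedMeasurable_gammaExp
  have hT : ((0 : ℝ≥0) : ℝ) ≤ M.T := M.T.coe_nonneg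
  filter_upwards [(b0.intervalIntegrable zero_le (le_refl M.T)).ae_hasDerivAt_integral,
    (b1.intervalIntegrable zero_le (le_refl M.T)).ae_hasDerivAt_integral,
    (b2.intervalIntegrable zero_le (le_refl M.T)).ae_hasDerivAt_integral,
    (b3.intervalIntegrable zero_le (le_refl M.T)).ae_hasDerivAt_integral,
    (b4.intervalIntegrable zero_le (le_refl M.T)).ae_hasDerivAt_integral]
    with t d0 d1 d2 d3 d4 htT f₁ f₂ ε hε hlim hεT
  have ht' : t ∈ uIcc ((0 : ℝ≥0) : ℝ) M.T := by rwa [uIcc_of_le hT, NNReal.coe_zero]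
  have hz : ((0 : ℝ≥0) : ℝ) ∈ uIcc ((0 : ℝ≥0) : ℝ) M.T := left_mem_uIcc
  have htt : t.toNNReal ≤ M.T := Real.toNNReal_le_iff_le_coe.2 htT.2
  set A := ∫ y, f₁ y ^ 2 ∂M.v
  set B := ∫ y, f₂ y ∂M.v
  set C := ∫ y, (y - f₁ y - f₂ y) ^ 2 ∂M.v
  set m := M.c - ∫ y, y ∂M.v
  have hH (s : ℝ≥0) : M.reward ξ₁ ξ₂ s (l₁ s) (l₂ s) - M.reward ξ₁ ξ₂ s f₁ f₂ =
      M.reward ξ₁ ξ₂ s (l₁ s) (l₂ s) - m * M.accum s + A * (M.accum s * ξ₁ s) +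
        B * (M.accum s * ξ₂ s) + C / 2 * (M.accum s * M.gammaExp s) := by
    simp only [reward, cost, A, B, C, m]
    ring
  have hder := ((((d0 ht' _ hz).sub ((d1 ht' _ hz).const_mul m)).add
    ((d2 ht' _ hz).const_mul A)).add ((d3 ht' _ hz).const_mul B)).add
    ((d4 ht' _ hz).const_mul (C / 2))
  have hεne : Tendsto (fun n => (ε n : ℝ)) atTop (𝓝[≠] 0) :=
    tendsto_nhdsWithin_iff.2 ⟨by simpa using NNReal.tendsto_coe.2 hlim,
      .of_forall fun n => NNReal.coe_ne_zero.2 (hε n).ne'⟩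
  have hslope := hder.tendsto_slope_zero.comp hεne
  rw [hH]
  refine hslope.congr fun n => ?_
  have hs := hεT n
  have hcoe : t + (ε n : ℝ) = ((t.toNNReal + ε n : ℝ≥0) : ℝ) := by
    rw [NNReal.coe_add, Real.coe_toNNReal t htT.1]
  have hsub (F : ℝ≥0 → ℝ) (hF : M.IsBoundedMeasurable F) :
      (∫ r in ((0 : ℝ≥0) : ℝ)..((t.toNNReal + ε n : ℝ≥0) : ℝ), F r.toNNReal) -
        ∫ r in ((0 : ℝ≥0) : ℝ)..t, F r.toNNReal =
      ∫ r in t..((t.toNNReal + ε n : ℝ≥0) : ℝ), F r.toNNReal := by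
    refine intervalIntegral.integral_interval_sub_left (hF.intervalIntegrable zero_le hs) ?_
    have := hF.intervalIntegrable zero_le htt
    rwa [Real.coe_toNNReal t htT.1] at this
  have hint (F : ℝ≥0 → ℝ) (hF : M.IsBoundedMeasurable F) :
      IntervalIntegrable (fun r : ℝ => F r.toNNReal) volume t ((t.toNNReal + ε n : ℝ≥0) : ℝ) := by
    have := hF.intervalIntegrable htt hs
    rwa [Real.coe_toNNReal t htT.1] at this
  have hsum : ∫ r in t..((t.toNNReal + ε n : ℝ≥0) : ℝ),
      (M.reward ξ₁ ξ₂ r.toNNReal (l₁ r.toNNReal) (l₂ r.toNNReal) -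
        M.reward ξ₁ ξ₂ r.toNNReal f₁ f₂) =
      (∫ r in t..((t.toNNReal + ε n : ℝ≥0) : ℝ),
        M.reward ξ₁ ξ₂ r.toNNReal (l₁ r.toNNReal) (l₂ r.toNNReal)) -
      m * (∫ r in t..((t.toNNReal + ε n : ℝ≥0) : ℝ), M.accum r.toNNReal) +
      A * (∫ r in t..((t.toNNReal + ε n : ℝ≥0) : ℝ), M.accum r.toNNReal * ξ₁ r.toNNReal) +
      B * (∫ r in t..((t.toNNReal + ε n : ℝ≥0) : ℝ), M.accum r.toNNReal * ξ₂ r.toNNReal) +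
      C / 2 * ∫ r in t..((t.toNNReal + ε n : ℝ≥0) : ℝ),
        M.accum r.toNNReal * M.gammaExp r.toNNReal := by
    simp_rw [hH]
    rw [intervalIntegral.integral_add
        ((((hint _ b0).sub ((hint _ b1).const_mul m)).add ((hint _ b2).const_mul A)).add
          ((hint _ b3).const_mul B)) ((hint _ b4).const_mul (C / 2)),
      intervalIntegral.integral_add (((hint _ b0).sub ((hint _ b1).const_mul m)).add
        ((hint _ b2).const_mul A)) ((hint _ b3).const_mul B),
      intervalIntegral.integral_add ((hint _ b0).sub ((hint _ b1).const_mul m))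
        ((hint _ b2).const_mul A),
      intervalIntegral.integral_sub (hint _ b0) ((hint _ b1).const_mul m)]
    simp only [intervalIntegral.integral_const_mul]
  rw [hsum, ← hsub _ b0, ← hsub _ b1, ← hsub _ b2, ← hsub _ b3, ← hsub _ b4]
  simp only [Function.comp_apply, Pi.add_apply, Pi.sub_apply, smul_eq_mul, hcoe]
  ring

theorem ae_eq_optTreaty_of_isEquilibriumReinsurance [IsProbabilityMeasure P]
    {l₁ l₂ : ℝ≥0 → ℝ → ℝ}
    (h : M.IsEquilibriumReinsurance (fun t y _ => l₁ t y) (fun t y _ => l₂ t y)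
      (fun t _ => ξ₁ t) (fun t _ => ξ₂ t)) :
    ∀ᵐ t ∂(volume.restrict (Icc (0 : ℝ) M.T)), ∀ᵐ y ∂M.claimLaw,
      l₁ t.toNNReal y = M.optTreaty1 ξ₁ ξ₂ t.toNNReal y ∧
      l₂ t.toNNReal y = M.optTreaty2 ξ₁ ξ₂ t.toNNReal y := by
  obtain ⟨hadm, heq⟩ := h
  have hξ₁ := hadm.premium₁
  have hξ₂ := hadm.premium₂
  have hξ := isLoadingPair hξ₁ hξ₂
  have hl : M.IsTreatyPair l₁ l₂ := hadm.isTreatyPair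
  have hopt := M.isTreatyPair_optTreaty hξ
  rw [ae_restrict_iff' measurableSet_Icc]
  -- The time `T` is excluded to leave room for a deviation; `ε n` below is chosen so that it ends
  -- by `T`.
  filter_upwards [hl.ae_tendsto_integral_reward_sub hξ, Measure.ae_ne volume (M.T : ℝ)]
    with t ht htne htT
  set s := t.toNNReal with hs_def
  have hts : (s : ℝ) = t := Real.coe_toNNReal t htT.1
  have hsT : s < M.T := by
    rw [← NNReal.coe_lt_coe, hts]; exact lt_of_le_of_ne htT.2 htne
  let ε (n : ℕ) : ℝ≥0 := (M.T - s) / (n + 1)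
  have hε0 (n : ℕ) : 0 < ε n := div_pos (tsub_pos_of_lt hsT) (by positivity)
  have hεlim : Tendsto ε atTop (𝓝 0) := by
    have := (tendsto_one_div_add_atTop_nhds_zero_nat (𝕜 := ℝ≥0)).const_mul (M.T - s)
    simpa [ε, div_eq_mul_inv] using this
  have hεT (n : ℕ) : s + ε n ≤ M.T := by
    have h1 : ε n ≤ M.T - s := div_le_self zero_le (by simp)
    exact (add_le_add_right h1 s).trans (add_tsub_cancel_of_le hsT.le).le
  have hpert (n : ℕ) := hl.isTreatyPair_deviation hopt hsT.le (ε n)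
  have hlim := ht htT (M.optTreaty1 ξ₁ ξ₂ s) (M.optTreaty2 ξ₁ ξ₂ s) ε hε0 hεlim hεT
  -- The deviation is to the optimal treaties frozen at time `s`. The initial surplus, here `0`,
  -- plays no role because its contribution cancels in the difference.
  have hinf := heq s hsT.le 0 (M.optTreaty1 ξ₁ ξ₂ s) (M.optTreaty2 ξ₁ ξ₂ s) ε hε0 hεlim
    fun n => (hpert n).isAdmissible hξ₁ hξ₂
  -- All objectives involved are almost surely constant, so evaluation at one good `ω` yields a
  -- deterministic inequality.
  obtain ⟨ω, h1, h2, h3⟩ := (hinf.and ((hl.insurerObjective_ae_eq hξ hsT.le 0).and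
    (ae_all_iff.2 fun n => (hpert n).insurerObjective_ae_eq hξ hsT.le 0))).exists
  have hquot (n : ℕ) :
      (M.insurerObjective (fun t y _ => l₁ t y) (fun t y _ => l₂ t y)
          (fun t _ => ξ₁ t) (fun t _ => ξ₂ t) s 0 ω
        - M.insurerObjective (perturbTreaty (fun t y _ => l₁ t y) s (ε n) (M.optTreaty1 ξ₁ ξ₂ s))
            (perturbTreaty (fun t y _ => l₂ t y) s (ε n) (M.optTreaty2 ξ₁ ξ₂ s))
            (fun t _ => ξ₁ t) (fun t _ => ξ₂ t) s 0 ω) / (ε n : ℝ) =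
      (∫ r in t..(s + ε n : ℝ≥0),
        (M.reward ξ₁ ξ₂ r.toNNReal (l₁ r.toNNReal) (l₂ r.toNNReal) -
          M.reward ξ₁ ξ₂ r.toNNReal (M.optTreaty1 ξ₁ ξ₂ s) (M.optTreaty2 ξ₁ ξ₂ s))) /
        (ε n : ℝ) := by
    have e := hl.integral_reward_sub_deviation hopt hξ (hεT n)
    rw [hts] at e h2
    have h3' := h3 n
    rw [hts] at h3'
    rw [← e, h2]
    congr 1
    refine (congrArg _ h3').trans ?_
    ring
  simp_rw [hquot] at h1
  rw [(EReal.tendsto_coe.2 hlim).liminf_eq, EReal.coe_nonneg, sub_nonneg] at h1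
  have hcost := le_of_mul_le_mul_left h1 (M.accum_pos s)
  exact hl.ae_eq_optTreaty hξ hsT.le (by linarith)

end InsuranceMarket

theorem proposition3p2 {Ω : Type*} [MeasurableSpace Ω] (P : Measure Ω) [IsProbabilityMeasure P]
    [P.IsComplete] (M : InsuranceMarket P) (ξ₁ ξ₂ : ℝ≥0 → ℝ)
    (hξ₁ : M.IsPremiumStrategy1 (fun t _ => ξ₁ t))
    (hξ₂ : M.IsPremiumStrategy2 (fun t _ => ξ₂ t)) :
    M.IsEquilibriumReinsurance
        (fun t y _ => M.optTreaty1 ξ₁ ξ₂ t y) (fun t y _ => M.optTreaty2 ξ₁ ξ₂ t y)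
        (fun t _ => ξ₁ t) (fun t _ => ξ₂ t) ∧
      ∀ l₁ l₂ : ℝ≥0 → ℝ → ℝ,
        M.IsEquilibriumReinsurance (fun t y _ => l₁ t y) (fun t y _ => l₂ t y)
          (fun t _ => ξ₁ t) (fun t _ => ξ₂ t) →
        ∀ᵐ t ∂(volume.restrict (Icc (0 : ℝ) M.T)), ∀ᵐ y ∂M.claimLaw,
          l₁ t.toNNReal y = M.optTreaty1 ξ₁ ξ₂ t.toNNReal y ∧
          l₂ t.toNNReal y = M.optTreaty2 ξ₁ ξ₂ t.toNNReal y :=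
  ⟨M.isEquilibriumReinsurance_optTreaty hξ₁ hξ₂,
    fun _ _ h => M.ae_eq_optTreaty_of_isEquilibriumReinsurance h⟩
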